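/- **Setting.** Let $\lambda>0$, $\mu>1$, $c>0$, $m\in(-1,1)$. Let $N$ be a Poisson process with rate $\mu$ on a probability space $(\Omega,\mathcal H,\mathbb P_0)$, with jump times $\sigma_n$ ($\sigma_0=0$), let $\mathbb F$ be the right-continuous enlargement, with $\mathbb P_0$-null sets, of the natural filtration of $N$, and let $\mathcal S$ be the set of all $[0,\infty]$-valued $\mathbb F$-stopping times. For $\phi=(\phi_0,\phi_1)\in\mathbb R_+^2$ let $x(\cdot,\phi_0)$, $y(\cdot,\phi_1)$ be the solutions of $$\dot x=(\lambda+1)x+\tfrac{\lambda(1-m)}{\sqrt2},\quad x(0)=\phi_0,\qquad \dot y=(\lambda-1)y+\tfrac{\lambda(1+m)}{\sqrt2},\quad y(0)=\phi_1 ,$$ and let $\widetilde\Phi=(\widetilde\Phi^{(0)},\widetilde\Phi^{(1)})$ be the process started at $\widetilde\Phi_0=\phi$ which follows this flow between consecutive jump times of $N$ and satisfies $\widetilde\Phi_{\sigma_n}=\big((1-\tfrac1\mu)\widetilde\Phi^{(0)}_{\sigma_n-},(1+\tfrac1\mu)\widetilde\Phi^{(1)}_{\sigma_n-}\big)$ for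 $n\ge1$. Write $\mathbb E_0^{\phi}$ for the $\mathbb P_0$-expectation when $\widetilde\Phi$ is started at $\phi$. Let $g(\phi_0,\phi_1)=\phi_0+\phi_1-\frac{\lambda}{c}\sqrt2$ and consider the optimal stopping problem $$V(\phi)=\inf_{\tau\in\mathcal S}\mathbb E_0^{\phi}\Big[\int_0^\tau e^{-\lambda t}g(\widetilde\Phi_t)\,dt\Big],\qquad \phi\in\mathbb R_+^2,$$ where the expectation may take the value $+\infty$. For $\varepsilon\ge0$ put $U_\varepsilon=\inf\{t\ge0: V(\widetilde\Phi_t)\ge-\varepsilon\}$ ($\inf\emptyset=\infty$), and let $\Gamma=\{\phi\in\mathbb R_+^2:V(\phi)=0\}$. Let $K=\frac{\lambda+\mu}{c}\sqrt2$ and define $\xi^*$ as follows. If $\lambda\ge1$, or if $\lambda<1$ and $\frac{\lambda}{1-\lambda}\ge\frac{\lambda+\mu}{c}$, then $\xi^*=K$. Otherwise let $(\phi_0^*,\phi_1^*)$ be the intersection point of the lines $(\lambda+1)x+(\lambda-1)y+\lambda\sqrt2=0$ and $x+y=K$, let $t^*$ be the solution of $x(-t^*,\phi_0^*)=0$, and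 $\xi^*=y(-t^*,\phi_1^*)$. Let $D=\{\phi\in\mathbb R_+^2:\phi_0+\phi_1<\xi^*\}$ and let $\tau_D=\inf\{t\ge0:\widetilde\Phi_t\notin D\}$. **Proposition 5.12.** 1. For every $\varepsilon\ge0$ and every $\phi\in\mathbb R_+^2$, $U_\varepsilon$ is an $\mathbb F$-stopping time and is $\varepsilon$-optimal: $$\mathbb E_0^{\phi}\Big[\int_0^{U_\varepsilon}e^{-\lambda s}g(\widetilde\Phi_s)\,ds\Big]\le V(\phi)+\varepsilon .$$ 2. In particular, for every $\phi\in\mathbb R_+^2$, $U_0$ is almost surely equal to the first entrance time of $\widetilde\Phi$ into $\Gamma$, and it is optimal: $\mathbb E_0^{\phi}\big[\int_0^{U_0}e^{-\lambda s}g(\widetilde\Phi_s)\,ds\big]=V(\phi)$. 3. $\xi^*\ge K$, and for every $\phi\in\mathbb R_+^2$, $\tau_D$ is an $\mathbb F$-stopping time, $U_0\le\tau_D$ almost surely, and $\mathbb E_0^{\phi}[U_0]\le\mathbb E_0^{\phi}[\tau_D]<\infty$. -/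

import Mathlib

open MeasureTheory ProbabilityTheory Filter
open scoped NNReal ENNReal Topology MeasureTheory

noncomputable section

namespace PoissonDisorder

/-! ### Poisson processes and the observation filtration -/

/-- `N` is a homogeneous Poisson process of rate `r` under `P`: almost every path is a
nondecreasing right-continuous step function started at `0` (right-continuity into the discrete
space `ℕ` means that the path is constant on some `[t, t + δ)`), the increments are independent,
and `N t - N s` has the Poisson law with mean `r (t - s)` for `s ≤ t`. -/
structure IsPoissonProcess {Ω : Type*} [MeasurableSpace Ω] (N : ℝ≥0 → Ω → ℕ) (r : ℝ)
    (P : Measure Ω) : Prop where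
  measurable : ∀ t, Measurable (N t)
  path : ∀ᵐ ω ∂P, N 0 ω = 0 ∧ Monotone (fun t => N t ω) ∧
    ∀ t : ℝ≥0, ContinuousWithinAt (fun s => N s ω) (Set.Ici t) t
  indep : HasIndepIncrements N P
  law : ∀ s t : ℝ≥0, s ≤ t →
    HasLaw (fun ω => N t ω - N s ω) (poissonMeasure (r.toNNReal * (t - s))) P

/-- The filtration `t ↦ σ(N_s : s ≤ t)` enlarged with all `P`-null sets: a set belongs to the
`t`-th σ-algebra iff it differs from an element of `σ(N_s : s ≤ t)` by a `P`-null set. It is a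
filtration of the `P`-completion of the ambient σ-algebra. -/
def augmentedFiltration {Ω : Type*} [mΩ : MeasurableSpace Ω] (N : ℝ≥0 → Ω → ℕ) (P : Measure Ω)
    (hN : ∀ t, Measurable (N t)) : Filtration ℝ≥0 (eventuallyMeasurableSpace mΩ (ae P)) where
  seq t := eventuallyMeasurableSpace
    (Filtration.natural N (fun s => (hN s).stronglyMeasurable) t) (ae P)
  mono' s t hst := by
    rintro A ⟨B, hB, hAB⟩
    exact ⟨B, (Filtration.natural N (fun s => (hN s).stronglyMeasurable)).mono hst B hB, hAB⟩
  le' t := by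
    rintro A ⟨B, hB, hAB⟩
    exact ⟨B, (Filtration.natural N (fun s => (hN s).stronglyMeasurable)).le t B hB, hAB⟩

/-- The right-continuous enlargement, with `P`-null sets, of the natural filtration of `N`. -/
def obsFiltration {Ω : Type*} [mΩ : MeasurableSpace Ω] (N : ℝ≥0 → Ω → ℕ) (P : Measure Ω)
    (hN : ∀ t, Measurable (N t)) : Filtration ℝ≥0 (eventuallyMeasurableSpace mΩ (ae P)) :=
  (augmentedFiltration N P hN).rightCont

/-! ### Parameters and the sufficient-statistic process -/

/-- `lam` is the rate of the exponential disorder time, `mu` the arrival rate before the disorder,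
`c` the cost of delay per unit time, `m` the mean of the (`±1`-valued) change of the arrival
rate. -/
structure Params where
  lam : ℝ
  mu : ℝ
  c : ℝ
  m : ℝ

/-- The solution `x(t, φ₀)` of `x' = (lam + 1) x + lam (1 - m) / √2`, `x(0) = φ₀`. -/
def flowX (p : Params) (t φ₀ : ℝ) : ℝ :=
  -(p.lam * (1 - p.m) / (√2 * (p.lam + 1))) +
    Real.exp ((p.lam + 1) * t) * (φ₀ + p.lam * (1 - p.m) / (√2 * (p.lam + 1)))

/-- The solution `y(t, φ₁)` of `y' = (lam - 1) y + lam (1 + m) / √2`, `y(0) = φ₁`. -/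
def flowY (p : Params) (t φ₁ : ℝ) : ℝ :=
  if p.lam = 1 then φ₁ + (1 + p.m) / √2 * t
  else -(p.lam * (1 + p.m) / (√2 * (p.lam - 1))) +
    Real.exp ((p.lam - 1) * t) * (φ₁ + p.lam * (1 + p.m) / (√2 * (p.lam - 1)))

/-- The deterministic motion between jumps. -/
def flow (p : Params) (t : ℝ) (φ : ℝ × ℝ) : ℝ × ℝ := (flowX p t φ.1, flowY p t φ.2)

/-- The effect of a jump on the position. -/
def jumpMap (p : Params) (φ : ℝ × ℝ) : ℝ × ℝ := ((1 - 1 / p.mu) * φ.1, (1 + 1 / p.mu) * φ.2)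

/-- The `n`-th jump time `σ_n = inf {t : N_t ≥ n}`; in particular `σ_0 = 0`. -/
def jumpTime {Ω : Type*} (N : ℝ≥0 → Ω → ℕ) (n : ℕ) (ω : Ω) : ℝ≥0 := sInf {t : ℝ≥0 | n ≤ N t ω}

/-- The position of the process, started from `φ`, at the jump time `σ_n`. -/
def postJump {Ω : Type*} (p : Params) (N : ℝ≥0 → Ω → ℕ) (φ : ℝ × ℝ) (ω : Ω) : ℕ → ℝ × ℝ
  | 0 => φ
  | n + 1 => jumpMap p
      (flow p ((jumpTime N (n + 1) ω : ℝ) - jumpTime N n ω) (postJump p N φ ω n))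

/-- The process `Φ̃` started from `φ`, i.e. the solution of
`dΦ⁰ = [(lam + 1) Φ⁰ + lam (1 - m) / √2] dt - (1 / mu) Φ⁰₋ dN`,
`dΦ¹ = [(lam - 1) Φ¹ + lam (1 + m) / √2] dt + (1 / mu) Φ¹₋ dN`, `Φ_0 = φ`:
since `σ_n ≤ t < σ_{n+1}` for `n = N_t`, it has moved along the flow since time `σ_{N_t}`. -/
def process {Ω : Type*} (p : Params) (N : ℝ≥0 → Ω → ℕ) (φ : ℝ × ℝ) (t : ℝ≥0) (ω : Ω) : ℝ × ℝ :=
  flow p ((t : ℝ) - jumpTime N (N t ω) ω) (postJump p N φ ω (N t ω))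

/-! ### The optimal stopping problem -/

/-- The integral of an extended-real function: integral of the positive part minus integral of
the negative part. It is the usual extended integral as soon as one of the two is finite. -/
def eIntegral {α : Type*} [MeasurableSpace α] (ν : Measure α) (f : α → EReal) : EReal :=
  ((∫⁻ a, (f a).toENNReal ∂ν : ℝ≥0∞) : EReal) - ((∫⁻ a, (-f a).toENNReal ∂ν : ℝ≥0∞) : EReal)

/-- The running cost `g(φ₀, φ₁) = φ₀ + φ₁ - (lam / c) √2`. -/
def runningCost (p : Params) (φ : ℝ × ℝ) : ℝ := φ.1 + φ.2 - p.lam / p.c * √2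

/-- The expected cost `E [∫_0^τ e^{-lam t} g(Φ̃_t) dt]` for the process started from `φ`. -/
def expectedCost {Ω : Type*} [MeasurableSpace Ω] (p : Params) (P : Measure Ω)
    (N : ℝ≥0 → Ω → ℕ) (φ : ℝ × ℝ) (τ : Ω → ℝ≥0∞) : EReal :=
  eIntegral P fun ω =>
    eIntegral (volume.restrict {t : ℝ | 0 ≤ t ∧ ENNReal.ofReal t < τ ω}) fun t =>
      ((Real.exp (-p.lam * t) * runningCost p (process p N φ t.toNNReal ω) : ℝ) : EReal)

/-- `τ`, with values in `[0, ∞]`, is a stopping time of the filtration `𝓕`. -/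
def IsStop {Ω : Type*} {m : MeasurableSpace Ω} (𝓕 : Filtration ℝ≥0 m) (τ : Ω → ℝ≥0∞) : Prop :=
  IsStoppingTime (ι := ℝ≥0) 𝓕 τ

/-- The value function: the infimum of the expected cost over all stopping times of the
observation filtration. -/
def value {Ω : Type*} [MeasurableSpace Ω] (p : Params) (P : Measure Ω) (N : ℝ≥0 → Ω → ℕ)
    (hN : ∀ t, Measurable (N t)) (φ : ℝ × ℝ) : EReal :=
  ⨅ (τ : Ω → ℝ≥0∞) (_ : IsStop (obsFiltration N P hN) τ), expectedCost p P N φ τ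

/-- The first time at which a path `X` is in the set `A` (`∞` if there is none). -/
def hitTime {Ω E : Type*} (X : ℝ≥0 → Ω → E) (A : Set E) (ω : Ω) : ℝ≥0∞ :=
  ⨅ (t : ℝ≥0) (_ : X t ω ∈ A), (t : ℝ≥0∞)

/-- The state space `ℝ₊²`. -/
def quadrant : Set (ℝ × ℝ) := {φ | 0 ≤ φ.1 ∧ 0 ≤ φ.2}

/-- `U_ε = inf {t ≥ 0 : V(Φ̃_t) ≥ -ε}` for the process started from `φ`. -/
def hitU {Ω : Type*} [MeasurableSpace Ω] (p : Params) (P : Measure Ω) (N : ℝ≥0 → Ω → ℕ)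
    (hN : ∀ t, Measurable (N t)) (ε : ℝ) (φ : ℝ × ℝ) : Ω → ℝ≥0∞ :=
  hitTime (process p N φ) {ψ | ((-ε : ℝ) : EReal) ≤ value p P N hN ψ}

/-- The stopping region `Γ = {φ ∈ ℝ₊² : V(φ) = 0}`. -/
def stopRegion {Ω : Type*} [MeasurableSpace Ω] (p : Params) (P : Measure Ω) (N : ℝ≥0 → Ω → ℕ)
    (hN : ∀ t, Measurable (N t)) : Set (ℝ × ℝ) :=
  {φ | φ ∈ quadrant ∧ value p P N hN φ = 0}

/-! ### The triangle `D` -/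

/-- The level `K = (lam + mu) √2 / c`. -/
def level (p : Params) : ℝ := (p.lam + p.mu) / p.c * √2

/-- First coordinate `φ₀*` of the intersection of the line
`(lam + 1) x + (lam - 1) y + lam √2 = 0` with the line `x + y = K`. -/
def crossX (p : Params) : ℝ := ((1 - p.lam) * level p - p.lam * √2) / 2

/-- Second coordinate `φ₁*` of that intersection. -/
def crossY (p : Params) : ℝ := level p - crossX p

/-- The time `t*` with `x(-t*, φ₀*) = 0`. -/
def backTime (p : Params) : ℝ :=
  Real.log (1 + crossX p / (p.lam * (1 - p.m) / (√2 * (p.lam + 1)))) / (p.lam + 1)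

open scoped Classical in
/-- The threshold `ξ*`: it is `K` if `lam ≥ 1` or `lam / (1 - lam) ≥ (lam + mu) / c`, and
otherwise `ξ* = y(-t*, φ₁*)`, i.e. the curve from `(0, ξ*)` reaches `(φ₀*, φ₁*)` at time `t*`. -/
def threshold (p : Params) : ℝ :=
  if 1 ≤ p.lam ∨ (p.lam + p.mu) / p.c ≤ p.lam / (1 - p.lam) then level p
  else flowY p (-backTime p) (crossY p)

/-- The triangle `D = {φ ∈ ℝ₊² : φ₀ + φ₁ < ξ*}`. -/
def triangle (p : Params) : Set (ℝ × ℝ) := {φ | φ ∈ quadrant ∧ φ.1 + φ.2 < threshold p}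

/-- The exit time `τ_D` of the process started from `φ` from the triangle `D`. -/
def exitTime {Ω : Type*} (p : Params) (N : ℝ≥0 → Ω → ℕ) (φ : ℝ × ℝ) : Ω → ℝ≥0∞ :=
  hitTime (process p N φ) (triangle p)ᶜ

end PoissonDisorder

end

open PoissonDisorder

open MeasureTheory ProbabilityTheory Filter
open scoped NNReal ENNReal Topology MeasureTheory

noncomputable section

namespace PoissonDisorder

/-! ### Deterministic side: flow, counting paths, pathwise estimates -/

section

/-! ### The flow -/

/-! The negative part of the cost is deterministic: `∫_0^τ e^{-λt} (λ/c)√2 dt = (√2/c)(1 -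
e^{-λτ})`. Adding the constant `bound p = √2/c` therefore turns the problem into minimising `E[∫_0^τ
e^{-λt}(Φ⁰ + Φ¹) dt + e^{-λτ} √2/c]`, all of whose terms are nonnegative. Tonelli and Fatou then
apply without integrability conditions, and stopping at once costs exactly `bound p`, so that `Γ` is
the set where the shifted value equals `bound p`.

The shifted value `valueLim` is built as an infimum of finite-horizon dynamic programs `stage` on
dyadic grids. For these only the Markov property at deterministic times is needed
(`setLIntegral_stepOp`), and it follows from independent increments. Continuity on the quadrant has
two halves: each `stage` is Lipschitz, so the infimum is upper semicontinuous; monotonicity together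
with `r V(φ) ≤ V(rφ)` for `0 ≤ r ≤ 1` gives lower semicontinuity (`continuousOn_valueLim`).

`valueLim` bounds every stopping cost from below, since stopping times can be approximated from the
right by grid times and paths are right-continuous (`valueLim_le_stopCost`). Conversely, the optimal
grid times lose nothing in the limit, so they cannot stop while the value stays `ε` below its
maximum. Cutting them off at the hitting time of the `ε`-near-maximal set and applying Fatou shows
that waiting for that set is free (`stopCost_le_valueLim`), which is `ε`-optimality for `ε > 0`. For
`ε = 0` the supremum of the times for `ε = 1/(m+1)` is optimal by lower semicontinuity of the cost;
an optimal time must stop where the value is maximal, which identifies the supremum with the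
entrance time into `Γ` (`stopCost_hit_zero_le`).

Beyond the threshold `ξ*` the flow never falls below `x + y = K`. Before the first jump the cost
rate is then at least `K = (λ+μ)√2/c`, and discounting at rate `λ` together with killing at the jump
rate `μ` already produces `√2/c` (`bound_le_stepOp`); hence such points lie in `Γ` and `U_0 ≤ τ_D`.
Finally, sufficiently many jumps within one unit of time push the second coordinate past `ξ*`. The
counts over disjoint unit intervals are independent, so `τ_D` has a geometric tail
(`measure_lt_hit_le`). -/

/-- The integral `∫_0^t e^{γ s} ds`. -/
def expInt (γ t : ℝ) : ℝ := if γ = 0 then t else (Real.exp (γ * t) - 1) / γ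

/-- This cocycle identity is the whole content of the semigroup law `flow_add`. -/
theorem expInt_add (γ s t : ℝ) :
    expInt γ (s + t) = Real.exp (γ * t) * expInt γ s + expInt γ t := by
  unfold expInt
  split_ifs with h
  · simp [h]
  · field_simp
    rw [mul_add, Real.exp_add]
    ring

@[simp] theorem expInt_zero (γ : ℝ) : expInt γ 0 = 0 := by simp [expInt]

theorem exp_sub_one_div_eq_integral {γ t : ℝ} (h : γ ≠ 0) :
    (Real.exp (γ * t) - 1) / γ = ∫ s in (0 : ℝ)..t, Real.exp (γ * s) := by
  rw [intervalIntegral.integral_comp_mul_left (fun x => Real.exp x) h, integral_exp]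
  simp [div_eq_inv_mul]

theorem expInt_eq_integral (γ t : ℝ) : expInt γ t = ∫ s in (0 : ℝ)..t, Real.exp (γ * s) := by
  unfold expInt
  split_ifs with h
  · simp [h]
  · exact exp_sub_one_div_eq_integral h

theorem expInt_nonneg (γ : ℝ) {t : ℝ} (ht : 0 ≤ t) : 0 ≤ expInt γ t := by
  rw [expInt_eq_integral]
  exact intervalIntegral.integral_nonneg ht fun _ _ => (Real.exp_pos _).le

theorem expInt_pos (γ : ℝ) {t : ℝ} (ht : 0 < t) : 0 < expInt γ t := by
  rw [expInt_eq_integral]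
  refine intervalIntegral.intervalIntegral_pos_of_pos ?_ (fun _ => Real.exp_pos _) ht
  exact (by fun_prop : Continuous fun s => Real.exp (γ * s)).intervalIntegrable _ _

theorem expInt_mono {γ : ℝ} : Monotone (expInt γ) := by
  intro s t hst
  have h := expInt_add γ (t - s) s
  rw [sub_add_cancel] at h
  rw [h]
  have := mul_nonneg (Real.exp_pos (γ * s)).le (expInt_nonneg γ (sub_nonneg.2 hst))
  linarith

theorem expInt_mono_left {γ γ' t : ℝ} (h : γ ≤ γ') (ht : 0 ≤ t) : expInt γ t ≤ expInt γ' t := by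
  rw [expInt_eq_integral, expInt_eq_integral]
  refine intervalIntegral.integral_mono_on ht ?_ ?_ ?_
  · exact (by fun_prop : Continuous fun s => Real.exp (γ * s)).intervalIntegrable _ _
  · exact (by fun_prop : Continuous fun s => Real.exp (γ' * s)).intervalIntegrable _ _
  · intro s hs
    exact Real.exp_le_exp.2 (mul_le_mul_of_nonneg_right h hs.1)

@[fun_prop] theorem continuous_expInt (γ : ℝ) : Continuous (expInt γ) := by
  unfold expInt
  split_ifs with h <;> fun_prop

/-- The standing assumptions on the parameters. -/
structure Params.Valid (p : Params) : Prop where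
  lam_pos : 0 < p.lam
  one_lt_mu : 1 < p.mu
  c_pos : 0 < p.c
  lt_m : -1 < p.m
  m_lt : p.m < 1

/-- The constant part of the drift of the first coordinate. -/
def Params.driftX (p : Params) : ℝ := p.lam * (1 - p.m) / √2

/-- The constant part of the drift of the second coordinate. -/
def Params.driftY (p : Params) : ℝ := p.lam * (1 + p.m) / √2

theorem Params.Valid.driftX_pos {p : Params} (hp : p.Valid) : 0 < p.driftX := by
  have := hp.lam_pos; have := hp.m_lt
  unfold Params.driftX
  exact div_pos (mul_pos hp.lam_pos (by linarith)) (by positivity)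

theorem Params.Valid.driftY_pos {p : Params} (hp : p.Valid) : 0 < p.driftY := by
  have := hp.lt_m
  unfold Params.driftY
  exact div_pos (mul_pos hp.lam_pos (by linarith)) (by positivity)

theorem Params.Valid.kappa_pos {p : Params} (hp : p.Valid) : 0 < 1 - 1 / p.mu := by
  have := hp.one_lt_mu
  rw [sub_pos, div_lt_one (by linarith)]
  exact this

theorem Params.Valid.inv_mu_pos {p : Params} (hp : p.Valid) : 0 < 1 / p.mu :=
  one_div_pos.2 (by linarith [hp.one_lt_mu])

theorem flowX_eq {p : Params} (hp : p.Valid) (t x : ℝ) :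
    flowX p t x = Real.exp ((p.lam + 1) * t) * x + p.driftX * expInt (p.lam + 1) t := by
  have h := hp.lam_pos
  have h1 : p.lam + 1 ≠ 0 := by positivity
  unfold flowX expInt Params.driftX
  rw [if_neg h1]
  field_simp
  ring

/-- The form "exponential times start plus drift times `expInt`" removes the case `λ = 1` from
everything that follows. -/
theorem flowY_eq (p : Params) (t y : ℝ) :
    flowY p t y = Real.exp ((p.lam - 1) * t) * y + p.driftY * expInt (p.lam - 1) t := by
  unfold flowY expInt Params.driftY
  by_cases h : p.lam = 1
  · simp [h]
  · have h1 : p.lam - 1 ≠ 0 := sub_ne_zero.2 h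
    rw [if_neg h, if_neg h1]
    field_simp
    ring

theorem flow_add {p : Params} (hp : p.Valid) (s t : ℝ) (φ : ℝ × ℝ) :
    flow p (s + t) φ = flow p t (flow p s φ) := by
  unfold flow
  ext <;> simp only [flowX_eq hp, flowY_eq p, expInt_add, mul_add, Real.exp_add] <;> ring

theorem flow_zero {p : Params} (hp : p.Valid) (φ : ℝ × ℝ) : flow p 0 φ = φ := by
  ext <;> simp [flow, flowX_eq hp, flowY_eq p]

theorem continuous_flow {p : Params} (hp : p.Valid) :
    Continuous fun z : ℝ × (ℝ × ℝ) => flow p z.1 z.2 := by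
  simp only [flow, flowX_eq hp, flowY_eq p]
  fun_prop

theorem continuous_jumpMap (p : Params) : Continuous (jumpMap p) := by
  unfold jumpMap
  fun_prop

theorem flow_mem_quadrant {p : Params} (hp : p.Valid) {t : ℝ} (ht : 0 ≤ t) {φ : ℝ × ℝ}
    (h : φ ∈ quadrant) : flow p t φ ∈ quadrant := by
  have h1 := hp.driftX_pos; have h2 := hp.driftY_pos
  have e1 := expInt_nonneg (p.lam + 1) ht; have e2 := expInt_nonneg (p.lam - 1) ht
  obtain ⟨hx, hy⟩ := h
  constructor
  · simp only [flow, flowX_eq hp]; positivity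
  · simp only [flow, flowY_eq p]; positivity

theorem jumpMap_mem_quadrant {p : Params} (hp : p.Valid) {φ : ℝ × ℝ}
    (h : φ ∈ quadrant) : jumpMap p φ ∈ quadrant :=
  ⟨mul_nonneg hp.kappa_pos.le h.1, mul_nonneg (by linarith [hp.inv_mu_pos]) h.2⟩

/-! ### Step paths -/

/-- Paths of the counting process: nondecreasing right-continuous step functions from `0`. -/
structure IsStepPath (w : ℝ≥0 → ℕ) : Prop where
  zero : w 0 = 0
  mono : Monotone w
  rc : ∀ t, ContinuousWithinAt w (Set.Ici t) t

/-- The `n`-th jump time, with value `∞` if it does not exist, as an infimum over rational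
times. -/
def jumpAt (n : ℕ) (w : ℝ≥0 → ℕ) : ℝ≥0∞ :=
  ⨅ q : ℚ≥0, if n ≤ w (q : ℝ≥0) then ((q : ℝ≥0) : ℝ≥0∞) else ⊤

/-- The position at the jump times. -/
def postAt (p : Params) (φ : ℝ × ℝ) (w : ℝ≥0 → ℕ) : ℕ → ℝ × ℝ
  | 0 => φ
  | n + 1 => jumpMap p (flow p ((jumpAt (n + 1) w).toReal - (jumpAt n w).toReal) (postAt p φ w n))

/-- The number of jumps up to time `t`. -/
@[irreducible] def jumpCount (t : ℝ≥0) (w : ℝ≥0 → ℕ) : ℕ :=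
  ⌊(∑' n : ℕ, if jumpAt (n + 1) w ≤ (t : ℝ≥0∞) then (1 : ℝ≥0∞) else 0).toReal⌋₊

/-- The position at time `t` as a measurable functional of the path. -/
@[irreducible] def pos (p : Params) (φ : ℝ × ℝ) (t : ℝ≥0) (w : ℝ≥0 → ℕ) : ℝ × ℝ :=
  flow p ((t : ℝ) - (jumpAt (jumpCount t w) w).toReal) (postAt p φ w (jumpCount t w))

/-- The path after time `s`, restarted at `0`. -/
def shiftPath (s : ℝ≥0) (w : ℝ≥0 → ℕ) : ℝ≥0 → ℕ := fun t => w (s + t) - w s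

/-- The path stopped at time `t`. -/
def stopPath (t : ℝ≥0) (w : ℝ≥0 → ℕ) : ℝ≥0 → ℕ := fun s => w (min s t)

@[simp] theorem jumpAt_zero (w : ℝ≥0 → ℕ) : jumpAt 0 w = 0 := by
  refine le_antisymm ?_ zero_le
  refine (iInf_le _ (0 : ℚ≥0)).trans ?_
  simp

theorem IsStepPath.eventually_eq {w : ℝ≥0 → ℕ} (hw : IsStepPath w) (t : ℝ≥0) :
    ∀ᶠ s in 𝓝[≥] t, w s = w t := by
  have h := hw.rc t
  rw [ContinuousWithinAt, nhds_discrete, tendsto_pure] at h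
  exact h

/-- Right-continuity makes the infimum over rational times faithful: a count not reached at `t` is
not reached shortly after `t` either. All later facts on jump times rest on this equivalence. -/
theorem IsStepPath.jumpAt_le_iff {w : ℝ≥0 → ℕ} (hw : IsStepPath w) {n : ℕ} {t : ℝ≥0} :
    jumpAt n w ≤ t ↔ n ≤ w t := by
  constructor
  · intro h
    by_contra hn
    push Not at hn
    obtain ⟨u, hu, hus⟩ := mem_nhdsGE_iff_exists_Ico_subset.1 (hw.eventually_eq t)
    -- Before `u` the path has at most `w t < n` jumps, so no rational time below `u` enters the
    -- infimum.
    have : (u : ℝ≥0∞) ≤ jumpAt n w := by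
      refine le_iInf fun q => ?_
      split_ifs with hq
      · by_contra hlt
        push Not at hlt
        have hqu : (q : ℝ≥0) < u := by exact_mod_cast hlt
        have : w q ≤ w t := by
          rcases le_total (q : ℝ≥0) t with h1 | h1
          · exact hw.mono h1
          · exact (hus ⟨h1, hqu⟩ : w q = w t).le
        omega
      · exact le_top
    have h2 : (u : ℝ≥0∞) ≤ t := this.trans h
    have h3 : u ≤ t := by exact_mod_cast h2
    exact absurd hu (not_lt.2 h3)
  · intro h
    refine le_of_forall_gt fun b hb => ?_
    obtain ⟨q, hq0, hq1, hq2⟩ := ENNReal.lt_iff_exists_rat_btwn.1 hb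
    let r : ℚ≥0 := ⟨q, hq0⟩
    have hr : ((r : ℝ≥0) : ℝ≥0∞) = (Real.toNNReal q : ℝ≥0∞) := by
      congr 1
      apply NNReal.coe_injective
      rw [Real.coe_toNNReal _ (by exact_mod_cast hq0)]
      rfl
    refine lt_of_le_of_lt (iInf_le _ r) ?_
    have htr : t ≤ (r : ℝ≥0) := by
      have : (t : ℝ≥0∞) < (r : ℝ≥0) := by rw [hr]; exact hq1
      exact_mod_cast this.le
    rw [if_pos (h.trans (hw.mono htr)), hr]
    exact hq2

theorem IsStepPath.jumpCount_eq {w : ℝ≥0 → ℕ} (hw : IsStepPath w) (t : ℝ≥0) :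
    jumpCount t w = w t := by
  unfold jumpCount
  rw [tsum_eq_sum (s := Finset.range (w t))]
  · rw [Finset.sum_congr rfl (g := fun _ => (1 : ℝ≥0∞))]
    · simp
    · intro n hn
      rw [if_pos]
      rw [hw.jumpAt_le_iff]
      have := Finset.mem_range.1 hn
      omega
  · intro n hn
    rw [if_neg]
    rw [hw.jumpAt_le_iff]
    have := mt Finset.mem_range.2 hn
    omega

theorem IsStepPath.pos_eq {w : ℝ≥0 → ℕ} (hw : IsStepPath w) (p : Params) (φ : ℝ × ℝ) (t : ℝ≥0) :
    pos p φ t w = flow p ((t : ℝ) - (jumpAt (w t) w).toReal) (postAt p φ w (w t)) := by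
  rw [pos, hw.jumpCount_eq]

theorem IsStepPath.jumpTime_eq {Ω : Type*} {N : ℝ≥0 → Ω → ℕ} {ω : Ω}
    (hw : IsStepPath fun t => N t ω) (n : ℕ) :
    jumpTime N n ω = (jumpAt n fun t => N t ω).toNNReal := by
  unfold jumpTime
  have : {t : ℝ≥0 | n ≤ N t ω} = {t : ℝ≥0 | jumpAt n (fun t => N t ω) ≤ t} := by
    ext t
    exact hw.jumpAt_le_iff.symm
  rw [this]
  cases h : jumpAt n (fun t => N t ω) with
  | top => simp
  | coe a =>
    have : {t : ℝ≥0 | (a : ℝ≥0∞) ≤ t} = Set.Ici a := by ext t; simp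
    rw [this]
    simp

/-- On step paths, hence almost surely, the process may be replaced by a functional of the path that
is jointly measurable in start, time and path. -/
theorem IsStepPath.process_eq {Ω : Type*} {N : ℝ≥0 → Ω → ℕ} {ω : Ω}
    (hw : IsStepPath fun t => N t ω) (p : Params) (φ : ℝ × ℝ) (t : ℝ≥0) :
    process p N φ t ω = pos p φ t fun t => N t ω := by
  have hpost : ∀ n, postJump p N φ ω n = postAt p φ (fun t => N t ω) n := by
    intro n
    induction n with
    | zero => rfl
    | succ n ih =>
      rw [postJump, postAt, ih, hw.jumpTime_eq, hw.jumpTime_eq]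
      rfl
  rw [hw.pos_eq, process, hpost, hw.jumpTime_eq]
  rfl

theorem IsStepPath.jumpAt_toReal_le {w : ℝ≥0 → ℕ} (hw : IsStepPath w) {n : ℕ} {t : ℝ≥0}
    (h : n ≤ w t) : (jumpAt n w).toReal ≤ t :=
  ENNReal.toReal_le_coe_of_le_coe (hw.jumpAt_le_iff.2 h)

theorem jumpAt_mono (w : ℝ≥0 → ℕ) : Monotone fun n => jumpAt n w := by
  intro m n hmn
  refine iInf_mono fun q => ?_
  split_ifs with h1 h2 h2
  · exact le_rfl
  · exact le_top
  · omega
  · exact le_rfl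

theorem IsStepPath.jumpAt_toReal_mono {w : ℝ≥0 → ℕ} (hw : IsStepPath w) {m n : ℕ} {t : ℝ≥0}
    (hmn : m ≤ n) (h : n ≤ w t) : (jumpAt m w).toReal ≤ (jumpAt n w).toReal :=
  ENNReal.toReal_mono ((hw.jumpAt_le_iff.2 h).trans_lt ENNReal.coe_lt_top).ne (jumpAt_mono w hmn)

/-- Induction principle for two copies of the process driven by the same step path: a relation
stable under the flow and under jumps holds at all times. -/
theorem IsStepPath.pos_rel {w : ℝ≥0 → ℕ} (hw : IsStepPath w) {p : Params} {φ φ' : ℝ × ℝ}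
    (I : ℕ → ℝ → ℝ × ℝ → ℝ × ℝ → Prop) (h0 : I 0 0 φ φ')
    (hflow : ∀ n t s ψ ψ', 0 ≤ t → 0 ≤ s → I n t ψ ψ' → I n (t + s) (flow p s ψ) (flow p s ψ'))
    (hjump : ∀ n t ψ ψ', I n t ψ ψ' → I (n + 1) t (jumpMap p ψ) (jumpMap p ψ')) (t : ℝ≥0) :
    I (w t) t (pos p φ t w) (pos p φ' t w) := by
  have key : ∀ k, k ≤ w t → I k (jumpAt k w).toReal (postAt p φ w k) (postAt p φ' w k) := by
    intro k
    induction k with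
    | zero => intro _; simpa [postAt] using h0
    | succ k ih =>
      intro hk
      have h1 := ih (by omega)
      have h2 := hflow _ _ ((jumpAt (k + 1) w).toReal - (jumpAt k w).toReal) _ _
        ENNReal.toReal_nonneg (sub_nonneg.2 (hw.jumpAt_toReal_mono (Nat.le_succ k) hk)) h1
      rw [add_sub_cancel] at h2
      exact hjump _ _ _ _ h2
  have h1 := key (w t) le_rfl
  have h2 := hflow _ _ ((t : ℝ) - (jumpAt (w t) w).toReal) _ _
    ENNReal.toReal_nonneg (sub_nonneg.2 (hw.jumpAt_toReal_le le_rfl)) h1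
  rw [add_sub_cancel] at h2
  rwa [hw.pos_eq, hw.pos_eq]

theorem IsStepPath.shiftPath {w : ℝ≥0 → ℕ} (hw : IsStepPath w) (s : ℝ≥0) :
    IsStepPath (shiftPath s w) where
  zero := by simp [PoissonDisorder.shiftPath]
  mono := fun a b hab => Nat.sub_le_sub_right (hw.mono (by gcongr)) _
  rc := fun t => by
    rw [ContinuousWithinAt, nhds_discrete, tendsto_pure]
    have h := hw.eventually_eq (s + t)
    have ht : Tendsto (fun r : ℝ≥0 => s + r) (𝓝[≥] t) (𝓝[≥] (s + t)) := by
      refine tendsto_nhdsWithin_of_tendsto_nhds_of_eventually_within _ ?_ ?_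
      · exact (by fun_prop : Continuous fun r : ℝ≥0 => s + r).continuousWithinAt
      · filter_upwards [self_mem_nhdsWithin] with r hr
        exact add_le_add_right hr s
    filter_upwards [ht.eventually h] with r hr
    simp [PoissonDisorder.shiftPath, hr]

theorem IsStepPath.stopPath {w : ℝ≥0 → ℕ} (hw : IsStepPath w) (t : ℝ≥0) :
    IsStepPath (stopPath t w) where
  zero := by simp [PoissonDisorder.stopPath, hw.zero]
  mono := fun a b hab => hw.mono (min_le_min_right t hab)
  rc := fun s => by
    rw [ContinuousWithinAt, nhds_discrete, tendsto_pure]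
    have h := hw.eventually_eq (min s t)
    have ht : Tendsto (fun r : ℝ≥0 => min r t) (𝓝[≥] s) (𝓝[≥] (min s t)) := by
      refine tendsto_nhdsWithin_of_tendsto_nhds_of_eventually_within _ ?_ ?_
      · exact (by fun_prop : Continuous fun r : ℝ≥0 => min r t).continuousWithinAt
      · filter_upwards [self_mem_nhdsWithin] with r hr
        exact min_le_min_right t hr
    filter_upwards [ht.eventually h] with r hr
    simp [PoissonDisorder.stopPath, hr]

/-- The condition `1 ≤ k` is essential: the jump numbered `w s` occurs at or before `s`, whereas the
zeroth jump of the shifted path is at its own time origin. -/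
theorem IsStepPath.jumpAt_shiftPath {w : ℝ≥0 → ℕ} (hw : IsStepPath w) (s : ℝ≥0) {k : ℕ}
    (hk : 1 ≤ k) : jumpAt (w s + k) w = s + jumpAt k (PoissonDisorder.shiftPath s w) := by
  have hiff : ∀ r : ℝ≥0, jumpAt (w s + k) w ≤ r ↔
      s + jumpAt k (PoissonDisorder.shiftPath s w) ≤ r := by
    intro r
    rw [hw.jumpAt_le_iff]
    rcases lt_or_ge r s with h | h
    · have h1 := hw.mono h.le
      constructor
      · intro h2; omega
      · intro h2
        have h3 : (s : ℝ≥0∞) ≤ r := le_self_add.trans h2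
        have : s ≤ r := by exact_mod_cast h3
        exact absurd h (not_lt.2 this)
    · obtain ⟨u, rfl⟩ := exists_add_of_le h
      rw [ENNReal.coe_add, ENNReal.add_le_add_iff_left ENNReal.coe_ne_top,
        (hw.shiftPath s).jumpAt_le_iff, PoissonDisorder.shiftPath]
      omega
  refine le_antisymm (ENNReal.le_of_forall_nnreal_lt ?_) (ENNReal.le_of_forall_nnreal_lt ?_)
  · intro r hr
    by_contra h
    push Not at h
    exact absurd ((hiff r).2 h.le) (not_le.2 hr)
  · intro r hr
    by_contra h
    push Not at h
    exact absurd ((hiff r).1 h.le) (not_le.2 hr)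

theorem IsStepPath.jumpAt_ne_top {w : ℝ≥0 → ℕ} (hw : IsStepPath w) {n : ℕ} {t : ℝ≥0}
    (h : n ≤ w t) : jumpAt n w ≠ ⊤ :=
  ((hw.jumpAt_le_iff.2 h).trans_lt ENNReal.coe_lt_top).ne

/-- The flow property: after time `s` the process is driven by the shifted path. -/
theorem IsStepPath.pos_add {w : ℝ≥0 → ℕ} (hw : IsStepPath w) {p : Params} (hp : p.Valid)
    (φ : ℝ × ℝ) (s t : ℝ≥0) :
    pos p φ (s + t) w = pos p (pos p φ s w) t (PoissonDisorder.shiftPath s w) := by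
  set v := PoissonDisorder.shiftPath s w with hv
  have hvs : IsStepPath v := hw.shiftPath s
  have hwst : w (s + t) = w s + v t := by
    have := hw.mono (le_self_add : s ≤ s + t)
    simp only [hv, PoissonDisorder.shiftPath]; omega
  have hL : ∀ k, 1 ≤ k → k ≤ v t → (jumpAt (w s + k) w).toReal = s + (jumpAt k v).toReal := by
    intro k hk hkt
    rw [hw.jumpAt_shiftPath s hk, ENNReal.toReal_add ENNReal.coe_ne_top (hvs.jumpAt_ne_top hkt)]
    rfl
  -- The two post-jump sequences agree only from the first jump after `s` on; at index `0` the
  -- restarted one sits at the position at time `s`, in the middle of a flow segment.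
  have key : ∀ k, k + 1 ≤ v t →
      postAt p (pos p φ s w) v (k + 1) = postAt p φ w (w s + (k + 1)) := by
    intro k
    induction k with
    | zero =>
      intro hk
      rw [postAt, postAt, ← add_assoc, postAt, hw.pos_eq, ← flow_add hp]
      have := hL 1 le_rfl hk
      simp only [zero_add, jumpAt_zero, ENNReal.toReal_zero] at this ⊢
      rw [this]
      congr 2
      ring
    | succ k ih =>
      intro hk
      conv_lhs => rw [postAt, ih (by omega)]
      conv_rhs => rw [← add_assoc, postAt]
      have h1 := hL (k + 1) (by omega) (by omega)
      have h2 := hL (k + 1 + 1) (by omega) (by omega)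
      rw [← add_assoc] at h2
      rw [h1, h2]
      congr 2
      ring
  rw [hw.pos_eq, hvs.pos_eq, hwst]
  cases hk : v t with
  | zero =>
    rw [add_zero, postAt, hw.pos_eq, ← flow_add hp]
    simp only [jumpAt_zero, ENNReal.toReal_zero, NNReal.coe_add]
    congr 1
    ring
  | succ k =>
    rw [key k hk.ge, hL (k + 1) (by omega) hk.ge]
    simp only [NNReal.coe_add]
    congr 1
    ring

/-- Adaptedness in pathwise form: no information after `t` is used. -/
theorem IsStepPath.pos_stopPath {w : ℝ≥0 → ℕ} (hw : IsStepPath w) (p : Params)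
    (φ : ℝ × ℝ) {s t : ℝ≥0} (hst : s ≤ t) :
    pos p φ s (PoissonDisorder.stopPath t w) = pos p φ s w := by
  have hL : ∀ k, k ≤ w t → jumpAt k (PoissonDisorder.stopPath t w) = jumpAt k w := by
    intro k hk
    refine le_antisymm (ENNReal.le_of_forall_nnreal_lt ?_) (ENNReal.le_of_forall_nnreal_lt ?_)
    · intro r hr
      by_contra h
      push Not at h
      refine absurd ?_ (not_le.2 hr)
      rw [(hw.stopPath t).jumpAt_le_iff]
      have := hw.jumpAt_le_iff.1 h.le
      rcases le_total r t with h1 | h1 <;> simp [PoissonDisorder.stopPath, h1, this, hk]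
    · intro r hr
      by_contra h
      push Not at h
      refine absurd ?_ (not_le.2 hr)
      rw [hw.jumpAt_le_iff]
      have := (hw.stopPath t).jumpAt_le_iff.1 h.le
      exact this.trans (hw.mono (min_le_left _ _))
  have hs : PoissonDisorder.stopPath t w s = w s := by simp [PoissonDisorder.stopPath, hst]
  have key : ∀ k, k ≤ w t → postAt p φ (PoissonDisorder.stopPath t w) k = postAt p φ w k := by
    intro k
    induction k with
    | zero => intro _; rfl
    | succ k ih =>
      intro hk
      rw [postAt, postAt, ih (by omega), hL _ hk, hL _ (by omega)]
  have := hw.mono hst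
  rw [(hw.stopPath t).pos_eq, hw.pos_eq, hs, key _ this, hL _ this]

theorem IsStepPath.pos_zero {w : ℝ≥0 → ℕ} (hw : IsStepPath w) {p : Params} (hp : p.Valid)
    (φ : ℝ × ℝ) : pos p φ 0 w = φ := by
  rw [hw.pos_eq, hw.zero]
  simp [postAt, flow_zero hp]

theorem IsStepPath.pos_of_eq_zero {w : ℝ≥0 → ℕ} (hw : IsStepPath w) {p : Params}
    (φ : ℝ × ℝ) {t : ℝ≥0} (ht : w t = 0) : pos p φ t w = flow p t φ := by
  rw [hw.pos_eq, ht]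
  simp [postAt]

theorem IsStepPath.continuousWithinAt_pos {w : ℝ≥0 → ℕ} (hw : IsStepPath w) {p : Params}
    (hp : p.Valid) (φ : ℝ × ℝ) (t : ℝ≥0) :
    ContinuousWithinAt (fun s => pos p φ s w) (Set.Ici t) t := by
  have h : ContinuousWithinAt (fun s : ℝ≥0 =>
      flow p ((s : ℝ) - (jumpAt (w t) w).toReal) (postAt p φ w (w t))) (Set.Ici t) t := by
    have := (continuous_flow hp).comp (by fun_prop : Continuous fun s : ℝ≥0 =>
      ((s : ℝ) - (jumpAt (w t) w).toReal, postAt p φ w (w t)))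
    exact this.continuousWithinAt
  refine h.congr_of_eventuallyEq ?_ (hw.pos_eq p φ t)
  filter_upwards [hw.eventually_eq t] with s hs
  rw [hw.pos_eq, hs]

/-! ### Pathwise bounds -/

theorem IsStepPath.pos_mem_quadrant {w : ℝ≥0 → ℕ} (hw : IsStepPath w) {p : Params}
    (hp : p.Valid) {φ : ℝ × ℝ} (hφ : φ ∈ quadrant) (t : ℝ≥0) : pos p φ t w ∈ quadrant :=
  hw.pos_rel (fun _ _ ψ _ => ψ ∈ quadrant) (φ' := φ) hφ
    (fun _ _ _ _ _ _ hs h => flow_mem_quadrant hp hs h)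
    (fun _ _ _ _ h => jumpMap_mem_quadrant hp h) t

theorem IsStepPath.pos_mono {w : ℝ≥0 → ℕ} (hw : IsStepPath w) {p : Params}
    (hp : p.Valid) {φ φ' : ℝ × ℝ} (hφ : φ ≤ φ') (t : ℝ≥0) : pos p φ t w ≤ pos p φ' t w := by
  refine hw.pos_rel (fun _ _ ψ ψ' => ψ ≤ ψ') hφ ?_ ?_ t
  · intro n t s ψ ψ' _ _ h
    constructor
    · simp only [flow, flowX_eq hp]
      have := h.1
      gcongr
    · simp only [flow, flowY_eq p]
      have := h.2
      gcongr
  · intro n t ψ ψ' h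
    have h1 := hp.kappa_pos
    have h2 := hp.inv_mu_pos
    exact ⟨mul_le_mul_of_nonneg_left h.1 h1.le, mul_le_mul_of_nonneg_left h.2 (by linarith)⟩

/-- The dynamics are affine with nonnegative constant drift. Scaling the start leaves the drift at
full strength, whereas scaling the path shrinks it. -/
theorem IsStepPath.smul_pos_le {w : ℝ≥0 → ℕ} (hw : IsStepPath w) {p : Params}
    (hp : p.Valid) (φ : ℝ × ℝ) {r : ℝ} (hr : r ≤ 1) (t : ℝ≥0) :
    r • pos p φ t w ≤ pos p (r • φ) t w := by
  refine hw.pos_rel (fun _ _ ψ ψ' => r • ψ ≤ ψ') le_rfl ?_ ?_ t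
  · intro n t s ψ ψ' _ hs h
    have h1 : r * ψ.1 ≤ ψ'.1 := h.1
    have h2 : r * ψ.2 ≤ ψ'.2 := h.2
    constructor
    · simp only [flow, flowX_eq hp, Prod.smul_mk, smul_eq_mul]
      have e := mul_le_mul_of_nonneg_left h1 (Real.exp_pos ((p.lam + 1) * s)).le
      have e1 := mul_nonneg hp.driftX_pos.le (expInt_nonneg (p.lam + 1) hs)
      nlinarith
    · simp only [flow, flowY_eq p, Prod.smul_mk, smul_eq_mul]
      have e := mul_le_mul_of_nonneg_left h2 (Real.exp_pos ((p.lam - 1) * s)).le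
      have e1 := mul_nonneg hp.driftY_pos.le (expInt_nonneg (p.lam - 1) hs)
      nlinarith
  · intro n t ψ ψ' h
    have h1 : r * ψ.1 ≤ ψ'.1 := h.1
    have h2 : r * ψ.2 ≤ ψ'.2 := h.2
    have k1 := mul_le_mul_of_nonneg_left h1 hp.kappa_pos.le
    have k2 := mul_le_mul_of_nonneg_left h2 (by linarith [hp.inv_mu_pos] : 0 ≤ 1 + 1 / p.mu)
    constructor
    · simp only [jumpMap, Prod.smul_mk, smul_eq_mul]; linarith
    · simp only [jumpMap, Prod.smul_mk, smul_eq_mul]; linarith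

/-- The growth factor dominating the process. -/
def growth (p : Params) (n : ℕ) (t : ℝ) : ℝ := Real.exp ((p.lam + 1) * t) * (1 + 1 / p.mu) ^ n

theorem growth_pos {p : Params} (hp : p.Valid) (n : ℕ) (t : ℝ) : 0 < growth p n t :=
  mul_pos (Real.exp_pos _) (pow_pos (by linarith [hp.inv_mu_pos]) _)

theorem growth_add (p : Params) (n : ℕ) (t s : ℝ) :
    growth p n (t + s) = Real.exp ((p.lam + 1) * s) * growth p n t := by
  rw [growth, growth, mul_add, Real.exp_add]; ring

theorem growth_succ (p : Params) (n : ℕ) (t : ℝ) :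
    growth p (n + 1) t = (1 + 1 / p.mu) * growth p n t := by
  rw [growth, growth, pow_succ]; ring

theorem growth_mono {p : Params} (hp : p.Valid) {m n : ℕ} {s t : ℝ} (hmn : m ≤ n) (hst : s ≤ t) :
    growth p m s ≤ growth p n t := by
  have h1 := hp.inv_mu_pos
  have h2 := hp.lam_pos
  unfold growth
  gcongr
  linarith

/-- Adding the drift constants to the coordinates makes the estimate multiplicative: since `λ + 1 ≥
1`, the drift contributes at most `e^{(λ+1)s} - 1` times its constant. -/
theorem IsStepPath.pos_le {w : ℝ≥0 → ℕ} (hw : IsStepPath w) {p : Params}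
    (hp : p.Valid) {φ : ℝ × ℝ} (hφ : φ ∈ quadrant) (t : ℝ≥0) :
    (pos p φ t w).1 + (pos p φ t w).2 ≤
      growth p (w t) t * (φ.1 + φ.2 + (p.driftX + p.driftY)) := by
  have hl := hp.lam_pos
  have hX := hp.driftX_pos
  have hY := hp.driftY_pos
  have hmu := hp.inv_mu_pos
  have h := hw.pos_rel (p := p) (φ := φ) (φ' := φ) (fun n t ψ _ => ψ ∈ quadrant ∧
    ψ.1 + p.driftX ≤ growth p n t * (φ.1 + p.driftX) ∧
    ψ.2 + p.driftY ≤ growth p n t * (φ.2 + p.driftY)) ⟨hφ, by simp [growth], by simp [growth]⟩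
    ?_ ?_ t
  · linarith [h.2.1, h.2.2]
  · rintro n t s ψ - ht hs ⟨hq, h1, h2⟩
    refine ⟨flow_mem_quadrant hp hs hq, ?_, ?_⟩
    · have e : expInt (p.lam + 1) s ≤ Real.exp ((p.lam + 1) * s) - 1 := by
        rw [expInt, if_neg (by positivity)]
        refine div_le_self ?_ (by linarith)
        have : 0 ≤ (p.lam + 1) * s := by positivity
        linarith [Real.one_le_exp this]
      rw [growth_add]
      simp only [flow, flowX_eq hp]
      have k1 := mul_le_mul_of_nonneg_left e hX.le
      have k2 := mul_le_mul_of_nonneg_left h1 (Real.exp_pos ((p.lam + 1) * s)).le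
      nlinarith
    · have e : expInt (p.lam - 1) s ≤ Real.exp ((p.lam + 1) * s) - 1 := by
        refine (expInt_mono_left (by linarith : p.lam - 1 ≤ p.lam + 1) hs).trans ?_
        rw [expInt, if_neg (by positivity)]
        refine div_le_self ?_ (by linarith)
        have : 0 ≤ (p.lam + 1) * s := by positivity
        linarith [Real.one_le_exp this]
      rw [growth_add]
      simp only [flow, flowY_eq p]
      have k1 := mul_le_mul_of_nonneg_left e hY.le
      have k2 := mul_le_mul_of_nonneg_left h2 (Real.exp_pos ((p.lam + 1) * s)).le
      have k3 : Real.exp ((p.lam - 1) * s) * ψ.2 ≤ Real.exp ((p.lam + 1) * s) * ψ.2 := by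
        refine mul_le_mul_of_nonneg_right (Real.exp_le_exp.2 ?_) hq.2
        nlinarith
      nlinarith
  · rintro n t ψ - ⟨hq, h1, h2⟩
    refine ⟨jumpMap_mem_quadrant hp hq, ?_, ?_⟩
    · rw [growth_succ]
      simp only [jumpMap]
      have k := mul_le_mul_of_nonneg_left h1 (by linarith : 0 ≤ 1 + 1 / p.mu)
      have := mul_nonneg hmu.le hq.1
      have := mul_nonneg hmu.le hX.le
      nlinarith
    · rw [growth_succ]
      simp only [jumpMap]
      have k := mul_le_mul_of_nonneg_left h2 (by linarith : 0 ≤ 1 + 1 / p.mu)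
      have := mul_nonneg hmu.le hY.le
      nlinarith

/-- The drift cancels in differences, which evolve linearly with factors at most those in `growth`.
The order of the starting points keeps the differences nonnegative, so enlarging a factor is
harmless. -/
theorem IsStepPath.pos_sub_le {w : ℝ≥0 → ℕ} (hw : IsStepPath w) {p : Params}
    (hp : p.Valid) {φ φ' : ℝ × ℝ} {d : ℝ} (hφ : φ ≤ φ') (hd : φ' ≤ φ + (d, d)) (t : ℝ≥0) :
    pos p φ' t w ≤ pos p φ t w + (growth p (w t) t * d, growth p (w t) t * d) := by
  have hl := hp.lam_pos
  have hmu := hp.inv_mu_pos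
  have hk := hp.kappa_pos
  refine (hw.pos_rel (p := p) (φ := φ) (φ' := φ') (fun n t ψ ψ' => ψ ≤ ψ' ∧
    ψ' ≤ ψ + (growth p n t * d, growth p n t * d)) ⟨hφ, by simpa [growth] using hd⟩ ?_ ?_ t).2
  · rintro n t s ψ ψ' ht hs ⟨h0, h⟩
    have h1 : ψ'.1 ≤ ψ.1 + growth p n t * d := h.1
    have h2 : ψ'.2 ≤ ψ.2 + growth p n t * d := h.2
    have g1 : ψ.1 ≤ ψ'.1 := h0.1
    have g2 : ψ.2 ≤ ψ'.2 := h0.2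
    have e : Real.exp ((p.lam - 1) * s) ≤ Real.exp ((p.lam + 1) * s) :=
      Real.exp_le_exp.2 (by nlinarith)
    have e0 := Real.exp_pos ((p.lam - 1) * s)
    refine ⟨⟨?_, ?_⟩, ⟨?_, ?_⟩⟩
    · simp only [flow, flowX_eq hp]; gcongr
    · simp only [flow, flowY_eq p]; gcongr
    · simp only [flow, flowX_eq hp, growth_add, Prod.mk_add_mk]
      have := mul_le_mul_of_nonneg_left h1 (Real.exp_pos ((p.lam + 1) * s)).le
      linarith
    · simp only [flow, flowY_eq p, growth_add, Prod.mk_add_mk]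
      have k1 := mul_le_mul_of_nonneg_right e (by linarith : 0 ≤ ψ'.2 - ψ.2)
      have k2 := mul_le_mul_of_nonneg_left (by linarith : ψ'.2 - ψ.2 ≤ growth p n t * d)
        (Real.exp_pos ((p.lam + 1) * s)).le
      nlinarith
  · rintro n t ψ ψ' ⟨h0, h⟩
    have h1 : ψ'.1 ≤ ψ.1 + growth p n t * d := h.1
    have h2 : ψ'.2 ≤ ψ.2 + growth p n t * d := h.2
    have g1 : ψ.1 ≤ ψ'.1 := h0.1
    have g2 : ψ.2 ≤ ψ'.2 := h0.2
    refine ⟨⟨?_, ?_⟩, ⟨?_, ?_⟩⟩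
    · simp only [jumpMap]; gcongr
    · simp only [jumpMap]; gcongr
    · simp only [jumpMap, growth_succ, Prod.mk_add_mk]
      have k1 := mul_le_mul_of_nonneg_right (by linarith : 1 - 1 / p.mu ≤ 1 + 1 / p.mu)
        (by linarith : 0 ≤ ψ'.1 - ψ.1)
      have k2 := mul_le_mul_of_nonneg_left (by linarith : ψ'.1 - ψ.1 ≤ growth p n t * d)
        (by linarith : 0 ≤ 1 + 1 / p.mu)
      nlinarith
    · simp only [jumpMap, growth_succ, Prod.mk_add_mk]
      have k2 := mul_le_mul_of_nonneg_left h2 (by linarith : 0 ≤ 1 + 1 / p.mu)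
      nlinarith

/-- The second coordinate is bounded below independently of the starting point. -/
theorem IsStepPath.le_pos_snd {w : ℝ≥0 → ℕ} (hw : IsStepPath w) {p : Params}
    (hp : p.Valid) {φ : ℝ × ℝ} (hφ : φ ∈ quadrant) (t : ℝ≥0) :
    p.driftY * expInt (p.lam - 1) t ≤ (pos p φ t w).2 := by
  have hY := hp.driftY_pos
  have hmu := hp.inv_mu_pos
  refine (hw.pos_rel (p := p) (φ := φ) (φ' := φ) (fun n t ψ _ => 0 ≤ ψ.2 ∧
    p.driftY * expInt (p.lam - 1) t ≤ ψ.2) ⟨hφ.2, by simpa using hφ.2⟩ ?_ ?_ t).2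
  · rintro n t s ψ - ht hs ⟨h0, h⟩
    have e := expInt_nonneg (p.lam - 1) hs
    simp only [flow, flowY_eq p, expInt_add]
    refine ⟨by positivity, ?_⟩
    have := mul_le_mul_of_nonneg_left h (Real.exp_pos ((p.lam - 1) * s)).le
    linarith
  · rintro n t ψ - ⟨h0, h⟩
    simp only [jumpMap]
    refine ⟨by positivity, ?_⟩
    nlinarith [mul_nonneg hmu.le h0]

/-- Dropping the drift leaves a product of jump factors and one exponential; used to show that many
jumps carry the process far out. -/
theorem IsStepPath.pow_mul_le_pos_snd {w : ℝ≥0 → ℕ} (hw : IsStepPath w) {p : Params}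
    (hp : p.Valid) (φ : ℝ × ℝ) (t : ℝ≥0) :
    (1 + 1 / p.mu) ^ w t * Real.exp ((p.lam - 1) * t) * φ.2 ≤ (pos p φ t w).2 := by
  have hY := hp.driftY_pos
  have hmu := hp.inv_mu_pos
  refine hw.pos_rel (p := p) (φ := φ) (φ' := φ) (fun n t ψ _ =>
    (1 + 1 / p.mu) ^ n * Real.exp ((p.lam - 1) * t) * φ.2 ≤ ψ.2) (by simp) ?_ ?_ t
  · rintro n t s ψ - ht hs h
    have e := mul_nonneg hY.le (expInt_nonneg (p.lam - 1) hs)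
    simp only [flow, flowY_eq p]
    have := mul_le_mul_of_nonneg_left h (Real.exp_pos ((p.lam - 1) * s)).le
    rw [mul_add, Real.exp_add]
    linarith
  · rintro n t ψ - h
    simp only [jumpMap]
    have := mul_le_mul_of_nonneg_left h (by linarith : 0 ≤ 1 + 1 / p.mu)
    rw [pow_succ]
    linarith

end

/-! ### Probabilistic side: law on path space, Markov property, observability -/

section

/-! ### Measurability of the path functionals -/

-- Only countably many coordinates of the path enter, thanks to the rational infimum.
@[fun_prop] theorem measurable_jumpAt (n : ℕ) : Measurable (jumpAt n) := by
  unfold jumpAt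
  refine Measurable.iInf fun q => Measurable.ite ?_ measurable_const measurable_const
  exact (measurable_pi_apply (q : ℝ≥0)) (measurableSet_Ici (a := n))

theorem measurable_postAt {p : Params} (hp : p.Valid) (n : ℕ) :
    Measurable fun z : (ℝ × ℝ) × (ℝ≥0 → ℕ) => postAt p z.1 z.2 n := by
  induction n with
  | zero => exact measurable_fst
  | succ n ih =>
    simp only [postAt]
    refine (continuous_jumpMap p).measurable.comp ((continuous_flow hp).measurable.comp
      (g := fun z => flow p z.1 z.2) (f := fun z : (ℝ × ℝ) × (ℝ≥0 → ℕ) =>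
        ((jumpAt (n + 1) z.2).toReal - (jumpAt n z.2).toReal, postAt p z.1 z.2 n)) ?_)
    exact Measurable.prodMk (by fun_prop) ih

/-- Evaluating a path at a variable time is not jointly measurable on the full product space;
counting the jump times below `t` is, and agrees with evaluation on step paths. -/
theorem measurable_jumpCount :
    Measurable fun z : ℝ≥0 × (ℝ≥0 → ℕ) => jumpCount z.1 z.2 := by
  unfold jumpCount
  refine Nat.measurable_floor.comp (Measurable.ennreal_toReal (Measurable.tsum fun n => ?_))
  refine Measurable.ite ?_ measurable_const measurable_const
  exact measurableSet_le (by fun_prop) (by fun_prop)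

theorem measurable_pos {p : Params} (hp : p.Valid) :
    Measurable fun z : (ℝ × ℝ) × ℝ≥0 × (ℝ≥0 → ℕ) => pos p z.1 z.2.1 z.2.2 := by
  unfold pos
  -- The number of jumps is made a separate countable variable, so that it may be frozen.
  have h : Measurable fun z : ℕ × ((ℝ × ℝ) × ℝ≥0 × (ℝ≥0 → ℕ)) =>
      flow p ((z.2.2.1 : ℝ) - (jumpAt z.1 z.2.2.2).toReal) (postAt p z.2.1 z.2.2.2 z.1) := by
    refine measurable_from_prod_countable_right fun n => ?_
    refine (continuous_flow hp).measurable.comp (g := fun z => flow p z.1 z.2)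
      (f := fun z : (ℝ × ℝ) × ℝ≥0 × (ℝ≥0 → ℕ) =>
        ((z.2.1 : ℝ) - (jumpAt n z.2.2).toReal, postAt p z.1 z.2.2 n)) (Measurable.prodMk ?_ ?_)
    · fun_prop
    · exact (measurable_postAt hp n).comp (by fun_prop :
        Measurable fun z : (ℝ × ℝ) × ℝ≥0 × (ℝ≥0 → ℕ) => (z.1, z.2.2))
  exact h.comp (Measurable.prodMk (measurable_jumpCount.comp measurable_snd) measurable_id)

theorem measurable_shiftPath (s : ℝ≥0) : Measurable (shiftPath s) := by
  unfold shiftPath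
  fun_prop

theorem measurable_stopPath (s : ℝ≥0) : Measurable (stopPath s) := by
  unfold stopPath
  fun_prop

/-! ### The law of a Poisson process -/

variable {Ω : Type*} [MeasurableSpace Ω] {P : Measure Ω} {N : ℝ≥0 → Ω → ℕ} {r : ℝ}

/-- The path of the counting process. -/
def pathOf {Ω : Type*} (N : ℝ≥0 → Ω → ℕ) (ω : Ω) : ℝ≥0 → ℕ := fun t => N t ω

theorem IsPoissonProcess.measurable_pathOf (hN : IsPoissonProcess N r P) :
    Measurable (pathOf N) :=
  measurable_pi_lambda _ hN.measurable

theorem IsPoissonProcess.isStepPath (hN : IsPoissonProcess N r P) :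
    ∀ᵐ ω ∂P, IsStepPath (pathOf N ω) := by
  filter_upwards [hN.path] with ω h
  exact ⟨h.1, h.2.1, h.2.2⟩

/-- The process restarted at time `s` is again a Poisson process. -/
theorem IsPoissonProcess.shift (hN : IsPoissonProcess N r P) (s : ℝ≥0) :
    IsPoissonProcess (fun t ω => N (s + t) ω - N s ω) r P where
  measurable t := (hN.measurable _).sub (hN.measurable _)
  path := by
    filter_upwards [hN.isStepPath] with ω hω
    exact ⟨(hω.shiftPath s).zero, (hω.shiftPath s).mono, (hω.shiftPath s).rc⟩
  indep := by
    intro n t ht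
    refine (hN.indep n (fun i => s + t i) fun i j hij =>
      add_le_add_right (ht hij) s).congr fun i => ?_
    filter_upwards [hN.isStepPath] with ω hω
    have h1 : N s ω ≤ N (s + t i.castSucc) ω := hω.mono le_self_add
    have h2 : N (s + t i.castSucc) ω ≤ N (s + t i.succ) ω :=
      hω.mono (by gcongr; exact ht (Fin.castSucc_le_succ i))
    omega
  law a b hab := by
    have h := hN.law (s + a) (s + b) (by gcongr)
    rw [add_tsub_add_eq_tsub_left] at h
    refine h.congr ?_
    filter_upwards [hN.isStepPath] with ω hω
    have h1 : N s ω ≤ N (s + a) ω := hω.mono le_self_add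
    have h2 : N (s + a) ω ≤ N (s + b) ω := hω.mono (by gcongr)
    omega

/-- A monotone sequence from `0` running through the points of the finite set `K`. -/
def gridTime (K : Finset ℝ≥0) (n : ℕ) : ℝ≥0 :=
  (K.filter fun i => (K.filter fun j => j < i).card < n).sup id

/-- The index at which `gridTime K` visits `k`. -/
def gridIndex (K : Finset ℝ≥0) (k : ℝ≥0) : ℕ := (K.filter fun j => j < k).card + 1

theorem gridTime_mono (K : Finset ℝ≥0) : Monotone (gridTime K) := by
  intro m n hmn
  refine Finset.sup_mono fun i hi => ?_
  rw [Finset.mem_filter] at hi ⊢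
  exact ⟨hi.1, hi.2.trans_le hmn⟩

theorem gridTime_zero (K : Finset ℝ≥0) : gridTime K 0 = 0 := by simp [gridTime]

theorem gridIndex_mono (K : Finset ℝ≥0) : Monotone (gridIndex K) := by
  intro a b hab
  refine Nat.succ_le_succ (Finset.card_le_card fun x hx => ?_)
  rw [Finset.mem_filter] at hx ⊢
  exact ⟨hx.1, hx.2.trans_le hab⟩

theorem gridIndex_le (K : Finset ℝ≥0) (k : ℝ≥0) : gridIndex K k ≤ K.card + 1 :=
  Nat.succ_le_succ (Finset.card_filter_le _ _)

/-- The points with at most as many predecessors as `k` are exactly those up to `k`: a larger point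
has `k` itself as an extra predecessor. Index `0` is reserved for time `0`. -/
theorem gridTime_gridIndex {K : Finset ℝ≥0} {k : ℝ≥0} (hk : k ∈ K) :
    gridTime K (gridIndex K k) = k := by
  refine le_antisymm (Finset.sup_le fun i hi => ?_) ?_
  · rw [Finset.mem_filter] at hi
    by_contra hlt
    simp only [id, not_le] at hlt
    have hsub : insert k (K.filter fun j => j < k) ⊆ K.filter fun j => j < i := by
      intro j hj
      rw [Finset.mem_insert, Finset.mem_filter] at hj
      rw [Finset.mem_filter]
      rcases hj with rfl | hj
      · exact ⟨hk, hlt⟩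
      · exact ⟨hj.1, hj.2.trans hlt⟩
    have := Finset.card_le_card hsub
    rw [Finset.card_insert_of_notMem (by simp)] at this
    have h2 := hi.2
    unfold gridIndex at h2
    omega
  · exact Finset.le_sup (f := id) (by rw [Finset.mem_filter]; exact ⟨hk, by simp [gridIndex]⟩)

/-- The increments of `N` along the sequence `t`. -/
def increment {Ω : Type*} (N : ℝ≥0 → Ω → ℕ) (t : ℕ → ℝ≥0) (i : ℕ) (ω : Ω) : ℕ :=
  N (t (i + 1)) ω - N (t i) ω

theorem IsStepPath.sum_increment {Ω : Type*} {N : ℝ≥0 → Ω → ℕ} {ω : Ω}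
    (hω : IsStepPath (pathOf N ω)) {t : ℕ → ℝ≥0}
    (ht : Monotone t) {m n : ℕ} (hmn : m ≤ n) :
    ∑ i ∈ Finset.Ico m n, increment N t i ω = N (t n) ω - N (t m) ω := by
  induction n, hmn using Nat.le_induction with
  | base => simp
  | succ n hmn ih =>
    rw [Finset.sum_Ico_succ_top hmn, ih, increment]
    have h1 : N (t m) ω ≤ N (t n) ω := hω.mono (ht hmn)
    have h2 : N (t n) ω ≤ N (t (n + 1)) ω := hω.mono (ht (Nat.le_succ n))
    omega

theorem IsPoissonProcess.measurable_increment (hN : IsPoissonProcess N r P) (t : ℕ → ℝ≥0) (i : ℕ) :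
    Measurable (increment N t i) := (hN.measurable _).sub (hN.measurable _)

/-- The values of `N` are partial sums of independent increments, so the finite-dimensional laws are
expressed through `r` and the time points alone. This gives uniqueness in law. -/
theorem IsPoissonProcess.map_restrict [IsProbabilityMeasure P] (hN : IsPoissonProcess N r P)
    (I : Finset ℝ≥0) : (P.map (pathOf N)).map I.restrict =
      (Measure.infinitePi fun i => poissonMeasure
        (r.toNNReal * (gridTime I (i + 1) - gridTime I i))).map
        fun (d : ℕ → ℕ) (i : I) => ∑ j ∈ Finset.Ico 0 (gridIndex I i), d j := by
  have hind : iIndepFun (increment N (gridTime I)) P := hN.indep.nat (gridTime_mono I)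
  rw [iIndepFun_iff_map_fun_eq_infinitePi_map (hN.measurable_increment _)] at hind
  have hl : ∀ i, P.map (increment N (gridTime I) i) =
      poissonMeasure (r.toNNReal * (gridTime I (i + 1) - gridTime I i)) := fun i =>
    (hN.law _ _ (gridTime_mono I (Nat.le_succ i))).map_eq
  simp_rw [hl] at hind
  have hinc : Measurable fun ω i => increment N (gridTime I) i ω :=
    measurable_pi_lambda _ (hN.measurable_increment _)
  rw [← hind, Measure.map_map (by fun_prop) hinc,
    Measure.map_map (by fun_prop) hN.measurable_pathOf]
  refine Measure.map_congr ?_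
  filter_upwards [hN.isStepPath] with ω hω
  ext i
  have h0 : N 0 ω = 0 := hω.zero
  simp only [Function.comp, Finset.restrict, pathOf]
  rw [hω.sum_increment (gridTime_mono I) (Nat.zero_le _), gridTime_zero,
    gridTime_gridIndex i.2, h0, Nat.sub_zero]

/-- Two Poisson processes with the same rate have the same law on the path space. -/
theorem IsPoissonProcess.map_pathOf_eq [IsProbabilityMeasure P] (hN : IsPoissonProcess N r P)
    {Ω' : Type*} [MeasurableSpace Ω'] {P' : Measure Ω'} [IsProbabilityMeasure P']
    {N' : ℝ≥0 → Ω' → ℕ} (hN' : IsPoissonProcess N' r P') :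
    P.map (pathOf N) = P'.map (pathOf N') := by
  have := Measure.isProbabilityMeasure_map (μ := P') hN'.measurable_pathOf.aemeasurable
  have hP (I : Finset ℝ≥0) : IsFiniteMeasure ((P'.map (pathOf N')).map I.restrict) := inferInstance
  refine IsProjectiveLimit.unique (P := fun I => (P'.map (pathOf N')).map I.restrict) ?_ ?_
  · intro I
    simp only [hN.map_restrict, hN'.map_restrict]
  · intro I
    rfl

theorem IsPoissonProcess.map_shiftPath [IsProbabilityMeasure P] (hN : IsPoissonProcess N r P)
    (s : ℝ≥0) : P.map (fun ω => shiftPath s (pathOf N ω)) = P.map (pathOf N) :=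
  (hN.shift s).map_pathOf_eq hN

/-- The past and the increments after time `s` are independent. -/
theorem IsPoissonProcess.indepFun_stopPath_shiftPath [IsProbabilityMeasure P]
    (hN : IsPoissonProcess N r P) (s : ℝ≥0) :
    IndepFun (fun ω => stopPath s (pathOf N ω)) (fun ω => shiftPath s (pathOf N ω)) P := by
  refine IndepFun.process_indepFun_process (X := fun i ω => N (min i s) ω)
    (Y := fun j ω => N (s + j) ω - N s ω) (fun i => hN.measurable _)
    (fun j => (hN.measurable _).sub (hN.measurable _)) fun I J => ?_
  classical
  -- One grid for past and future: including `s` splits the increments into two disjoint index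
  -- blocks, and each family is a function of its own block.
  set K : Finset ℝ≥0 := I.image (fun i => min i s) ∪ {s} ∪ J.image (fun j => s + j) with hK
  have hind : iIndepFun (increment N (gridTime K)) P := hN.indep.nat (gridTime_mono K)
  have h := hind.indepFun_finset (Finset.Ico 0 (gridIndex K s))
    (Finset.Ico (gridIndex K s) (K.card + 1)) (Finset.Ico_disjoint_Ico_consecutive _ _ _)
    (hN.measurable_increment _)
  let G₁ (x : Finset.Ico 0 (gridIndex K s) → ℕ) (i : I) : ℕ :=
    ∑ l : Finset.Ico 0 (gridIndex K s), if (l : ℕ) < gridIndex K (min i s) then x l else 0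
  let G₂ (x : Finset.Ico (gridIndex K s) (K.card + 1) → ℕ) (j : J) : ℕ :=
    ∑ l : Finset.Ico (gridIndex K s) (K.card + 1),
      if (l : ℕ) < gridIndex K (s + j) then x l else 0
  have h1 : Measurable G₁ := Measurable.of_discrete
  have h2 : Measurable G₂ := Measurable.of_discrete
  refine (h.comp h1 h2).congr ?_ ?_
  · filter_upwards [hN.isStepPath] with ω hω
    ext i
    have hi : min (i : ℝ≥0) s ∈ K := by
      simp only [hK, Finset.mem_union, Finset.mem_image]
      exact Or.inl (Or.inl ⟨i, i.2, rfl⟩)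
    have h0 : N 0 ω = 0 := hω.zero
    have hle := gridIndex_mono K (min_le_right (i : ℝ≥0) s)
    have key := hω.sum_increment (gridTime_mono K) (Nat.zero_le (gridIndex K (min i s)))
    rw [gridTime_gridIndex hi, gridTime_zero, h0, Nat.sub_zero] at key
    simp only [Function.comp, G₁]
    rw [← key, Finset.sum_coe_sort (Finset.Ico 0 (gridIndex K s))
      (fun l => if l < gridIndex K (min i s) then increment N (gridTime K) l ω else 0),
      ← Finset.sum_filter]
    congr 1
    ext l
    simp only [Finset.mem_filter, Finset.mem_Ico]
    omega
  · filter_upwards [hN.isStepPath] with ω hω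
    ext j
    have hj : s + (j : ℝ≥0) ∈ K := by
      simp only [hK, Finset.mem_union, Finset.mem_image]
      exact Or.inr ⟨j, j.2, rfl⟩
    have hs : s ∈ K := by simp [hK]
    have hle := gridIndex_mono K (le_self_add : s ≤ s + j)
    have hle' := gridIndex_le K (s + j)
    have key := hω.sum_increment (gridTime_mono K) hle
    rw [gridTime_gridIndex hj, gridTime_gridIndex hs] at key
    simp only [Function.comp, G₂]
    rw [← key, Finset.sum_coe_sort (Finset.Ico (gridIndex K s) (K.card + 1))
      (fun l => if l < gridIndex K (s + j) then increment N (gridTime K) l ω else 0),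
      ← Finset.sum_filter]
    congr 1
    ext l
    simp only [Finset.mem_filter, Finset.mem_Ico]
    omega

/-- The Markov property at a deterministic time, on the level of paths. -/
theorem IsPoissonProcess.lintegral_stopPath_shiftPath [IsProbabilityMeasure P]
    (hN : IsPoissonProcess N r P) (s : ℝ≥0) {F : (ℝ≥0 → ℕ) → (ℝ≥0 → ℕ) → ℝ≥0∞}
    (hF : Measurable (Function.uncurry F)) :
    ∫⁻ ω, F (stopPath s (pathOf N ω)) (shiftPath s (pathOf N ω)) ∂P =
      ∫⁻ ω, ∫⁻ ω', F (stopPath s (pathOf N ω)) (pathOf N ω') ∂P ∂P := by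
  have h1 : Measurable fun ω => stopPath s (pathOf N ω) :=
    (measurable_stopPath s).comp hN.measurable_pathOf
  have h2 : Measurable fun ω => shiftPath s (pathOf N ω) :=
    (measurable_shiftPath s).comp hN.measurable_pathOf
  have hind := (indepFun_iff_map_prod_eq_prod_map_map h1.aemeasurable h2.aemeasurable).1
    (hN.indepFun_stopPath_shiftPath s)
  have := Measure.isProbabilityMeasure_map (μ := P) hN.measurable_pathOf.aemeasurable
  calc ∫⁻ ω, F (stopPath s (pathOf N ω)) (shiftPath s (pathOf N ω)) ∂P
      = ∫⁻ z, Function.uncurry F z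
          ∂(P.map fun ω => (stopPath s (pathOf N ω), shiftPath s (pathOf N ω))) := by
        rw [lintegral_map hF (h1.prodMk h2)]; rfl
    _ = ∫⁻ u, ∫⁻ w, F u w ∂(P.map (pathOf N)) ∂(P.map fun ω => stopPath s (pathOf N ω)) := by
        rw [hind, hN.map_shiftPath s, lintegral_prod _ hF.aemeasurable]; rfl
    _ = _ := by
        rw [lintegral_map (f := fun u => ∫⁻ w, F u w ∂(P.map (pathOf N)))
          hF.lintegral_prod_right' h1]
        refine lintegral_congr fun ω => ?_
        rw [lintegral_map (f := F (stopPath s (pathOf N ω)))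
          (hF.comp measurable_prodMk_left) hN.measurable_pathOf]

/-! ### Observable events -/

theorem measurable_natural_stopPath (hm : ∀ t, Measurable (N t)) (t : ℝ≥0) :
    Measurable[Filtration.natural N (fun s => (hm s).stronglyMeasurable) t]
      fun ω => stopPath t (pathOf N ω) := by
  refine @measurable_pi_lambda _ _ _ (_) _ _ fun s => ?_
  have h : MeasurableSpace.comap (N (min s t)) ⊤ ≤
      Filtration.natural N (fun s => (hm s).stronglyMeasurable) t :=
    le_iSup₂_of_le (min s t) (min_le_right s t) le_rfl
  intro A _
  exact h _ ⟨A, trivial, rfl⟩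

theorem exists_eq_stopPath_preimage {hm : ∀ t, Measurable (N t)} {t : ℝ≥0} {A : Set Ω}
    (hA : MeasurableSet[Filtration.natural N (fun s => (hm s).stronglyMeasurable) t] A) :
    ∃ C : Set (ℝ≥0 → ℕ), MeasurableSet C ∧ A = (fun ω => stopPath t (pathOf N ω)) ⁻¹' C := by
  have h : Filtration.natural N (fun s => (hm s).stronglyMeasurable) t ≤
      MeasurableSpace.comap (fun ω => stopPath t (pathOf N ω)) MeasurableSpace.pi := by
    refine iSup₂_le fun j hj => ?_
    rintro _ ⟨B, hB, rfl⟩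
    refine ⟨(fun w => w j) ⁻¹' B, measurable_pi_apply j hB, ?_⟩
    ext ω
    simp [stopPath, pathOf, hj]
  obtain ⟨C, hC, rfl⟩ := h A hA
  exact ⟨C, hC, rfl⟩

/-- The events observable up to time `t`. -/
def Obs (N : ℝ≥0 → Ω → ℕ) (P : Measure Ω) (t : ℝ≥0) (A : Set Ω) : Prop :=
  ∃ C : Set (ℝ≥0 → ℕ), MeasurableSet C ∧ A =ᵐ[P] (fun ω => stopPath t (pathOf N ω)) ⁻¹' C

/-- Since `σ(N_s : s ≤ t)` is generated by the stopped path, observability can be handled through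
measurable sets of paths. -/
theorem obs_iff {hm : ∀ t, Measurable (N t)} {t : ℝ≥0} {A : Set Ω} :
    Obs N P t A ↔ MeasurableSet[augmentedFiltration N P hm t] A := by
  constructor
  · rintro ⟨C, hC, hA⟩
    exact ⟨_, measurable_natural_stopPath hm t hC, hA⟩
  · rintro ⟨B, hB, hA⟩
    obtain ⟨C, hC, rfl⟩ := exists_eq_stopPath_preimage (hm := hm) hB
    exact ⟨C, hC, hA⟩

theorem Obs.compl {t : ℝ≥0} {A : Set Ω} (h : Obs N P t A) : Obs N P t Aᶜ := by
  obtain ⟨C, hC, hA⟩ := h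
  exact ⟨Cᶜ, hC.compl, hA.compl⟩

theorem Obs.inter {t : ℝ≥0} {A B : Set Ω} (hA : Obs N P t A) (hB : Obs N P t B) :
    Obs N P t (A ∩ B) := by
  obtain ⟨C, hC, hA⟩ := hA
  obtain ⟨D, hD, hB⟩ := hB
  exact ⟨C ∩ D, hC.inter hD, hA.inter hB⟩

theorem Obs.iUnion {ι : Sort*} [Countable ι] {t : ℝ≥0} {A : ι → Set Ω} (h : ∀ i, Obs N P t (A i)) :
    Obs N P t (⋃ i, A i) := by
  choose C hC hA using h
  refine ⟨⋃ i, C i, MeasurableSet.iUnion hC, ?_⟩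
  rw [Set.preimage_iUnion]
  exact Filter.EventuallyEq.countable_iUnion hA

theorem obs_empty {t : ℝ≥0} : Obs N P t ∅ := ⟨∅, MeasurableSet.empty, by simp⟩

theorem obs_univ {t : ℝ≥0} : Obs N P t Set.univ := ⟨Set.univ, MeasurableSet.univ, by simp⟩

theorem Obs.congr {t : ℝ≥0} {A B : Set Ω} (h : Obs N P t A) (hAB : B =ᵐ[P] A) : Obs N P t B := by
  obtain ⟨C, hC, hA⟩ := h
  exact ⟨C, hC, hAB.trans hA⟩

theorem Obs.mono {s t : ℝ≥0} (hst : s ≤ t) {A : Set Ω} (h : Obs N P s A) : Obs N P t A := by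
  obtain ⟨C, hC, hA⟩ := h
  refine ⟨stopPath s ⁻¹' C, measurable_stopPath s hC, ?_⟩
  have : (fun ω => stopPath t (pathOf N ω)) ⁻¹' (stopPath s ⁻¹' C) =
      (fun ω => stopPath s (pathOf N ω)) ⁻¹' C := by
    ext ω
    have : stopPath s (stopPath t (pathOf N ω)) = stopPath s (pathOf N ω) := by
      ext u
      simp only [stopPath, min_eq_left (min_le_of_right_le hst)]
    rw [Set.mem_preimage, Set.mem_preimage, Set.mem_preimage, this]
  rwa [this]

theorem Obs.nullMeasurableSet (hm : ∀ t, Measurable (N t)) {t : ℝ≥0} {A : Set Ω}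
    (h : Obs N P t A) : NullMeasurableSet A P := by
  obtain ⟨C, hC, hA⟩ := h
  refine NullMeasurableSet.congr (MeasurableSet.nullMeasurableSet ?_) hA.symm
  exact ((measurable_stopPath t).comp (measurable_pi_lambda _ hm)) hC

theorem obs_of_stepPath (hN : IsPoissonProcess N r P) {t : ℝ≥0} {A : Set Ω}
    {C : Set (ℝ≥0 → ℕ)} (hC : MeasurableSet C)
    (h : ∀ ω, IsStepPath (pathOf N ω) → (ω ∈ A ↔ stopPath t (pathOf N ω) ∈ C)) :
    Obs N P t A := by
  refine ⟨C, hC, ?_⟩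
  filter_upwards [hN.isStepPath] with ω hω
  exact propext (h ω hω)

/-- Right-continuity of the filtration enters here: `{τ ≤ i}` is the intersection of the events `{τ
< i + δ}` with `δ` arbitrarily small. -/
theorem isStop_of_obs_lt {hm : ∀ t, Measurable (N t)} {τ : Ω → ℝ≥0∞}
    (h : ∀ t : ℝ≥0, Obs N P t {ω | τ ω < t}) : IsStop (obsFiltration N P hm) τ := by
  intro i
  rw [obsFiltration, Filtration.rightCont_eq]
  simp only [MeasurableSpace.measurableSet_iInf]
  intro j hj
  rw [← obs_iff (hm := hm)]
  have hne : Nonempty {n : ℕ // i + 1 / ((n : ℝ≥0) + 1) ≤ j} := by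
    have := tendsto_one_div_add_atTop_nhds_zero_nat (𝕜 := ℝ≥0)
    have h2 := (tendsto_const_nhds (x := i)).add this
    rw [add_zero] at h2
    obtain ⟨n, hn⟩ := ((tendsto_order.1 h2).2 j hj).exists
    exact ⟨⟨n, hn.le⟩⟩
  obtain ⟨n₀, hn₀⟩ := hne
  -- Starting the sequence at `n₀` keeps every time `i + δ` at or before `j`.
  have heq : {ω | τ ω ≤ (i : ℝ≥0∞)} =
      (⋃ n : ℕ, {ω | τ ω < ((i + 1 / (((n + n₀ : ℕ) : ℝ≥0) + 1) : ℝ≥0) : ℝ≥0∞)}ᶜ)ᶜ := by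
    ext ω
    simp only [Set.mem_ofPred_eq, Set.mem_compl_iff, Set.mem_iUnion, not_exists, not_not]
    constructor
    · intro hω n
      refine hω.trans_lt ?_
      rw [ENNReal.coe_lt_coe]
      exact lt_add_of_pos_right _ (by positivity)
    · intro hω
      have hlim : Tendsto (fun n : ℕ => ((i + 1 / (((n + n₀ : ℕ) : ℝ≥0) + 1) : ℝ≥0) : ℝ≥0∞)) atTop
          (𝓝 (i : ℝ≥0∞)) := by
        rw [ENNReal.tendsto_coe]
        have := (tendsto_one_div_add_atTop_nhds_zero_nat (𝕜 := ℝ≥0)).comp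
          (tendsto_add_atTop_nat n₀)
        have h2 := (tendsto_const_nhds (x := i)).add this
        rw [add_zero] at h2
        exact h2
      exact ge_of_tendsto' hlim fun n => (hω n).le
  change Obs N P j {ω | τ ω ≤ (i : ℝ≥0∞)}
  rw [heq]
  refine (Obs.iUnion fun n => (Obs.mono ?_ (h _)).compl).compl
  refine le_trans ?_ hn₀
  gcongr
  linarith [zero_le (a := (n : ℝ≥0))]

theorem IsStop.obs_lt {hm : ∀ t, Measurable (N t)} {τ : Ω → ℝ≥0∞}
    (h : IsStop (obsFiltration N P hm) τ) (t : ℝ≥0) : Obs N P t {ω | τ ω < t} := by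
  have hle : ∀ s < t, Obs N P t {ω | τ ω ≤ s} := by
    intro s hs
    have h1 := h s
    rw [obsFiltration, Filtration.rightCont_eq] at h1
    simp only [MeasurableSpace.measurableSet_iInf] at h1
    exact obs_iff.2 (h1 t hs)
  have heq : {ω | τ ω < (t : ℝ≥0∞)} =
      ⋃ q : {q : ℚ≥0 // (q : ℝ≥0) < t}, {ω | τ ω ≤ ((q.1 : ℝ≥0) : ℝ≥0∞)} := by
    ext ω
    simp only [Set.mem_ofPred_eq, Set.mem_iUnion, Subtype.exists, exists_prop]
    constructor
    · intro hω
      obtain ⟨q, hq0, hq1, hq2⟩ := ENNReal.lt_iff_exists_rat_btwn.1 hω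
      let u : ℚ≥0 := ⟨q, hq0⟩
      have hr : ((u : ℝ≥0) : ℝ≥0∞) = (Real.toNNReal q : ℝ≥0∞) := by
        congr 1
        apply NNReal.coe_injective
        rw [Real.coe_toNNReal _ (by exact_mod_cast hq0)]
        rfl
      refine ⟨u, ?_, ?_⟩
      · rw [← ENNReal.coe_lt_coe, hr]; exact hq2
      · rw [hr]; exact hq1.le
    · rintro ⟨q, hq, hω⟩
      exact hω.trans_lt (by exact_mod_cast hq)
  rw [heq]
  exact Obs.iUnion fun q => hle _ q.2

/-- The filtration lives in the completed σ-algebra, so only measurability up to null sets can be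
expected. -/
theorem IsStop.aemeasurable {hm : ∀ t, Measurable (N t)} {τ : Ω → ℝ≥0∞}
    (h : IsStop (obsFiltration N P hm) τ) : AEMeasurable τ P := by
  refine NullMeasurable.aemeasurable
    (measurable_of_Iio (δ := NullMeasurableSpace Ω P) (f := τ) fun x => ?_)
  cases x with
  | top =>
    have : τ ⁻¹' Set.Iio ⊤ = ⋃ n : ℕ, {ω | τ ω < ((n : ℝ≥0) : ℝ≥0∞)} := by
      ext ω
      simp only [Set.mem_preimage, Set.mem_Iio, Set.mem_iUnion, Set.mem_ofPred_eq,
        ENNReal.coe_natCast]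
      exact ⟨fun h => ENNReal.exists_nat_gt h.ne,
        fun ⟨n, hn⟩ => hn.trans (ENNReal.natCast_lt_top n)⟩
    refine this ▸ ?_
    exact NullMeasurableSet.iUnion fun n => (h.obs_lt n).nullMeasurableSet hm
  | coe x => exact (h.obs_lt x).nullMeasurableSet hm

end

/-! ### Shifted cost, dynamic programming, continuity of the value -/

section

/-! ### The discounted running cost -/

/-- The sum of the coordinates. -/
def size (φ : ℝ × ℝ) : ℝ≥0∞ := ENNReal.ofReal (φ.1 + φ.2)

/-- The discount factor. -/
def disc (p : Params) (t : ℝ) : ℝ≥0∞ := ENNReal.ofReal (Real.exp (-p.lam * t))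

/-- The discounted cost rate, shifted so as to be nonnegative. -/
def runRate (p : Params) (φ : ℝ × ℝ) (w : ℝ≥0 → ℕ) (t : ℝ) : ℝ≥0∞ :=
  disc p t * size (pos p φ t.toNNReal w)

/-- The constant `√2 / c`: minus it is a lower bound of the value function. -/
def bound (p : Params) : ℝ≥0∞ := ENNReal.ofReal (√2 / p.c)

@[fun_prop] theorem measurable_size : Measurable size := by
  unfold size
  fun_prop

@[fun_prop] theorem measurable_disc (p : Params) : Measurable (disc p) := by
  unfold disc
  fun_prop

theorem size_mono : Monotone size := fun _ _ h => ENNReal.ofReal_le_ofReal (add_le_add h.1 h.2)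

theorem size_smul {r : ℝ} (hr : 0 ≤ r) (φ : ℝ × ℝ) :
    size (r • φ) = ENNReal.ofReal r * size φ := by
  rw [size, size, ← ENNReal.ofReal_mul hr]
  simp only [Prod.smul_fst, Prod.smul_snd, smul_eq_mul]
  rw [mul_add]

theorem disc_add (p : Params) (s t : ℝ) : disc p (s + t) = disc p s * disc p t := by
  rw [disc, disc, disc, ← ENNReal.ofReal_mul (Real.exp_pos _).le, ← Real.exp_add, mul_add]

@[simp] theorem disc_zero (p : Params) : disc p 0 = 1 := by simp [disc]

theorem disc_ne_top (p : Params) (t : ℝ) : disc p t ≠ ⊤ := ENNReal.ofReal_ne_top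

theorem disc_ne_zero (p : Params) (t : ℝ) : disc p t ≠ 0 := by
  rw [disc, Ne, ENNReal.ofReal_eq_zero, not_le]
  exact Real.exp_pos _

theorem bound_ne_top (p : Params) : bound p ≠ ⊤ := ENNReal.ofReal_ne_top

theorem disc_le_one {p : Params} (hp : p.Valid) {t : ℝ} (ht : 0 ≤ t) : disc p t ≤ 1 := by
  rw [disc, ENNReal.ofReal_le_one, Real.exp_le_one_iff]
  nlinarith [hp.lam_pos]

theorem disc_antitone {p : Params} (hp : p.Valid) : Antitone (disc p) := by
  intro s t hst
  refine ENNReal.ofReal_le_ofReal (Real.exp_le_exp.2 ?_)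
  nlinarith [hp.lam_pos]

theorem tendsto_disc_atTop {p : Params} (hp : p.Valid) : Tendsto (disc p) atTop (𝓝 0) := by
  rw [← ENNReal.ofReal_zero]
  refine ENNReal.tendsto_ofReal (Real.tendsto_exp_atBot.comp ?_)
  exact tendsto_id.const_mul_atTop_of_neg (by linarith [hp.lam_pos])

theorem continuous_disc (p : Params) : Continuous (disc p) := by
  exact ENNReal.continuous_ofReal.comp (by fun_prop)

theorem measurable_runRate {p : Params} (hp : p.Valid) :
    Measurable fun z : (ℝ × ℝ) × (ℝ≥0 → ℕ) × ℝ => runRate p z.1 z.2.1 z.2.2 := by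
  unfold runRate
  refine Measurable.mul (by fun_prop) (measurable_size.comp ?_)
  exact (measurable_pos hp).comp (by fun_prop :
    Measurable fun z : (ℝ × ℝ) × (ℝ≥0 → ℕ) × ℝ => (z.1, z.2.2.toNNReal, z.2.1))

/-- The running cost up to a deterministic time. -/
theorem measurable_lintegral_runRate {p : Params} (hp : p.Valid) (S : Set ℝ) :
    Measurable fun z : (ℝ × ℝ) × (ℝ≥0 → ℕ) => ∫⁻ t in S, runRate p z.1 z.2 t :=
  Measurable.lintegral_prod_right' (f := fun z : ((ℝ × ℝ) × (ℝ≥0 → ℕ)) × ℝ =>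
    runRate p z.1.1 z.1.2 z.2) ((measurable_runRate hp).comp (by fun_prop :
      Measurable fun z : ((ℝ × ℝ) × (ℝ≥0 → ℕ)) × ℝ => (z.1.1, z.1.2, z.2)))

theorem setLIntegral_Ico_add (f : ℝ → ℝ≥0∞) (s h : ℝ) :
    ∫⁻ t in Set.Ico s (s + h), f t = ∫⁻ t in Set.Ico 0 h, f (s + t) := by
  have hmp := (measurePreserving_add_left volume s).restrict_preimage_emb
    (measurableEmbedding_addLeft s) (Set.Ico s (s + h))
  have hpre : (fun t => s + t) ⁻¹' Set.Ico s (s + h) = Set.Ico 0 h := by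
    ext t; simp
  rw [hpre] at hmp
  rw [← hmp.lintegral_comp_emb (measurableEmbedding_addLeft s)]

theorem IsStepPath.runRate_add {w : ℝ≥0 → ℕ} (hw : IsStepPath w) {p : Params} (hp : p.Valid)
    (φ : ℝ × ℝ) (s : ℝ≥0) {t : ℝ} (ht : 0 ≤ t) :
    runRate p φ w (s + t) =
      disc p s * runRate p (pos p φ s w) (PoissonDisorder.shiftPath s w) t := by
  rw [runRate, runRate, disc_add, mul_assoc, Real.toNNReal_add s.coe_nonneg ht, Real.toNNReal_coe,
    hw.pos_add hp]

theorem IsStepPath.setLIntegral_runRate {w : ℝ≥0 → ℕ} (hw : IsStepPath w) {p : Params}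
    (hp : p.Valid) (φ : ℝ × ℝ) (s : ℝ≥0) (h : ℝ) :
    ∫⁻ t in Set.Ico (s : ℝ) (s + h), runRate p φ w t =
      disc p s * ∫⁻ t in Set.Ico 0 h,
        runRate p (pos p φ s w) (PoissonDisorder.shiftPath s w) t := by
  rw [setLIntegral_Ico_add, ← lintegral_const_mul' _ _ (disc_ne_top p s)]
  exact setLIntegral_congr_fun measurableSet_Ico fun t ht => hw.runRate_add hp φ s ht.1

/-! ### The one-step operator -/

variable {Ω : Type*} [MeasurableSpace Ω] {P : Measure Ω} {N : ℝ≥0 → Ω → ℕ} {p : Params}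

/-- The cost of running for time `h` and then paying `u`. -/
@[irreducible] def stepCost (p : Params) (h : ℝ≥0) (u : ℝ × ℝ → ℝ≥0∞) (φ : ℝ × ℝ)
    (w : ℝ≥0 → ℕ) : ℝ≥0∞ :=
  (∫⁻ t in Set.Ico 0 (h : ℝ), runRate p φ w t) + disc p h * u (pos p φ h w)

/-- The expected cost of running for time `h` and then paying `u`. -/
def stepOp (p : Params) (P : Measure Ω) (N : ℝ≥0 → Ω → ℕ) (h : ℝ≥0) (u : ℝ × ℝ → ℝ≥0∞)
    (φ : ℝ × ℝ) : ℝ≥0∞ :=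
  ∫⁻ ω, stepCost p h u φ (pathOf N ω) ∂P

theorem measurable_stepCost (hp : p.Valid) (h : ℝ≥0) {u : ℝ × ℝ → ℝ≥0∞} (hu : Measurable u) :
    Measurable fun z : (ℝ × ℝ) × (ℝ≥0 → ℕ) => stepCost p h u z.1 z.2 := by
  unfold stepCost
  refine (measurable_lintegral_runRate hp _).add (Measurable.const_mul (hu.comp ?_) _)
  exact (measurable_pos hp).comp (by fun_prop :
    Measurable fun z : (ℝ × ℝ) × (ℝ≥0 → ℕ) => (z.1, h, z.2))

theorem measurable_stepOp [SFinite P] (hp : p.Valid) (hN : IsPoissonProcess N p.mu P) (h : ℝ≥0)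
    {u : ℝ × ℝ → ℝ≥0∞} (hu : Measurable u) : Measurable (stepOp p P N h u) := by
  have h1 := measurable_stepCost hp h hu
  have h2 : Measurable fun z : (ℝ × ℝ) × Ω => (z.1, pathOf N z.2) :=
    measurable_fst.prodMk (hN.measurable_pathOf.comp measurable_snd)
  have h3 := (h1.comp h2).lintegral_prod_right' (ν := P)
  exact h3

theorem measurable_pos_pathOf (hp : p.Valid) (hN : IsPoissonProcess N p.mu P) (φ : ℝ × ℝ)
    {τ : Ω → ℝ≥0} (hτ : Measurable τ) : Measurable fun ω => pos p φ (τ ω) (pathOf N ω) :=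
  (measurable_pos hp).comp (measurable_const.prodMk (hτ.prodMk hN.measurable_pathOf))

theorem measurable_pos_const (hp : p.Valid) (φ : ℝ × ℝ) (t : ℝ≥0) : Measurable (pos p φ t) :=
  (measurable_pos hp).comp (by fun_prop : Measurable fun w : ℝ≥0 → ℕ => (φ, t, w))

/-- The Markov property of the process at deterministic times. -/
theorem setLIntegral_stepOp [IsProbabilityMeasure P] (hp : p.Valid)
    (hN : IsPoissonProcess N p.mu P) (φ : ℝ × ℝ) (s h : ℝ≥0) {u : ℝ × ℝ → ℝ≥0∞}
    (hu : Measurable u) {A : Set Ω} (hA : Obs N P s A) :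
    ∫⁻ ω in A, disc p s * stepOp p P N h u (pos p φ s (pathOf N ω)) ∂P =
      ∫⁻ ω in A, (∫⁻ t in Set.Ico (s : ℝ) (s + h), runRate p φ (pathOf N ω) t) +
        disc p (s + h) * u (pos p φ (s + h) (pathOf N ω)) ∂P := by
  obtain ⟨C, hC, hAC⟩ := hA
  rw [setLIntegral_congr hAC, setLIntegral_congr hAC]
  have hm : MeasurableSet ((fun ω => stopPath s (pathOf N ω)) ⁻¹' C) :=
    ((measurable_stopPath s).comp hN.measurable_pathOf) hC
  rw [← lintegral_indicator hm, ← lintegral_indicator hm]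
  have h2 : Measurable fun z : (ℝ≥0 → ℕ) × (ℝ≥0 → ℕ) => (pos p φ s z.1, z.2) :=
    ((measurable_pos_const hp φ s).comp measurable_fst).prodMk measurable_snd
  have h3 : Measurable fun z : (ℝ≥0 → ℕ) × (ℝ≥0 → ℕ) => stepCost p h u (pos p φ s z.1) z.2 :=
    Measurable.comp (g := fun z : (ℝ × ℝ) × (ℝ≥0 → ℕ) => stepCost p h u z.1 z.2)
      (measurable_stepCost hp h hu) h2
  have h4 : Measurable fun z : (ℝ≥0 → ℕ) × (ℝ≥0 → ℕ) =>
      C.indicator (1 : (ℝ≥0 → ℕ) → ℝ≥0∞) z.1 :=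
    (measurable_one.indicator hC).comp measurable_fst
  -- The event and the position at time `s` are read off the stopped path `v`; the cost of the next
  -- step uses the shifted path `w`, which may be replaced by an independent copy.
  have hF : Measurable (Function.uncurry fun v w : ℝ≥0 → ℕ =>
      C.indicator (1 : (ℝ≥0 → ℕ) → ℝ≥0∞) v * (disc p s * stepCost p h u (pos p φ s v) w)) :=
    h4.mul (h3.const_mul (disc p s))
  have hmarkov := hN.lintegral_stopPath_shiftPath s hF
  have e1 : ∀ᵐ ω ∂P, ((fun ω => stopPath s (pathOf N ω)) ⁻¹' C).indicator
      (fun ω => disc p s * stepOp p P N h u (pos p φ s (pathOf N ω))) ω =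
      ∫⁻ ω', C.indicator (1 : (ℝ≥0 → ℕ) → ℝ≥0∞) (stopPath s (pathOf N ω)) * (disc p s *
        stepCost p h u (pos p φ s (stopPath s (pathOf N ω))) (pathOf N ω')) ∂P := by
    filter_upwards [hN.isStepPath] with ω hω
    by_cases hωC : stopPath s (pathOf N ω) ∈ C
    · rw [Set.indicator_of_mem hωC, Set.indicator_of_mem (a := ω)
        (s := (fun ω => stopPath s (pathOf N ω)) ⁻¹' C) hωC]
      simp only [Pi.one_apply, one_mul]
      rw [lintegral_const_mul' _ _ (disc_ne_top p s), hω.pos_stopPath p φ le_rfl, stepOp]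
    · rw [Set.indicator_of_notMem hωC, Set.indicator_of_notMem (a := ω)
        (s := (fun ω => stopPath s (pathOf N ω)) ⁻¹' C) hωC]
      simp
  have e2 : ∀ᵐ ω ∂P, C.indicator (1 : (ℝ≥0 → ℕ) → ℝ≥0∞) (stopPath s (pathOf N ω)) * (disc p s *
        stepCost p h u (pos p φ s (stopPath s (pathOf N ω))) (shiftPath s (pathOf N ω))) =
      ((fun ω => stopPath s (pathOf N ω)) ⁻¹' C).indicator
      (fun ω => (∫⁻ t in Set.Ico (s : ℝ) (s + h), runRate p φ (pathOf N ω) t) +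
        disc p (s + h) * u (pos p φ (s + h) (pathOf N ω))) ω := by
    filter_upwards [hN.isStepPath] with ω hω
    by_cases hωC : stopPath s (pathOf N ω) ∈ C
    · rw [Set.indicator_of_mem hωC, Set.indicator_of_mem (a := ω)
        (s := (fun ω => stopPath s (pathOf N ω)) ⁻¹' C) hωC]
      simp only [Pi.one_apply, one_mul]
      rw [stepCost, hω.setLIntegral_runRate hp, hω.pos_stopPath p φ le_rfl, mul_add,
        hω.pos_add hp, disc_add, mul_assoc]
    · rw [Set.indicator_of_notMem hωC, Set.indicator_of_notMem (a := ω)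
        (s := (fun ω => stopPath s (pathOf N ω)) ⁻¹' C) hωC]
      simp
  rw [lintegral_congr_ae e1, ← lintegral_congr_ae e2]
  exact hmarkov.symm

theorem stepOp_mono {h : ℝ≥0} {u v : ℝ × ℝ → ℝ≥0∞} (huv : u ≤ v) :
    stepOp p P N h u ≤ stepOp p P N h v := by
  intro φ
  unfold stepOp stepCost
  gcongr
  exact huv _

/-! ### Growth of the process -/

/-- The mean of the growth factor. -/
def growthMean (p : Params) (P : Measure Ω) (N : ℝ≥0 → Ω → ℕ) (h : ℝ≥0) : ℝ≥0∞ :=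
  ∫⁻ ω, ENNReal.ofReal (growth p (N h ω) h) ∂P

/-- The weights `e^{-r} r^n / n!` turn the integral into an exponential series in `r b`. -/
theorem lintegral_poissonMeasure_pow_ne_top (r : ℝ≥0) {a b : ℝ} (_ : 0 ≤ a) (_ : 0 ≤ b) :
    ∫⁻ n : ℕ, ENNReal.ofReal (a * b ^ n) ∂(poissonMeasure r) ≠ ⊤ := by
  rw [poissonMeasure, lintegral_sum_measure]
  simp only [lintegral_smul_measure, lintegral_dirac, smul_eq_mul]
  have h : ∀ n : ℕ, ENNReal.ofReal (Real.exp (-r) * r ^ n / n.factorial) *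
      ENNReal.ofReal (a * b ^ n) =
      ENNReal.ofReal (Real.exp (-r) * a * ((r * b) ^ n / n.factorial)) := by
    intro n
    rw [← ENNReal.ofReal_mul (by positivity)]
    congr 1
    rw [mul_pow]
    ring
  simp_rw [h]
  exact ((Real.summable_pow_div_factorial (r * b)).mul_left _).tsum_ofReal_ne_top

theorem growthMean_ne_top (hp : p.Valid) (hN : IsPoissonProcess N p.mu P) (h : ℝ≥0) :
    growthMean p P N h ≠ ⊤ := by
  have hlaw := hN.law 0 h zero_le
  have heq : growthMean p P N h = ∫⁻ n : ℕ, ENNReal.ofReal (growth p n h)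
      ∂(poissonMeasure (p.mu.toNNReal * (h - 0))) := by
    rw [← hlaw.map_eq, lintegral_map' (Measurable.of_discrete).aemeasurable hlaw.aemeasurable]
    refine lintegral_congr_ae ?_
    filter_upwards [hN.path] with ω hω
    rw [hω.1, Nat.sub_zero]
  rw [heq]
  exact lintegral_poissonMeasure_pow_ne_top _ (Real.exp_pos _).le (by linarith [hp.inv_mu_pos])

theorem IsStepPath.runRate_le {w : ℝ≥0 → ℕ} (hw : IsStepPath w) (hp : p.Valid) {φ : ℝ × ℝ}
    (hφ : φ ∈ quadrant) {t : ℝ} {T : ℝ≥0} (ht : 0 ≤ t) (htT : t ≤ T) :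
    runRate p φ w t ≤ ENNReal.ofReal (growth p (w T) T) *
      ENNReal.ofReal (φ.1 + φ.2 + (p.driftX + p.driftY)) := by
  have h0 : 0 ≤ φ.1 + φ.2 + (p.driftX + p.driftY) := by
    linarith [hφ.1, hφ.2, hp.driftX_pos, hp.driftY_pos]
  rw [← ENNReal.ofReal_mul (growth_pos hp _ _).le]
  refine (mul_le_of_le_one_left zero_le (disc_le_one hp ht)).trans (ENNReal.ofReal_le_ofReal ?_)
  refine (hw.pos_le hp hφ _).trans (mul_le_mul_of_nonneg_right ?_ h0)
  refine growth_mono hp (hw.mono ?_) ?_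
  · exact Real.toNNReal_le_iff_le_coe.2 htT
  · rwa [Real.coe_toNNReal t ht]

/-! ### Value iteration on a dyadic grid -/

/-- The mesh `2^{-k}`. -/
def mesh (k : ℕ) : ℝ≥0 := (1 / 2) ^ k

/-- The (shifted) value with `n` decision times of mesh `2^{-k}`. -/
def stage (p : Params) (P : Measure Ω) (N : ℝ≥0 → Ω → ℕ) (k : ℕ) : ℕ → ℝ × ℝ → ℝ≥0∞
  | 0 => fun _ => bound p
  | n + 1 => fun φ => min (bound p) (stepOp p P N (mesh k) (stage p P N k n) φ)

/-- The (shifted) value function, as a limit over dyadic grids. -/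
def valueLim (p : Params) (P : Measure Ω) (N : ℝ≥0 → Ω → ℕ) (φ : ℝ × ℝ) : ℝ≥0∞ :=
  ⨅ (k : ℕ) (n : ℕ), stage p P N k n φ

theorem stage_le_bound (k n : ℕ) (φ : ℝ × ℝ) : stage p P N k n φ ≤ bound p := by
  cases n with
  | zero => exact le_rfl
  | succ n => exact min_le_left _ _

theorem stage_ne_top (k n : ℕ) (φ : ℝ × ℝ) : stage p P N k n φ ≠ ⊤ :=
  ((stage_le_bound k n φ).trans_lt (bound_ne_top p).lt_top).ne

theorem valueLim_le_stage (k n : ℕ) (φ : ℝ × ℝ) : valueLim p P N φ ≤ stage p P N k n φ :=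
  iInf₂_le (f := fun k n => stage p P N k n φ) k n

theorem valueLim_le_bound (φ : ℝ × ℝ) : valueLim p P N φ ≤ bound p :=
  (valueLim_le_stage 0 0 φ).trans le_rfl

theorem stage_antitone (k : ℕ) : Antitone (stage p P N k) := by
  refine antitone_nat_of_succ_le fun n => ?_
  induction n with
  | zero => exact fun φ => min_le_left _ _
  | succ n ih => exact fun φ => min_le_min_left _ (stepOp_mono ih φ)

theorem measurable_stage [SFinite P] (hp : p.Valid) (hN : IsPoissonProcess N p.mu P) (k n : ℕ) :
    Measurable (stage p P N k n) := by
  induction n with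
  | zero => exact measurable_const
  | succ n ih => exact measurable_const.min (measurable_stepOp hp hN _ ih)

theorem measurable_valueLim [SFinite P] (hp : p.Valid) (hN : IsPoissonProcess N p.mu P) :
    Measurable (valueLim p P N) :=
  Measurable.iInf fun k => Measurable.iInf fun n => measurable_stage hp hN k n

theorem stage_mono (hp : p.Valid) (hN : IsPoissonProcess N p.mu P) (k n : ℕ) :
    Monotone (stage p P N k n) := by
  induction n with
  | zero => exact fun _ _ _ => le_rfl
  | succ n ih =>
    intro φ φ' h
    refine min_le_min_left _ (lintegral_mono_ae ?_)
    filter_upwards [hN.isStepPath] with ω hω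
    unfold stepCost
    gcongr with t
    · exact mul_le_mul_right (size_mono (hω.pos_mono hp h _)) _
    · exact ih (hω.pos_mono hp h _)

/-- The path from `r • φ` dominates `r` times the path from `φ`, the running cost is homogeneous,
and the stopping cost only shrinks under multiplication by `r ≤ 1`. Together with monotonicity this
yields lower semicontinuity. -/
theorem ofReal_mul_stage_le (hp : p.Valid) (hN : IsPoissonProcess N p.mu P) (k n : ℕ)
    {r : ℝ} (hr0 : 0 ≤ r) (hr : r ≤ 1) (φ : ℝ × ℝ) :
    ENNReal.ofReal r * stage p P N k n φ ≤ stage p P N k n (r • φ) := by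
  have hr1 : ENNReal.ofReal r ≤ 1 := ENNReal.ofReal_le_one.2 hr
  induction n generalizing φ with
  | zero => exact mul_le_of_le_one_left zero_le hr1
  | succ n ih =>
    refine le_min ((mul_le_mul_right (min_le_left _ _) _).trans
      (mul_le_of_le_one_left zero_le hr1)) ((mul_le_mul_right (min_le_right _ _) _).trans ?_)
    unfold stepOp stepCost
    rw [← lintegral_const_mul' _ _ ENNReal.ofReal_ne_top]
    refine lintegral_mono_ae ?_
    filter_upwards [hN.isStepPath] with ω hω
    rw [mul_add, ← lintegral_const_mul' _ _ ENNReal.ofReal_ne_top]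
    refine add_le_add (lintegral_mono fun t => ?_) ?_
    · rw [runRate, mul_left_comm, ← size_smul hr0]
      exact mul_le_mul_right (size_mono (hω.smul_pos_le hp φ hr _)) _
    · rw [mul_left_comm]
      exact mul_le_mul_right ((ih _).trans (stage_mono hp hN k n (hω.smul_pos_le hp φ hr _))) _

/-- The Lipschitz bound comes from `IsStepPath.pos_sub_le` and the finite mean of the growth factor.
The constant may depend on `k` and `n`, since only continuity of each single stage is needed. -/
theorem stage_le_add (hp : p.Valid) (hN : IsPoissonProcess N p.mu P)
    (k n : ℕ) : ∃ L : ℝ≥0∞, L ≠ ⊤ ∧ ∀ φ φ' : ℝ × ℝ, ∀ d : ℝ, 0 ≤ d → φ ≤ φ' → φ' ≤ φ + (d, d) →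
      stage p P N k n φ' ≤ stage p P N k n φ + L * ENNReal.ofReal d := by
  induction n with
  | zero => exact ⟨0, ENNReal.zero_ne_top, fun φ φ' d _ _ _ => le_self_add⟩
  | succ n ih =>
    obtain ⟨L, hL, ih⟩ := ih
    set h := mesh k
    refine ⟨(2 * ENNReal.ofReal h + L) * growthMean p P N h, ENNReal.mul_ne_top
      (ENNReal.add_ne_top.2 ⟨ENNReal.mul_ne_top (by simp) ENNReal.ofReal_ne_top, hL⟩)
      (growthMean_ne_top hp hN h), fun φ φ' d hd h1 h2 => ?_⟩
    have key : stepOp p P N h (stage p P N k n) φ' ≤ stepOp p P N h (stage p P N k n) φ +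
        (2 * ENNReal.ofReal h + L) * growthMean p P N h * ENNReal.ofReal d := by
      have hc : (2 * ENNReal.ofReal h + L) * growthMean p P N h * ENNReal.ofReal d =
          ∫⁻ ω, (2 * ENNReal.ofReal h + L) * ENNReal.ofReal (growth p (N h ω) h) *
            ENNReal.ofReal d ∂P := by
        have hm : Measurable fun ω => ENNReal.ofReal (growth p (N h ω) h) :=
          (Measurable.of_discrete (f := fun n => ENNReal.ofReal (growth p n h))).comp
            (hN.measurable h)
        rw [lintegral_mul_const _ (hm.const_mul _), lintegral_const_mul _ hm]
        rfl
      rw [hc]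
      unfold stepOp stepCost
      have hm : Measurable fun ω => (2 * ENNReal.ofReal h + L) *
          ENNReal.ofReal (growth p (N h ω) h) * ENNReal.ofReal d :=
        ((Measurable.of_discrete (f := fun n => (2 * ENNReal.ofReal h + L) *
          ENNReal.ofReal (growth p n h) * ENNReal.ofReal d))).comp (hN.measurable h)
      rw [← lintegral_add_right _ hm]
      refine lintegral_mono_ae ?_
      filter_upwards [hN.isStepPath] with ω hω
      set w := pathOf N ω
      have g0 := (growth_pos hp (w h) h).le
      have e1 : ∫⁻ t in Set.Ico 0 (h : ℝ), runRate p φ' w t ≤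
          (∫⁻ t in Set.Ico 0 (h : ℝ), runRate p φ w t) +
            2 * ENNReal.ofReal h * ENNReal.ofReal (growth p (w h) h) * ENNReal.ofReal d := by
        have hb : ∫⁻ t in Set.Ico 0 (h : ℝ), runRate p φ' w t ≤
            ∫⁻ t in Set.Ico 0 (h : ℝ), (runRate p φ w t +
              2 * ENNReal.ofReal (growth p (w h) h) * ENNReal.ofReal d) := by
          refine setLIntegral_mono' measurableSet_Ico fun t ht => ?_
          have hs : size (pos p φ' t.toNNReal w) ≤ size (pos p φ t.toNNReal w) +
              2 * ENNReal.ofReal (growth p (w h) h) * ENNReal.ofReal d := by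
            have hg : growth p (w t.toNNReal) t.toNNReal ≤ growth p (w h) h :=
              growth_mono hp (hω.mono (Real.toNNReal_le_iff_le_coe.2 ht.2.le))
                (by rw [Real.coe_toNNReal t ht.1]; exact ht.2.le)
            have h3 := hω.pos_sub_le hp h1 h2 t.toNNReal
            have h4 := h3.1
            have h5 := h3.2
            simp only [Prod.fst_add, Prod.snd_add] at h4 h5
            have h6 := mul_le_mul_of_nonneg_right hg hd
            calc size (pos p φ' t.toNNReal w)
                ≤ ENNReal.ofReal ((pos p φ t.toNNReal w).1 + (pos p φ t.toNNReal w).2 +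
                    2 * growth p (w h) h * d) := ENNReal.ofReal_le_ofReal (by linarith)
              _ ≤ _ := by
                refine ENNReal.ofReal_add_le.trans (add_le_add le_rfl (le_of_eq ?_))
                rw [ENNReal.ofReal_mul (by positivity), ENNReal.ofReal_mul (by norm_num)]
                simp
          calc runRate p φ' w t ≤ disc p t * (size (pos p φ t.toNNReal w) +
                2 * ENNReal.ofReal (growth p (w h) h) * ENNReal.ofReal d) :=
                mul_le_mul_right hs _
            _ ≤ _ := by
              rw [mul_add]
              exact add_le_add le_rfl (mul_le_of_le_one_left zero_le (disc_le_one hp ht.1))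
        refine hb.trans (le_of_eq ?_)
        rw [lintegral_add_right _ measurable_const, setLIntegral_const, Real.volume_Ico, sub_zero]
        ring
      have e2 : disc p h * stage p P N k n (pos p φ' h w) ≤
          disc p h * stage p P N k n (pos p φ h w) +
            L * ENNReal.ofReal (growth p (w h) h) * ENNReal.ofReal d := by
        have := ih (pos p φ h w) (pos p φ' h w) (growth p (w h) h * d) (by positivity)
          (hω.pos_mono hp h1 h) (hω.pos_sub_le hp h1 h2 h)
        refine (mul_le_mul_right this _).trans ?_
        rw [mul_add, ENNReal.ofReal_mul g0, mul_assoc L]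
        exact add_le_add le_rfl (mul_le_of_le_one_left zero_le (disc_le_one hp h.2))
      refine (add_le_add e1 e2).trans (le_of_eq ?_)
      change _ = _ + (2 * ENNReal.ofReal h + L) * ENNReal.ofReal (growth p (w h) h) *
        ENNReal.ofReal d
      ring
    calc stage p P N k (n + 1) φ' ≤ min (bound p) (stepOp p P N h (stage p P N k n) φ +
          (2 * ENNReal.ofReal h + L) * growthMean p P N h * ENNReal.ofReal d) :=
          min_le_min_left _ key
      _ ≤ _ := by
        rw [stage, ← min_add_add_right]
        exact min_le_min_right _ le_self_add

theorem continuous_stage (hp : p.Valid) (hN : IsPoissonProcess N p.mu P) (k n : ℕ) :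
    Continuous (stage p P N k n) := by
  obtain ⟨L, hL, h⟩ := stage_le_add hp hN k n
  refine continuous_of_le_add_edist L hL fun φ' φ => ?_
  -- Passing through `φ ⊔ φ'` supplies the ordered pair that the Lipschitz bound requires.
  refine (stage_mono hp hN k n (le_sup_right : φ' ≤ φ ⊔ φ')).trans ?_
  rw [edist_dist]
  refine h φ (φ ⊔ φ') (dist φ' φ) dist_nonneg le_sup_left ?_
  have h1 : |φ'.1 - φ.1| ≤ dist φ' φ := by
    rw [Prod.dist_eq, Real.dist_eq]; exact le_max_left _ _
  have h2 : |φ'.2 - φ.2| ≤ dist φ' φ := by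
    rw [Prod.dist_eq, Real.dist_eq (φ'.2)]; exact le_max_right _ _
  refine sup_le ?_ ?_
  · exact ⟨le_add_of_nonneg_right dist_nonneg, le_add_of_nonneg_right dist_nonneg⟩
  · refine ⟨?_, ?_⟩
    · have := le_abs_self (φ'.1 - φ.1)
      simp only [Prod.fst_add]; linarith
    · have := le_abs_self (φ'.2 - φ.2)
      simp only [Prod.snd_add]; linarith

theorem valueLim_mono (hp : p.Valid) (hN : IsPoissonProcess N p.mu P) :
    Monotone (valueLim p P N) :=
  fun _ _ h => iInf₂_mono fun k n => stage_mono hp hN k n h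

theorem ofReal_mul_valueLim_le (hp : p.Valid) (hN : IsPoissonProcess N p.mu P)
    {r : ℝ} (hr0 : 0 ≤ r) (hr : r ≤ 1) (φ : ℝ × ℝ) :
    ENNReal.ofReal r * valueLim p P N φ ≤ valueLim p P N (r • φ) :=
  le_iInf₂ fun k n => (mul_le_mul_right (valueLim_le_stage k n φ) _).trans
    (ofReal_mul_stage_le hp hN k n hr0 hr φ)

/-- Upper semicontinuity holds for any infimum of continuous functions. For the lower half, every
`ψ` of the quadrant near `φ` satisfies `r • φ ≤ ψ` for fixed `r < 1`, hence `V(ψ) ≥ V(rφ) ≥ r V(φ)`.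
-/
theorem continuousOn_valueLim (hp : p.Valid) (hN : IsPoissonProcess N p.mu P) :
    ContinuousOn (valueLim p P N) quadrant := by
  intro φ hφ
  refine tendsto_order.2 ⟨fun a ha => ?_, fun a ha => ?_⟩
  · have hlim : Tendsto (fun r : ℝ => ENNReal.ofReal r * valueLim p P N φ) (𝓝[<] 1)
        (𝓝 (valueLim p P N φ)) := by
      have : Tendsto (fun r : ℝ => ENNReal.ofReal r) (𝓝[<] 1) (𝓝 1) := by
        rw [← ENNReal.ofReal_one]
        exact (ENNReal.continuous_ofReal.tendsto 1).mono_left nhdsWithin_le_nhds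
      have h2 := ENNReal.Tendsto.mul_const (b := valueLim p P N φ) this (Or.inl one_ne_zero)
      rwa [one_mul] at h2
    have hev : ∀ᶠ r : ℝ in 𝓝[<] 1, r ∈ Set.Ioo (0 : ℝ) 1 := Ioo_mem_nhdsLT one_pos
    obtain ⟨r, hr, hr0, hr1⟩ := (((tendsto_order.1 hlim).1 a ha).and hev).exists
    -- A vanishing coordinate leaves no room for continuity; there the sign constraint of the
    -- quadrant does the work.
    have hcoord : ∀ x : ℝ, 0 ≤ x → ∀ f : ℝ × ℝ → ℝ, Continuous f → f φ = x →
        ∀ᶠ ψ in 𝓝[quadrant] φ, 0 ≤ f ψ → r * x ≤ f ψ := by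
      intro x hx f hf hfx
      rcases hx.eq_or_lt with rfl | hx
      · exact Eventually.of_forall fun ψ h => by simpa using h
      · have h1 : r * x < f φ := by rw [hfx]; nlinarith
        have h2 := (hf.tendsto φ).mono_left (nhdsWithin_le_nhds (s := quadrant))
        filter_upwards [(tendsto_order.1 h2).1 _ h1] with ψ hψ _ using hψ.le
    filter_upwards [hcoord φ.1 hφ.1 _ continuous_fst rfl, hcoord φ.2 hφ.2 _ continuous_snd rfl,
      self_mem_nhdsWithin] with ψ h1 h2 h3
    refine hr.trans_le ((ofReal_mul_valueLim_le hp hN hr0.le hr1.le φ).trans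
      (valueLim_mono hp hN ⟨h1 h3.1, h2 h3.2⟩))
  · obtain ⟨k, hk⟩ := iInf_lt_iff.1 ha
    obtain ⟨n, hn⟩ := iInf_lt_iff.1 hk
    have h2 := ((continuous_stage hp hN k n).tendsto φ).mono_left
      (nhdsWithin_le_nhds (s := quadrant))
    filter_upwards [(tendsto_order.1 h2).2 _ hn] with ψ hψ
    exact (valueLim_le_stage k n ψ).trans_lt hψ

end

/-! ### Grid-valued stopping times and refinement of grids -/

section

variable {Ω : Type*} [MeasurableSpace Ω] {P : Measure Ω} {N : ℝ≥0 → Ω → ℕ} {p : Params}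

/-! ### Stopping on a dyadic grid -/

/-- The `i`-th point of the dyadic grid of mesh `2^{-k}`. -/
def grid (k i : ℕ) : ℝ≥0 := i * mesh k

@[simp] theorem grid_zero (k : ℕ) : grid k 0 = 0 := by simp [grid]

theorem grid_succ (k i : ℕ) : grid k (i + 1) = grid k i + mesh k := by
  simp [grid, add_mul]

theorem grid_mono (k : ℕ) : Monotone (grid k) := fun i j h => by
  unfold grid; gcongr

theorem grid_mul_two_pow (k l i : ℕ) : grid (k + l) (i * 2 ^ l) = grid k i := by
  unfold grid mesh
  push_cast
  rw [pow_add, mul_assoc, mul_left_comm (2 ^ l : ℝ≥0), ← mul_pow]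
  norm_num

theorem setLIntegral_mono_obs (hN : IsPoissonProcess N p.mu P) {t : ℝ≥0} {A : Set Ω}
    (hA : Obs N P t A) {f g : Ω → ℝ≥0∞} (h : ∀ ω ∈ A, IsStepPath (pathOf N ω) → f ω ≤ g ω) :
    ∫⁻ ω in A, f ω ∂P ≤ ∫⁻ ω in A, g ω ∂P := by
  refine lintegral_mono_ae ((ae_restrict_iff'₀ (hA.nullMeasurableSet hN.measurable)).2 ?_)
  filter_upwards [hN.isStepPath] with ω hω hωA using h ω hωA hω

theorem setLIntegral_congr_obs (hN : IsPoissonProcess N p.mu P) {t : ℝ≥0} {A : Set Ω}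
    (hA : Obs N P t A) {f g : Ω → ℝ≥0∞} (h : ∀ ω ∈ A, f ω = g ω) :
    ∫⁻ ω in A, f ω ∂P = ∫⁻ ω in A, g ω ∂P :=
  le_antisymm (setLIntegral_mono_obs hN hA fun ω hω _ => (h ω hω).le)
    (setLIntegral_mono_obs hN hA fun ω hω _ => (h ω hω).ge)

theorem setLIntegral_Ico_split (f : ℝ → ℝ≥0∞) {a b c : ℝ} (hab : a ≤ b) (hbc : b ≤ c) :
    ∫⁻ t in Set.Ico a c, f t = (∫⁻ t in Set.Ico a b, f t) + ∫⁻ t in Set.Ico b c, f t := by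
  rw [← Set.Ico_union_Ico_eq_Ico hab hbc,
    lintegral_union measurableSet_Ico (Set.Ico_disjoint_Ico_same)]

theorem measurable_runTo (hp : p.Valid) (hN : IsPoissonProcess N p.mu P) (φ : ℝ × ℝ)
    (S : Set ℝ) : Measurable fun ω => ∫⁻ t in S, runRate p φ (pathOf N ω) t :=
  (measurable_lintegral_runRate hp S).comp (measurable_const.prodMk hN.measurable_pathOf)

/-- The one-step value `stepOp` in integrated form on an observable event. -/
theorem setLIntegral_stepOp_grid [IsProbabilityMeasure P] (hp : p.Valid)
    (hN : IsPoissonProcess N p.mu P) (φ : ℝ × ℝ) (k i : ℕ) {u : ℝ × ℝ → ℝ≥0∞}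
    (hu : Measurable u) {A : Set Ω} (hA : Obs N P (grid k i) A) :
    ∫⁻ ω in A, disc p (grid k i) * stepOp p P N (mesh k) u (pos p φ (grid k i) (pathOf N ω)) ∂P =
      (∫⁻ ω in A, (∫⁻ t in Set.Ico (grid k i : ℝ) (grid k (i + 1)),
        runRate p φ (pathOf N ω) t) ∂P) +
        ∫⁻ ω in A, disc p (grid k (i + 1)) * u (pos p φ (grid k (i + 1)) (pathOf N ω)) ∂P := by
  rw [setLIntegral_stepOp hp hN φ _ _ hu hA, lintegral_add_left (measurable_runTo hp hN φ _),
    grid_succ, NNReal.coe_add]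

/-- The value after stopping at a grid-valued time is at least the stage value. -/
theorem stage_le_of_stopped [IsProbabilityMeasure P] (hp : p.Valid)
    (hN : IsPoissonProcess N p.mu P) (φ : ℝ × ℝ) (k n : ℕ) {τ : Ω → ℕ} (hτm : Measurable τ)
    (hτ : ∀ j, Obs N P (grid k j) {ω | j < τ ω}) (r : ℕ) : ∀ (i : ℕ) (A : Set Ω),
    Obs N P (grid k i) A → (∀ ω ∈ A, i ≤ τ ω ∧ τ ω ≤ i + r) →
      ∫⁻ ω in A, disc p (grid k i) * stage p P N k (n + r) (pos p φ (grid k i) (pathOf N ω)) ∂P ≤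
        ∫⁻ ω in A, (∫⁻ t in Set.Ico (grid k i : ℝ) (grid k (τ ω)), runRate p φ (pathOf N ω) t) +
          disc p (grid k (τ ω)) * stage p P N k n (pos p φ (grid k (τ ω)) (pathOf N ω)) ∂P := by
  -- Where `τ` has already stopped, the unused decision times can only lower the stage value.
  have hbase : ∀ (r i : ℕ) (A : Set Ω), Obs N P (grid k i) A → (∀ ω ∈ A, τ ω = i) →
      ∫⁻ ω in A, disc p (grid k i) * stage p P N k (n + r) (pos p φ (grid k i) (pathOf N ω)) ∂P ≤
        ∫⁻ ω in A, (∫⁻ t in Set.Ico (grid k i : ℝ) (grid k (τ ω)), runRate p φ (pathOf N ω) t) +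
          disc p (grid k (τ ω)) * stage p P N k n (pos p φ (grid k (τ ω)) (pathOf N ω)) ∂P := by
    intro r i A hA h
    refine setLIntegral_mono_obs hN hA fun ω hω _ => ?_
    rw [h ω hω]
    refine le_add_left (mul_le_mul_right (stage_antitone k (Nat.le_add_right n r) _) _)
  induction r with
  | zero =>
    intro i A hA h
    exact hbase 0 i A hA fun ω hω => le_antisymm (h ω hω).2 (h ω hω).1
  | succ r ih =>
    intro i A hA h
    have hm : MeasurableSet {ω | i < τ ω} := hτm measurableSet_Ioi
    rw [← lintegral_inter_add_sdiff _ A hm, ← lintegral_inter_add_sdiff (fun ω =>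
      (∫⁻ t in Set.Ico (grid k i : ℝ) (grid k (τ ω)), runRate p φ (pathOf N ω) t) +
          disc p (grid k (τ ω)) * stage p P N k n (pos p φ (grid k (τ ω)) (pathOf N ω))) A hm]
    refine add_le_add ?_ ?_
    · have hA2 : Obs N P (grid k i) (A ∩ {ω | i < τ ω}) := hA.inter (hτ i)
      have hih := ih (i + 1) (A ∩ {ω | i < τ ω}) (hA2.mono (grid_mono k (Nat.le_succ i)))
        fun ω hω => ⟨hω.2, by have := (h ω hω.1).2; omega⟩
      calc ∫⁻ ω in A ∩ {ω | i < τ ω},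
            disc p (grid k i) * stage p P N k (n + (r + 1)) (pos p φ (grid k i) (pathOf N ω)) ∂P
          ≤ ∫⁻ ω in A ∩ {ω | i < τ ω}, disc p (grid k i) *
              stepOp p P N (mesh k) (stage p P N k (n + r))
                (pos p φ (grid k i) (pathOf N ω)) ∂P := by
            refine lintegral_mono fun ω => mul_le_mul_right ?_ _
            exact min_le_right _ _
        _ ≤ _ := by
            rw [setLIntegral_stepOp_grid hp hN φ k i (measurable_stage hp hN k _) hA2]
            refine (add_le_add le_rfl hih).trans (le_of_eq ?_)
            rw [← lintegral_add_left (measurable_runTo hp hN φ _)]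
            refine setLIntegral_congr_obs hN hA2 fun ω hω => ?_
            rw [← add_assoc, ← setLIntegral_Ico_split]
            · exact NNReal.coe_le_coe.2 (grid_mono k (Nat.le_succ i))
            · exact NNReal.coe_le_coe.2 (grid_mono k hω.2)
    · refine hbase (r + 1) i _ (hA.inter (hτ i).compl) fun ω hω => ?_
      have := (h ω hω.1).1
      have h2 : ¬ i < τ ω := hω.2
      omega

/-- The first grid time at which the stage value is the cost of stopping. -/
def optIndex (p : Params) (P : Measure Ω) (N : ℝ≥0 → Ω → ℕ) (φ : ℝ × ℝ) (k n : ℕ) (ω : Ω) : ℕ :=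
  sInf {j | bound p ≤ stage p P N k (n - j) (pos p φ (grid k j) (pathOf N ω))}

/-- Whether the rule continues past `j` depends on the grid positions up to `j` alone, which makes
it adapted. The defining set contains `n`, as the last stage is the stopping cost. -/
theorem lt_optIndex_iff {φ : ℝ × ℝ} {k n j : ℕ} {ω : Ω} : j < optIndex p P N φ k n ω ↔
    ∀ l ≤ j, stage p P N k (n - l) (pos p φ (grid k l) (pathOf N ω)) < bound p := by
  have hne : {j | bound p ≤ stage p P N k (n - j) (pos p φ (grid k j) (pathOf N ω))}.Nonempty :=
    ⟨n, by simp [stage]⟩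
  constructor
  · intro h l hl
    by_contra hcon
    have hle : optIndex p P N φ k n ω ≤ l := Nat.sInf_le (not_lt.1 hcon)
    omega
  · intro h
    by_contra hcon
    exact absurd (Nat.sInf_mem hne) (not_le.2 (h _ (not_lt.1 hcon)))

theorem bound_le_stage_optIndex {φ : ℝ × ℝ} {k n : ℕ} {ω : Ω} :
    bound p ≤ stage p P N k (n - optIndex p P N φ k n ω)
      (pos p φ (grid k (optIndex p P N φ k n ω)) (pathOf N ω)) :=
  Nat.sInf_mem (s := {j | bound p ≤ stage p P N k (n - j) (pos p φ (grid k j) (pathOf N ω))})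
    ⟨n, by simp [stage]⟩

theorem optIndex_le {φ : ℝ × ℝ} {k n : ℕ} {ω : Ω} : optIndex p P N φ k n ω ≤ n :=
  Nat.sInf_le (by simp [stage])

theorem measurable_optIndex [SFinite P] (hp : p.Valid) (hN : IsPoissonProcess N p.mu P)
    (φ : ℝ × ℝ) (k n : ℕ) : Measurable (optIndex p P N φ k n) := by
  refine measurable_of_Ioi fun j => ?_
  have : optIndex p P N φ k n ⁻¹' Set.Ioi j = ⋂ l ∈ Set.Iic j,
      {ω | stage p P N k (n - l) (pos p φ (grid k l) (pathOf N ω)) < bound p} := by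
    ext ω
    simp only [Set.mem_preimage, Set.mem_Ioi, lt_optIndex_iff, Set.mem_iInter, Set.mem_Iic,
      Set.mem_ofPred_eq]
  rw [this]
  refine MeasurableSet.biInter (Set.to_countable _) fun l _ => ?_
  exact measurableSet_lt ((measurable_stage hp hN k _).comp
    (measurable_pos_pathOf hp hN φ measurable_const)) measurable_const

theorem obs_lt_optIndex [SFinite P] (hp : p.Valid) (hN : IsPoissonProcess N p.mu P)
    (φ : ℝ × ℝ) (k n j : ℕ) : Obs N P (grid k j) {ω | j < optIndex p P N φ k n ω} := by
  refine obs_of_stepPath hN (C := ⋂ l ∈ Set.Iic j,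
    {w | stage p P N k (n - l) (pos p φ (grid k l) w) < bound p}) ?_ fun ω hω => ?_
  · refine MeasurableSet.biInter (Set.to_countable _) fun l _ => ?_
    exact measurableSet_lt ((measurable_stage hp hN k _).comp
      (measurable_pos_const hp φ _)) measurable_const
  · simp only [Set.mem_ofPred_eq, lt_optIndex_iff, Set.mem_iInter, Set.mem_Iic]
    refine forall₂_congr fun l hl => ?_
    rw [hω.pos_stopPath p φ (grid_mono k hl)]

/-- Up to `optIndex`, continuing for one more grid step does not increase the expected cost. -/
theorem stopped_le_stage_aux [IsProbabilityMeasure P] (hp : p.Valid)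
    (hN : IsPoissonProcess N p.mu P) (φ : ℝ × ℝ) (k n : ℕ) {τ : Ω → ℕ} (hτm : Measurable τ)
    (hτ : ∀ j, Obs N P (grid k j) {ω | j < τ ω}) (hle : ∀ ω, τ ω ≤ optIndex p P N φ k n ω)
    (r : ℕ) : ∀ (i : ℕ) (A : Set Ω),
    i + r = n → Obs N P (grid k i) A → (∀ ω ∈ A, i ≤ τ ω) →
      ∫⁻ ω in A, (∫⁻ t in Set.Ico (grid k i : ℝ) (grid k (τ ω)), runRate p φ (pathOf N ω) t) +
          disc p (grid k (τ ω)) *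
            stage p P N k (n - τ ω) (pos p φ (grid k (τ ω)) (pathOf N ω)) ∂P ≤
      ∫⁻ ω in A, disc p (grid k i) * stage p P N k r (pos p φ (grid k i) (pathOf N ω)) ∂P := by
  have hbase : ∀ (r i : ℕ) (A : Set Ω), i + r = n → Obs N P (grid k i) A →
      (∀ ω ∈ A, τ ω = i) →
      ∫⁻ ω in A, (∫⁻ t in Set.Ico (grid k i : ℝ) (grid k (τ ω)), runRate p φ (pathOf N ω) t) +
          disc p (grid k (τ ω)) *
            stage p P N k (n - τ ω) (pos p φ (grid k (τ ω)) (pathOf N ω)) ∂P ≤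
      ∫⁻ ω in A, disc p (grid k i) * stage p P N k r (pos p φ (grid k i) (pathOf N ω)) ∂P := by
    intro r i A hn hA h
    refine setLIntegral_mono_obs hN hA fun ω hω _ => ?_
    rw [h ω hω, Set.Ico_self, Measure.restrict_empty, lintegral_zero_measure, zero_add,
      show n - i = r by omega]
  have hm : ∀ i, MeasurableSet {ω | i < τ ω} := fun i => hτm measurableSet_Ioi
  induction r with
  | zero =>
    intro i A hn hA h
    refine hbase 0 i A hn hA fun ω hω => le_antisymm ?_ (h ω hω)
    have := optIndex_le (p := p) (P := P) (N := N) (φ := φ) (k := k) (n := n) (ω := ω)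
    have := hle ω
    omega
  | succ r ih =>
    intro i A hn hA h
    rw [← lintegral_inter_add_sdiff _ A (hm i), ← lintegral_inter_add_sdiff (fun ω =>
      disc p (grid k i) * stage p P N k (r + 1) (pos p φ (grid k i) (pathOf N ω))) A (hm i)]
    have hA2 : Obs N P (grid k i) (A ∩ {ω | i < τ ω}) := hA.inter (hτ i)
    refine add_le_add ?_ ?_
    · have hih := ih (i + 1) _ (by omega) (hA2.mono (grid_mono k (Nat.le_succ i)))
        fun ω hω => hω.2
      have hstep : ∫⁻ ω in A ∩ {ω | i < τ ω}, disc p (grid k i) *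
            stage p P N k (r + 1) (pos p φ (grid k i) (pathOf N ω)) ∂P =
          ∫⁻ ω in A ∩ {ω | i < τ ω}, disc p (grid k i) *
              stepOp p P N (mesh k) (stage p P N k r) (pos p φ (grid k i) (pathOf N ω)) ∂P := by
        refine setLIntegral_congr_obs hN hA2 fun ω hω => ?_
        -- Strictly before the optimal index the minimum defining the stage is the continuation
        -- cost, so the recursion is an equality.
        have h1 := lt_optIndex_iff.1 (lt_of_lt_of_le hω.2 (hle ω)) i le_rfl
        rw [show n - i = r + 1 by omega, stage, min_lt_iff] at h1
        change _ * min _ _ = _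
        rw [min_eq_right (h1.resolve_left (lt_irrefl _)).le]
      rw [hstep, setLIntegral_stepOp_grid hp hN φ k i (measurable_stage hp hN k _) hA2]
      refine le_trans (le_of_eq ?_) (add_le_add le_rfl hih)
      rw [← lintegral_add_left (measurable_runTo hp hN φ _)]
      refine setLIntegral_congr_obs hN hA2 fun ω hω => ?_
      rw [← add_assoc, ← setLIntegral_Ico_split]
      · exact NNReal.coe_le_coe.2 (grid_mono k (Nat.le_succ i))
      · exact NNReal.coe_le_coe.2 (grid_mono k hω.2)
    · refine hbase (r + 1) i _ hn (hA.inter (hτ i).compl) fun ω hω => ?_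
      have := h ω hω.1
      have h2 : ¬ i < τ ω := hω.2
      omega

theorem stage_start (hp : p.Valid) (hN : IsPoissonProcess N p.mu P) [IsProbabilityMeasure P]
    (φ : ℝ × ℝ) (k n : ℕ) : ∫⁻ ω in Set.univ, disc p (grid k 0) *
      stage p P N k n (pos p φ (grid k 0) (pathOf N ω)) ∂P = stage p P N k n φ := by
  rw [Measure.restrict_univ, lintegral_congr_ae (g := fun _ => stage p P N k n φ)]
  · simp
  · filter_upwards [hN.isStepPath] with ω hω
    rw [grid_zero, hω.pos_zero hp]
    simp

theorem stopped_le_stage [IsProbabilityMeasure P] (hp : p.Valid)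
    (hN : IsPoissonProcess N p.mu P) (φ : ℝ × ℝ) (k n : ℕ) {τ : Ω → ℕ} (hτm : Measurable τ)
    (hτ : ∀ j, Obs N P (grid k j) {ω | j < τ ω}) (hle : ∀ ω, τ ω ≤ optIndex p P N φ k n ω) :
    ∫⁻ ω, (∫⁻ t in Set.Ico 0 (grid k (τ ω) : ℝ), runRate p φ (pathOf N ω) t) +
      disc p (grid k (τ ω)) *
        stage p P N k (n - τ ω) (pos p φ (grid k (τ ω)) (pathOf N ω)) ∂P ≤
      stage p P N k n φ := by
  have h := stopped_le_stage_aux hp hN φ k n hτm hτ hle n 0 Set.univ (zero_add n) obs_univ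
    fun ω _ => Nat.zero_le _
  rw [stage_start hp hN, Measure.restrict_univ] at h
  simpa using h

/-- The stage value is attained by a grid-valued stopping time. -/
theorem optIndex_cost_le [IsProbabilityMeasure P] (hp : p.Valid)
    (hN : IsPoissonProcess N p.mu P) (φ : ℝ × ℝ) (k n : ℕ) :
    ∫⁻ ω, (∫⁻ t in Set.Ico 0 (grid k (optIndex p P N φ k n ω) : ℝ),
      runRate p φ (pathOf N ω) t) + disc p (grid k (optIndex p P N φ k n ω)) * bound p ∂P ≤
      stage p P N k n φ := by
  refine le_trans (lintegral_mono fun ω => ?_) (stopped_le_stage hp hN φ k n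
    (measurable_optIndex hp hN φ k n) (obs_lt_optIndex hp hN φ k n) fun ω => le_rfl)
  exact add_le_add le_rfl (mul_le_mul_right bound_le_stage_optIndex _)

theorem stage_le_of_index [IsProbabilityMeasure P] (hp : p.Valid)
    (hN : IsPoissonProcess N p.mu P) (φ : ℝ × ℝ) (k n m : ℕ) {τ : Ω → ℕ} (hτm : Measurable τ)
    (hτ : ∀ j, Obs N P (grid k j) {ω | j < τ ω}) (hle : ∀ ω, τ ω ≤ n) :
    stage p P N k (m + n) φ ≤
      ∫⁻ ω, (∫⁻ t in Set.Ico 0 (grid k (τ ω) : ℝ), runRate p φ (pathOf N ω) t) +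
        disc p (grid k (τ ω)) * stage p P N k m (pos p φ (grid k (τ ω)) (pathOf N ω)) ∂P := by
  have h := stage_le_of_stopped hp hN φ k m hτm hτ n 0 Set.univ obs_univ
    fun ω _ => ⟨Nat.zero_le _, by rw [zero_add]; exact hle ω⟩
  rw [stage_start hp hN, Measure.restrict_univ] at h
  simpa using h

/-- The coarse decision numbered `j / 2 ^ l` is made no later than the fine grid time numbered `j`.
-/
theorem obs_lt_mul {k l : ℕ} {τ : Ω → ℕ} (hτ : ∀ j, Obs N P (grid k j) {ω | j < τ ω}) (j : ℕ) :
    Obs N P (grid (k + l) j) {ω | j < τ ω * 2 ^ l} := by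
  have h2 : 0 < 2 ^ l := by positivity
  have heq : {ω | j < τ ω * 2 ^ l} = {ω | j / 2 ^ l < τ ω} := by
    ext ω
    exact (Nat.div_lt_iff_lt_mul h2).symm
  rw [heq]
  refine (hτ _).mono ?_
  rw [← grid_mul_two_pow k l]
  exact grid_mono _ (Nat.div_mul_le_self _ _)

/-- Refining the grid lowers the stage value. -/
theorem stage_refine [IsProbabilityMeasure P] (hp : p.Valid)
    (hN : IsPoissonProcess N p.mu P) (k l n : ℕ) (φ : ℝ × ℝ) :
    stage p P N (k + l) (n * 2 ^ l) φ ≤ stage p P N k n φ := by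
  refine le_trans ?_ (optIndex_cost_le hp hN φ k n)
  -- The optimal coarse rule, read on the fine grid, is an admissible competitor there.
  have h := stage_le_of_index hp hN φ (k + l) (n * 2 ^ l) 0
    (τ := fun ω => optIndex p P N φ k n ω * 2 ^ l) ((measurable_optIndex hp hN φ k n).mul_const _)
    (obs_lt_mul fun j => obs_lt_optIndex hp hN φ k n j)
    (fun ω => Nat.mul_le_mul_right _ optIndex_le)
  rw [zero_add] at h
  simpa only [grid_mul_two_pow, stage] using h

/-- A decreasing sequence of stage values converging to the value function. -/
def diagStage (p : Params) (P : Measure Ω) (N : ℝ≥0 → Ω → ℕ) (j : ℕ) : ℝ × ℝ → ℝ≥0∞ :=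
  stage p P N j (j * 2 ^ j)

theorem diagStage_antitone [IsProbabilityMeasure P] (hp : p.Valid)
    (hN : IsPoissonProcess N p.mu P) : Antitone (diagStage p P N) := by
  refine antitone_nat_of_succ_le fun j φ => ?_
  refine le_trans ?_ (stage_refine hp hN j 1 (j * 2 ^ j) φ)
  refine stage_antitone (j + 1) ?_ φ
  rw [pow_one, mul_assoc, ← pow_succ]
  exact Nat.mul_le_mul_right _ (Nat.le_succ j)

/-- The diagonal index `k + n` beats the pair `(k, n)`: its mesh refines `2^{-k}` by `2 ^ n`, and
its horizon has at least `n * 2 ^ n` steps. -/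
theorem iInf_diagStage [IsProbabilityMeasure P] (hp : p.Valid)
    (hN : IsPoissonProcess N p.mu P) (φ : ℝ × ℝ) :
    ⨅ j, diagStage p P N j φ = valueLim p P N φ := by
  refine le_antisymm (le_iInf₂ fun k n => ?_) (le_iInf fun j => valueLim_le_stage _ _ φ)
  refine (iInf_le _ (k + n)).trans (le_trans ?_ (stage_refine hp hN k n n φ))
  refine stage_antitone (k + n) ?_ φ
  gcongr
  · exact Nat.le_add_left n k
  · norm_num
  · exact Nat.le_add_left n k

end

/-! ### Lower bound for arbitrary stopping times -/

section

variable {Ω : Type*} [MeasurableSpace Ω] {P : Measure Ω} {N : ℝ≥0 → Ω → ℕ} {p : Params}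

/-! ### Cost of stopping at a general time -/

/-- The running cost up to an extended time. -/
def runCost (p : Params) (φ : ℝ × ℝ) (w : ℝ≥0 → ℕ) (τ : ℝ≥0∞) : ℝ≥0∞ :=
  ∫⁻ t in {t : ℝ | 0 ≤ t ∧ ENNReal.ofReal t < τ}, runRate p φ w t

/-- The discount factor at an extended time. -/
def discE (p : Params) (τ : ℝ≥0∞) : ℝ≥0∞ := if τ = ⊤ then 0 else disc p τ.toReal

/-- The running cost up to `τ` plus the discounted terminal cost `u`. -/
def stopCost (p : Params) (u : ℝ × ℝ → ℝ≥0∞) (φ : ℝ × ℝ) (w : ℝ≥0 → ℕ) (τ : ℝ≥0∞) : ℝ≥0∞ :=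
  runCost p φ w τ + discE p τ * u (pos p φ τ.toNNReal w)

theorem measurableSet_before (τ : ℝ≥0∞) :
    MeasurableSet {t : ℝ | 0 ≤ t ∧ ENNReal.ofReal t < τ} :=
  (measurableSet_le measurable_const measurable_id).inter
    (measurableSet_lt ENNReal.measurable_ofReal measurable_const)

theorem before_coe (t : ℝ≥0) :
    {s : ℝ | 0 ≤ s ∧ ENNReal.ofReal s < (t : ℝ≥0∞)} = Set.Ico 0 (t : ℝ) := by
  ext s
  refine and_congr_right fun hs => ?_
  rw [ENNReal.ofReal, ENNReal.coe_lt_coe, Real.toNNReal_lt_iff_lt_coe hs]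

theorem runCost_coe (φ : ℝ × ℝ) (w : ℝ≥0 → ℕ) (t : ℝ≥0) :
    runCost p φ w t = ∫⁻ s in Set.Ico 0 (t : ℝ), runRate p φ w s := by
  rw [runCost, before_coe]

theorem runCost_mono (φ : ℝ × ℝ) (w : ℝ≥0 → ℕ) : Monotone (runCost p φ w) :=
  fun _ _ h => lintegral_mono_set fun _ hs => ⟨hs.1, hs.2.trans_le h⟩

theorem runCost_eq (φ : ℝ × ℝ) (w : ℝ≥0 → ℕ) (τ : ℝ≥0∞) :
    runCost p φ w τ = ∫⁻ t, {t : ℝ | 0 ≤ t ∧ ENNReal.ofReal t < τ}.indicator (runRate p φ w) t :=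
  (lintegral_indicator (measurableSet_before τ) _).symm

@[simp] theorem discE_coe (t : ℝ≥0) : discE p t = disc p t := by simp [discE]

@[simp] theorem discE_top : discE p ⊤ = 0 := by simp [discE]

theorem discE_le_one (hp : p.Valid) (τ : ℝ≥0∞) : discE p τ ≤ 1 := by
  unfold discE
  split_ifs
  · exact zero_le_one
  · exact disc_le_one hp ENNReal.toReal_nonneg

theorem measurable_discE (p : Params) : Measurable (discE p) := by
  unfold discE
  exact Measurable.ite (measurableSet_singleton _) measurable_const (by fun_prop)

theorem measurable_runCost (hp : p.Valid) (hN : IsPoissonProcess N p.mu P) (φ : ℝ × ℝ)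
    {τ : Ω → ℝ≥0∞} (hτ : Measurable τ) :
    Measurable fun ω => runCost p φ (pathOf N ω) (τ ω) := by
  simp only [runCost_eq]
  refine Measurable.lintegral_prod_right' (f := fun z : Ω × ℝ =>
    {t : ℝ | 0 ≤ t ∧ ENNReal.ofReal t < τ z.1}.indicator (runRate p φ (pathOf N z.1)) z.2) ?_
  have hm : Measurable fun z : Ω × ℝ => runRate p φ (pathOf N z.1) z.2 :=
    (measurable_runRate hp).comp (measurable_const.prodMk
      ((hN.measurable_pathOf.comp measurable_fst).prodMk measurable_snd))
  have hs : MeasurableSet {z : Ω × ℝ | 0 ≤ z.2 ∧ ENNReal.ofReal z.2 < τ z.1} :=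
    (measurableSet_le measurable_const measurable_snd).inter
      (measurableSet_lt (by fun_prop) (hτ.comp measurable_fst))
  exact hm.indicator hs

theorem measurable_stopCost (hp : p.Valid) (hN : IsPoissonProcess N p.mu P) (φ : ℝ × ℝ)
    {u : ℝ × ℝ → ℝ≥0∞} (hu : Measurable u) {τ : Ω → ℝ≥0∞} (hτ : Measurable τ) :
    Measurable fun ω => stopCost p u φ (pathOf N ω) (τ ω) :=
  (measurable_runCost hp hN φ hτ).add (((measurable_discE p).comp hτ).mul
    (hu.comp (measurable_pos_pathOf hp hN φ hτ.ennreal_toNNReal)))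

theorem measurable_runRate_path (hp : p.Valid) (φ : ℝ × ℝ) (w : ℝ≥0 → ℕ) :
    Measurable (runRate p φ w) :=
  (measurable_runRate hp).comp (measurable_const.prodMk (measurable_const.prodMk measurable_id))

/-- The running cost is lower semicontinuous in time. -/
theorem runCost_le_liminf (hp : p.Valid) (φ : ℝ × ℝ) (w : ℝ≥0 → ℕ) {s : ℕ → ℝ≥0∞} {τ : ℝ≥0∞}
    (h : ∀ t < τ, ∀ᶠ j in atTop, t < s j) :
    runCost p φ w τ ≤ liminf (fun j => runCost p φ w (s j)) atTop := by
  simp only [runCost_eq]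
  refine le_trans (lintegral_mono fun t => ?_) (lintegral_liminf_le fun j =>
    (measurable_runRate_path hp φ w).indicator (measurableSet_before (s j)))
  by_cases ht : t ∈ {t : ℝ | 0 ≤ t ∧ ENNReal.ofReal t < τ}
  · refine le_liminf_of_le (by isBoundedDefault) ?_
    filter_upwards [h _ ht.2] with j hj
    rw [Set.indicator_of_mem ht, Set.indicator_of_mem]
    exact ⟨ht.1, hj⟩
  · rw [Set.indicator_of_notMem ht]
    exact zero_le

/-- A bound for the cost rate on `[0, T]`. -/
def rateBound (p : Params) (φ : ℝ × ℝ) (T : ℝ≥0) (w : ℝ≥0 → ℕ) : ℝ≥0∞ :=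
  ENNReal.ofReal (growth p (w T) T) * ENNReal.ofReal (φ.1 + φ.2 + (p.driftX + p.driftY))

theorem lintegral_rateBound_ne_top (hp : p.Valid) (hN : IsPoissonProcess N p.mu P) (φ : ℝ × ℝ)
    (T : ℝ≥0) : ∫⁻ ω, rateBound p φ T (pathOf N ω) ∂P ≠ ⊤ := by
  unfold rateBound
  rw [lintegral_mul_const' _ _ ENNReal.ofReal_ne_top]
  exact ENNReal.mul_ne_top (growthMean_ne_top hp hN T) ENNReal.ofReal_ne_top

theorem runCost_le_add {w : ℝ≥0 → ℕ} (hw : IsStepPath w) (hp : p.Valid) {φ : ℝ × ℝ}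
    (hφ : φ ∈ quadrant) {s t d T : ℝ≥0} (hst : s ≤ t) (hd : t ≤ s + d) (hT : t ≤ T) :
    runCost p φ w t ≤ runCost p φ w s + rateBound p φ T w * d := by
  rw [runCost_coe, runCost_coe, setLIntegral_Ico_split (b := (s : ℝ)) _ s.coe_nonneg
    (NNReal.coe_le_coe.2 hst)]
  refine add_le_add le_rfl ?_
  refine (setLIntegral_mono measurable_const (g := fun _ => rateBound p φ T w) fun x hx =>
    hw.runRate_le hp hφ (s.coe_nonneg.trans hx.1)
      (hx.2.le.trans (NNReal.coe_le_coe.2 hT))).trans ?_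
  rw [setLIntegral_const, Real.volume_Ico]
  refine mul_le_mul_right ?_ _
  refine ENNReal.ofReal_le_of_le_toReal ?_
  have : (t : ℝ) ≤ s + d := by exact_mod_cast hd
  rw [ENNReal.coe_toReal]
  linarith

/-! ### Rounding up to the grid -/

/-- The index of the first grid point after `x`, capped at `M`. -/
def upIndex (k M : ℕ) (x : ℝ≥0∞) : ℕ := sInf {j | M ≤ j ∨ x < grid k j}

/-- The strict inequality in `upIndex` is chosen so that going past `j` means `grid k j ≤ x`, the
complement of an event `{τ < t}` observable at that grid time. -/
theorem lt_upIndex_iff {k M j : ℕ} {x : ℝ≥0∞} :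
    j < upIndex k M x ↔ j < M ∧ (grid k j : ℝ≥0∞) ≤ x := by
  have hne : {j | M ≤ j ∨ x < grid k j}.Nonempty := ⟨M, Or.inl le_rfl⟩
  constructor
  · intro h
    have := Nat.notMem_of_lt_sInf h
    rw [Set.mem_ofPred_eq] at this
    push Not at this
    exact this
  · rintro ⟨h1, h2⟩
    by_contra hcon
    rcases Nat.sInf_mem hne with h | h
    · have := h.trans (not_lt.1 hcon)
      omega
    · refine absurd (h.trans_le (ENNReal.coe_le_coe.2 (grid_mono k (not_lt.1 hcon)))) ?_
      exact not_lt.2 h2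

theorem upIndex_le (k M : ℕ) (x : ℝ≥0∞) : upIndex k M x ≤ M := Nat.sInf_le (Or.inl le_rfl)

theorem le_grid_upIndex (k M : ℕ) (x : ℝ≥0∞) : min x (grid k M) ≤ grid k (upIndex k M x) := by
  have h := Nat.sInf_mem (s := {j | M ≤ j ∨ x < grid k j}) ⟨M, Or.inl le_rfl⟩
  rcases h with h | h
  · exact (min_le_right _ _).trans (ENNReal.coe_le_coe.2 (grid_mono k h))
  · exact (min_le_left _ _).trans h.le

theorem grid_upIndex_le (k M : ℕ) (x : ℝ≥0∞) :
    (grid k (upIndex k M x) : ℝ≥0∞) ≤ min x (grid k M) + mesh k := by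
  rcases Nat.eq_zero_or_pos (upIndex k M x) with h | h
  · rw [h, grid_zero]
    exact zero_le
  · obtain ⟨j, hj⟩ := Nat.exists_eq_add_of_lt h
    rw [zero_add] at hj
    have := lt_upIndex_iff.1 (show j < upIndex k M x by omega)
    rw [hj, grid_succ, ENNReal.coe_add]
    refine add_le_add (le_min this.2 (ENNReal.coe_le_coe.2 (grid_mono k this.1.le))) le_rfl

theorem measurable_upIndex (k M : ℕ) : Measurable (upIndex k M) := by
  refine measurable_of_Ioi fun j => ?_
  have : upIndex k M ⁻¹' Set.Ioi j = {x | j < M ∧ (grid k j : ℝ≥0∞) ≤ x} := by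
    ext x
    exact lt_upIndex_iff
  rw [this]
  exact (MeasurableSet.const _).inter measurableSet_Ici

theorem tendsto_mesh : Tendsto (fun k => (mesh k : ℝ≥0∞)) atTop (𝓝 0) := by
  rw [← ENNReal.coe_zero, ENNReal.tendsto_coe]
  unfold mesh
  exact NNReal.tendsto_pow_atTop_nhds_zero_of_lt_one (by norm_num)

/-- A measurable optional time of the observation filtration. -/
structure IsObsTime (N : ℝ≥0 → Ω → ℕ) (P : Measure Ω) (τ : Ω → ℝ≥0∞) : Prop where
  measurable : Measurable τ
  obs_lt : ∀ t : ℝ≥0, Obs N P t {ω | τ ω < t}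

theorem IsObsTime.obs_lt_upIndex {τ : Ω → ℝ≥0∞} (h : IsObsTime N P τ) (k M j : ℕ) :
    Obs N P (grid k j) {ω | j < upIndex k M (τ ω)} := by
  simp only [lt_upIndex_iff]
  by_cases hj : j < M
  · simp only [hj, true_and]
    have := (h.obs_lt (grid k j)).compl
    simpa only [Set.compl_ofPred, not_lt] using this
  · simp only [hj, false_and]
    exact obs_empty

/-! ### The value function bounds the cost of every stopping time from below -/

theorem tendsto_of_right {X : Type*} [TopologicalSpace X] {f : ℝ≥0 → X} {t : ℝ≥0}
    (hf : ContinuousWithinAt f (Set.Ici t) t) {s : ℕ → ℝ≥0}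
    (hs : ∀ᶠ j in atTop, t ≤ s j) (hlim : Tendsto s atTop (𝓝 t)) :
    Tendsto (fun j => f (s j)) atTop (𝓝 (f t)) :=
  hf.tendsto.comp (tendsto_nhdsWithin_iff.2 ⟨hlim, hs⟩)

theorem mesh_le_one (k : ℕ) : mesh k ≤ 1 := by
  unfold mesh
  exact pow_le_one₀ (by norm_num) (by norm_num)

theorem tendsto_of_le_add_mesh {t : ℝ≥0} {s : ℕ → ℝ≥0} (h1 : ∀ k, t ≤ s k)
    (h2 : ∀ k, s k ≤ t + mesh k) : Tendsto s atTop (𝓝 t) := by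
  refine tendsto_of_tendsto_of_tendsto_of_le_of_le tendsto_const_nhds ?_ h1 h2
  have : Tendsto mesh atTop (𝓝 0) := by
    have := tendsto_mesh
    rwa [← ENNReal.coe_zero, ENNReal.tendsto_coe] at this
  simpa using tendsto_const_nhds.add this

/-- The capped time is rounded up to the grid of mesh `2^{-(j+l)}`, where the stage inequality
applies; the horizon left after it, refined by `2 ^ l`, still dominates the fixed function
`diagStage p P N j`. As `l` grows the rounded times decrease to the capped time up to a vanishing
mesh, and right-continuity with domination gives the limit. -/
theorem valueLim_le_stopCost_diag [IsProbabilityMeasure P] (hp : p.Valid)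
    (hN : IsPoissonProcess N p.mu P) {φ : ℝ × ℝ} (hφ : φ ∈ quadrant) {τ : Ω → ℝ≥0∞}
    (hτ : IsObsTime N P τ) (T j : ℕ) :
    valueLim p P N φ ≤ (∫⁻ ω, runCost p φ (pathOf N ω) (min (τ ω) T) ∂P) +
      ∫⁻ ω, discE p (min (τ ω) T) *
        diagStage p P N j (pos p φ (min (τ ω) T).toNNReal (pathOf N ω)) ∂P := by
  set θ : Ω → ℝ≥0 := fun ω => (min (τ ω) T).toNNReal with hθdef
  have hθ : ∀ ω, ((θ ω : ℝ≥0) : ℝ≥0∞) = min (τ ω) T := fun ω =>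
    ENNReal.coe_toNNReal (ne_top_of_le_ne_top (ENNReal.natCast_ne_top T) (min_le_right _ _))
  have hθm : Measurable θ := (hτ.measurable.min measurable_const).ennreal_toNNReal
  set s : ℕ → Ω → ℝ≥0 := fun l ω => grid (j + l) (upIndex (j + l) (T * 2 ^ (j + l)) (τ ω))
    with hsdef
  have hg : ∀ k, grid k (T * 2 ^ k) = T := fun k => by
    have := grid_mul_two_pow 0 k T
    rw [zero_add] at this
    rw [this]
    simp [grid, mesh]
  have hs1 : ∀ l ω, θ ω ≤ s l ω := fun l ω => by
    have := le_grid_upIndex (j + l) (T * 2 ^ (j + l)) (τ ω)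
    rw [hg] at this
    rw [← ENNReal.coe_le_coe, hθ]
    exact this
  have hs2' : ∀ l ω, s l ω ≤ θ ω + mesh (j + l) := fun l ω => by
    have := grid_upIndex_le (j + l) (T * 2 ^ (j + l)) (τ ω)
    rw [hg] at this
    rw [← ENNReal.coe_le_coe, ENNReal.coe_add, hθ]
    exact this
  have hs2 : ∀ l ω, s l ω ≤ θ ω + mesh l := fun l ω => (hs2' l ω).trans <| by
    refine add_le_add le_rfl ?_
    unfold mesh
    exact pow_le_pow_of_le_one (by norm_num) (by norm_num) (Nat.le_add_left _ _)
  have hsm : ∀ l, Measurable (s l) := fun l =>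
    (Measurable.of_discrete (f := grid (j + l))).comp
      ((measurable_upIndex _ (T * 2 ^ (j + l))).comp hτ.measurable)
  have hT : ∀ l ω, s l ω ≤ T + 1 := fun l ω => (hs2 l ω).trans <| by
    refine add_le_add ?_ (mesh_le_one l)
    rw [← ENNReal.coe_le_coe, hθ]
    exact min_le_right _ _
  have key : ∀ l, valueLim p P N φ ≤ ((∫⁻ ω, runCost p φ (pathOf N ω) (θ ω) ∂P) +
      (∫⁻ ω, rateBound p φ (T + 1) (pathOf N ω) ∂P) * mesh l) +
        ∫⁻ ω, disc p (s l ω) * diagStage p P N j (pos p φ (s l ω) (pathOf N ω)) ∂P := by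
    intro l
    -- The summand `T * 2 ^ (j + l)` covers the grid up to time `T`; the other one is what remains
    -- for the terminal stage.
    refine (valueLim_le_stage (j + l) (j * 2 ^ j * 2 ^ l + T * 2 ^ (j + l)) φ).trans ?_
    refine (stage_le_of_index hp hN φ (j + l) (T * 2 ^ (j + l)) (j * 2 ^ j * 2 ^ l)
      ((measurable_upIndex _ _).comp hτ.measurable) (hτ.obs_lt_upIndex _ _)
      fun ω => upIndex_le _ _ _).trans ?_
    rw [← lintegral_mul_const' _ _ ENNReal.coe_ne_top,
      ← lintegral_add_left (measurable_runCost hp hN φ hθm.coe_nnreal_ennreal),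
      ← lintegral_add_right]
    · refine lintegral_mono_ae ?_
      filter_upwards [hN.isStepPath] with ω hω
      refine add_le_add ?_ (mul_le_mul_right (stage_refine hp hN j l (j * 2 ^ j) _) _)
      have := runCost_le_add hω hp hφ (hs1 l ω) (hs2 l ω) (hT l ω)
      rwa [runCost_coe φ _ (s l ω)] at this
    · exact Measurable.mul (by have := hsm l; fun_prop)
        ((measurable_stage hp hN _ _).comp (measurable_pos_pathOf hp hN φ (hsm l)))
  have hlim1 : Tendsto (fun l => ((∫⁻ ω, runCost p φ (pathOf N ω) (θ ω) ∂P) +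
      (∫⁻ ω, rateBound p φ (T + 1) (pathOf N ω) ∂P) * mesh l)) atTop
      (𝓝 (∫⁻ ω, runCost p φ (pathOf N ω) (θ ω) ∂P)) := by
    have h := ENNReal.Tendsto.const_mul (a := ∫⁻ ω, rateBound p φ (T + 1) (pathOf N ω) ∂P)
      tendsto_mesh (Or.inr (lintegral_rateBound_ne_top hp hN φ _))
    rw [mul_zero] at h
    simpa using tendsto_const_nhds.add h
  have hlim2 : Tendsto (fun l => ∫⁻ ω, disc p (s l ω) *
      diagStage p P N j (pos p φ (s l ω) (pathOf N ω)) ∂P) atTop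
      (𝓝 (∫⁻ ω, disc p (θ ω) * diagStage p P N j (pos p φ (θ ω) (pathOf N ω)) ∂P)) := by
    refine tendsto_lintegral_of_dominated_convergence (fun _ => bound p) (fun l => ?_)
      (fun l => ?_) ?_ ?_
    · exact Measurable.mul (by have := hsm l; fun_prop)
        ((measurable_stage hp hN _ _).comp (measurable_pos_pathOf hp hN φ (hsm l)))
    · exact ae_of_all _ fun ω => (mul_le_of_le_one_left zero_le
        (disc_le_one hp (NNReal.coe_nonneg _))).trans (stage_le_bound _ _ _)
    · simp [bound_ne_top]
    · filter_upwards [hN.isStepPath] with ω hω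
      have hlim := tendsto_of_le_add_mesh (fun l => hs1 l ω) fun l => hs2 l ω
      refine tendsto_of_right (f := fun t : ℝ≥0 =>
        disc p t * diagStage p P N j (pos p φ t (pathOf N ω))) ?_
        (Eventually.of_forall fun l => hs1 l ω) hlim
      refine ENNReal.Tendsto.mul ?_ (Or.inr (stage_ne_top _ _ _)) ?_ (Or.inr (disc_ne_top _ _))
      · exact ((continuous_disc p).comp NNReal.continuous_coe).continuousWithinAt
      · exact (continuous_stage hp hN _ _).continuousAt.comp_continuousWithinAt
          (hω.continuousWithinAt_pos hp φ _)
  have hfin := ge_of_tendsto' (hlim1.add hlim2) key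
  simp only [← hθ, discE_coe]
  exact hfin

theorem valueLim_le_lintegral_min [IsProbabilityMeasure P] (hp : p.Valid)
    (hN : IsPoissonProcess N p.mu P) {φ : ℝ × ℝ} (hφ : φ ∈ quadrant) {τ : Ω → ℝ≥0∞}
    (hτ : IsObsTime N P τ) (T : ℕ) :
    valueLim p P N φ ≤ (∫⁻ ω, runCost p φ (pathOf N ω) (τ ω) ∂P) +
      ∫⁻ ω, discE p (min (τ ω) T) *
        valueLim p P N (pos p φ (min (τ ω) T).toNNReal (pathOf N ω)) ∂P := by
  have hm : Measurable fun ω => min (τ ω) (T : ℝ≥0∞) := hτ.measurable.min measurable_const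
  have hlim : Tendsto (fun j => ∫⁻ ω, discE p (min (τ ω) T) *
      diagStage p P N j (pos p φ (min (τ ω) T).toNNReal (pathOf N ω)) ∂P) atTop
      (𝓝 (∫⁻ ω, discE p (min (τ ω) T) *
        valueLim p P N (pos p φ (min (τ ω) T).toNNReal (pathOf N ω)) ∂P)) := by
    refine tendsto_lintegral_of_dominated_convergence (fun _ => bound p) (fun j => ?_)
      (fun j => ?_) ?_ ?_
    · exact ((measurable_discE p).comp hm).mul ((measurable_stage hp hN _ _).comp
        (measurable_pos_pathOf hp hN φ hm.ennreal_toNNReal))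
    · exact ae_of_all _ fun ω => (mul_le_of_le_one_left zero_le
        (discE_le_one hp _)).trans (stage_le_bound _ _ _)
    · simp [bound_ne_top]
    · refine ae_of_all _ fun ω => ENNReal.Tendsto.const_mul ?_
        (Or.inr ((discE_le_one hp _).trans_lt ENNReal.one_lt_top).ne)
      rw [← iInf_diagStage hp hN]
      exact tendsto_atTop_iInf fun i j hij => diagStage_antitone hp hN hij _
  refine (ge_of_tendsto' (tendsto_const_nhds.add hlim) fun j =>
    valueLim_le_stopCost_diag hp hN hφ hτ T j).trans
      (add_le_add (lintegral_mono fun ω => ?_) le_rfl)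
  exact runCost_mono φ _ (min_le_left _ _)

/-- The value function bounds the expected cost of every stopping time from below. -/
theorem valueLim_le_stopCost [IsProbabilityMeasure P] (hp : p.Valid)
    (hN : IsPoissonProcess N p.mu P) {φ : ℝ × ℝ} (hφ : φ ∈ quadrant) {τ : Ω → ℝ≥0∞}
    (hτ : IsObsTime N P τ) :
    valueLim p P N φ ≤ ∫⁻ ω, stopCost p (valueLim p P N) φ (pathOf N ω) (τ ω) ∂P := by
  unfold stopCost
  rw [lintegral_add_left (measurable_runCost hp hN φ hτ.measurable)]
  have hlim : Tendsto (fun T : ℕ => ∫⁻ ω, discE p (min (τ ω) T) *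
        valueLim p P N (pos p φ (min (τ ω) T).toNNReal (pathOf N ω)) ∂P) atTop
      (𝓝 (∫⁻ ω, discE p (τ ω) *
        valueLim p P N (pos p φ (τ ω).toNNReal (pathOf N ω)) ∂P)) := by
    refine tendsto_lintegral_of_dominated_convergence (fun _ => bound p) (fun T => ?_)
      (fun j => ?_) ?_ ?_
    · have hm : Measurable fun ω => min (τ ω) (T : ℝ≥0∞) := hτ.measurable.min measurable_const
      exact ((measurable_discE p).comp hm).mul ((measurable_valueLim hp hN).comp
        (measurable_pos_pathOf hp hN φ hm.ennreal_toNNReal))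
    · exact ae_of_all _ fun ω => (mul_le_of_le_one_left zero_le
        (discE_le_one hp _)).trans (valueLim_le_bound _)
    · simp [bound_ne_top]
    · refine ae_of_all _ fun ω => ?_
      -- On `τ = ∞` the terminal cost at the cap `T` is killed by the discount; otherwise the cap is
      -- eventually inactive.
      rcases eq_or_ne (τ ω) ⊤ with h | h
      · rw [h, discE_top, zero_mul]
        have h0 : Tendsto (fun T : ℕ => disc p T * bound p) atTop (𝓝 0) := by
          rw [← zero_mul (bound p)]
          exact ENNReal.Tendsto.mul_const ((tendsto_disc_atTop hp).comp
            tendsto_natCast_atTop_atTop) (Or.inr (bound_ne_top p))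
        refine tendsto_of_tendsto_of_tendsto_of_le_of_le tendsto_const_nhds h0
          (fun _ => zero_le) fun T => ?_
        dsimp only
        rw [min_eq_right le_top]
        refine mul_le_mul' (le_of_eq ?_) (valueLim_le_bound _)
        simp [discE]
      · obtain ⟨n, hn⟩ := ENNReal.exists_nat_gt h
        refine tendsto_const_nhds.congr' ?_
        filter_upwards [eventually_ge_atTop n] with T hT
        rw [min_eq_left (hn.le.trans (by exact_mod_cast hT))]
  exact ge_of_tendsto' (tendsto_const_nhds.add hlim) fun T =>
    valueLim_le_lintegral_min hp hN hφ hτ T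

end

/-! ### Attaining the lower bound -/

section

variable {Ω : Type*} [MeasurableSpace Ω] {P : Measure Ω} {N : ℝ≥0 → Ω → ℕ} {p : Params}

/-! ### Optimality of hitting times of the region where the value is almost maximal -/

theorem liminf_add_liminf_le (f g : ℕ → ℝ≥0∞) :
    liminf f atTop + liminf g atTop ≤ liminf (fun n => f n + g n) atTop := by
  rw [liminf_eq_iSup_iInf_of_nat, liminf_eq_iSup_iInf_of_nat, liminf_eq_iSup_iInf_of_nat,
    ENNReal.iSup_add_iSup_of_monotone]
  · exact iSup_mono fun n => le_iInf₂ fun i hi => add_le_add (iInf₂_le i hi) (iInf₂_le i hi)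
  · exact fun m n h => le_iInf₂ fun i hi => iInf₂_le i (h.trans hi)
  · exact fun m n h => le_iInf₂ fun i hi => iInf₂_le i (h.trans hi)

theorem discE_antitone (hp : p.Valid) : Antitone (discE p) := by
  intro s t hst
  rcases eq_or_ne t ⊤ with h | h
  · simp [h]
  · have hs : s ≠ ⊤ := ne_top_of_le_ne_top h hst
    rw [discE, discE, if_neg h, if_neg hs]
    exact disc_antitone hp (ENNReal.toReal_mono h hst)

/-- The time at which the `j`-th diagonal stage problem is stopped. -/
def diagTime (p : Params) (P : Measure Ω) (N : ℝ≥0 → Ω → ℕ) (φ : ℝ × ℝ) (j : ℕ) (ω : Ω) : ℝ≥0 :=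
  grid j (optIndex p P N φ j (j * 2 ^ j) ω)

theorem measurable_diagTime [SFinite P] (hp : p.Valid) (hN : IsPoissonProcess N p.mu P)
    (φ : ℝ × ℝ) (j : ℕ) : Measurable (diagTime p P N φ j) :=
  (Measurable.of_discrete (f := grid j)).comp (measurable_optIndex hp hN φ j (j * 2 ^ j))

theorem isObsTime_diagTime [SFinite P] (hp : p.Valid) (hN : IsPoissonProcess N p.mu P)
    (φ : ℝ × ℝ) (j : ℕ) : IsObsTime N P fun ω => (diagTime p P N φ j ω : ℝ≥0∞) where
  measurable := (measurable_diagTime hp hN φ j).coe_nnreal_ennreal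
  obs_lt t := by
    have heq : {ω | (diagTime p P N φ j ω : ℝ≥0∞) < t} = ⋃ i : {i : ℕ // grid j i < t},
        {ω | (i : ℕ) < optIndex p P N φ j (j * 2 ^ j) ω}ᶜ := by
      ext ω
      simp only [Set.mem_ofPred_eq, ENNReal.coe_lt_coe, Set.mem_iUnion, Set.mem_compl_iff, not_lt,
        Subtype.exists, exists_prop]
      exact ⟨fun h => ⟨_, h, le_rfl⟩, fun ⟨i, hi, hle⟩ => (grid_mono j hle).trans_lt hi⟩
    rw [heq]
    exact Obs.iUnion fun i => (obs_lt_optIndex hp hN φ j _ i).compl.mono i.2.le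

/-- The expected loss from stopping at `diagTime` instead of continuing optimally. -/
theorem diagTime_gap [IsProbabilityMeasure P] (hp : p.Valid) (hN : IsPoissonProcess N p.mu P)
    {φ : ℝ × ℝ} (hφ : φ ∈ quadrant) (j : ℕ) :
    valueLim p P N φ + ∫⁻ ω, disc p (diagTime p P N φ j ω) *
      (bound p - valueLim p P N (pos p φ (diagTime p P N φ j ω) (pathOf N ω))) ∂P ≤
      diagStage p P N j φ := by
  refine le_trans ?_ (optIndex_cost_le hp hN φ j (j * 2 ^ j))
  refine (add_le_add (valueLim_le_stopCost hp hN hφ (isObsTime_diagTime hp hN φ j))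
    le_rfl).trans ?_
  rw [← lintegral_add_left (measurable_stopCost hp hN φ (measurable_valueLim hp hN)
    (isObsTime_diagTime hp hN φ j).measurable)]
  refine lintegral_mono fun ω => ?_
  rw [stopCost, discE_coe, runCost_coe, ENNReal.toNNReal_coe, add_assoc, ← mul_add,
    add_tsub_cancel_of_le (valueLim_le_bound _)]
  exact le_rfl

theorem valueLim_ne_top (φ : ℝ × ℝ) : valueLim p P N φ ≠ ⊤ :=
  ((valueLim_le_bound φ).trans_lt (bound_ne_top p).lt_top).ne

theorem tendsto_diagStage [IsProbabilityMeasure P] (hp : p.Valid)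
    (hN : IsPoissonProcess N p.mu P) (φ : ℝ × ℝ) :
    Tendsto (fun j => diagStage p P N j φ) atTop (𝓝 (valueLim p P N φ)) := by
  rw [← iInf_diagStage hp hN]
  exact tendsto_atTop_iInf fun i j hij => diagStage_antitone hp hN hij _

/-- Along a subsequence the stopping loss of `diagTime` vanishes almost surely. -/
theorem exists_diagTime_gap_tendsto [IsProbabilityMeasure P] (hp : p.Valid)
    (hN : IsPoissonProcess N p.mu P) {φ : ℝ × ℝ} (hφ : φ ∈ quadrant) :
    ∃ ns : ℕ → ℕ, Tendsto ns atTop atTop ∧ ∀ᵐ ω ∂P, Tendsto (fun i =>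
      disc p (diagTime p P N φ (ns i) ω) * (bound p -
        valueLim p P N (pos p φ (diagTime p P N φ (ns i) ω) (pathOf N ω)))) atTop (𝓝 0) := by
  set F : ℕ → Ω → ℝ≥0∞ := fun j ω => disc p (diagTime p P N φ j ω) * (bound p -
        valueLim p P N (pos p φ (diagTime p P N φ j ω) (pathOf N ω))) with hF
  have hFm : ∀ j, Measurable (F j) := fun j => by
    have h1 := measurable_diagTime (P := P) hp hN φ j
    exact Measurable.mul (by fun_prop) (measurable_const.sub ((measurable_valueLim hp hN).comp
      (measurable_pos_pathOf hp hN φ h1)))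
  have hint : Tendsto (fun j => ∫⁻ ω, F j ω ∂P) atTop (𝓝 0) := by
    have h1 : Tendsto (fun j => diagStage p P N j φ - valueLim p P N φ) atTop (𝓝 0) := by
      have := ENNReal.Tendsto.sub (tendsto_diagStage (P := P) hp hN φ)
        (tendsto_const_nhds (x := valueLim p P N φ)) (Or.inl (valueLim_ne_top φ))
      rwa [tsub_self] at this
    refine tendsto_of_tendsto_of_tendsto_of_le_of_le tendsto_const_nhds h1 (fun _ => zero_le)
      fun j => ?_
    exact ENNReal.le_sub_of_add_le_left (valueLim_ne_top φ) (diagTime_gap hp hN hφ j)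
  -- Summable mean losses along the subsequence make the losses themselves almost surely summable.
  have hex : ∀ i : ℕ, ∃ j ≥ i, ∫⁻ ω, F j ω ∂P ≤ (1 / 2 : ℝ≥0∞) ^ i := fun i => by
    have hpos : (0 : ℝ≥0∞) < (1 / 2) ^ i := by
      exact ENNReal.pow_pos (by norm_num) i
    obtain ⟨j, h1, h2⟩ := ((hint.eventually_lt_const hpos).and (eventually_ge_atTop i)).exists
    exact ⟨j, h2, h1.le⟩
  choose ns hns1 hns2 using hex
  refine ⟨ns, tendsto_atTop_mono hns1 tendsto_id, ?_⟩
  have hsum : ∫⁻ ω, ∑' i, F (ns i) ω ∂P ≠ ⊤ := by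
    rw [lintegral_tsum fun i => (hFm _).aemeasurable]
    refine ne_top_of_le_ne_top ?_ (ENNReal.tsum_le_tsum hns2)
    rw [ENNReal.tsum_geometric]
    simp
  filter_upwards [ae_lt_top (Measurable.tsum fun i => hFm _) hsum] with ω hω
  exact ENNReal.tendsto_atTop_zero_of_tsum_ne_top hω.ne

/-- As long as the value stays `ε` below its maximum, continuing is optimal. -/
theorem stopCost_le_valueLim [IsProbabilityMeasure P] (hp : p.Valid)
    (hN : IsPoissonProcess N p.mu P) {φ : ℝ × ℝ} (hφ : φ ∈ quadrant) {U : Ω → ℝ≥0∞}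
    (hU : IsObsTime N P U) {ε : ℝ≥0∞} (hε : ε ≠ 0)
    (hlt : ∀ᵐ ω ∂P, ∀ t : ℝ≥0, (t : ℝ≥0∞) < U ω →
      valueLim p P N (pos p φ t (pathOf N ω)) + ε ≤ bound p) :
    ∫⁻ ω, stopCost p (valueLim p P N) φ (pathOf N ω) (U ω) ∂P ≤ valueLim p P N φ := by
  obtain ⟨ns, hns, hgap⟩ := exists_diagTime_gap_tendsto (P := P) hp hN hφ
  -- The optimal grid rule is cut off at `U` rounded up to the grid; before its optimal index the
  -- grid problem loses nothing.
  set σ : ℕ → Ω → ℕ := fun j ω => min (upIndex j (j * 2 ^ j) (U ω))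
    (optIndex p P N φ j (j * 2 ^ j) ω) with hσ
  have hσm : ∀ j, Measurable (σ j) := fun j =>
    ((measurable_upIndex _ _).comp hU.measurable).min (measurable_optIndex hp hN φ _ _)
  set s : ℕ → Ω → ℝ≥0 := fun j ω => grid j (σ j ω) with hs
  have hsm : ∀ j, Measurable (s j) := fun j =>
    (Measurable.of_discrete (f := grid j)).comp (hσm j)
  have hsmin : ∀ j ω, s j ω = min (grid j (upIndex j (j * 2 ^ j) (U ω))) (diagTime p P N φ j ω) :=
    fun j ω => (grid_mono j).map_min
  have hcost : ∀ j, ∫⁻ ω, runCost p φ (pathOf N ω) (s j ω) + disc p (s j ω) *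
      valueLim p P N (pos p φ (s j ω) (pathOf N ω)) ∂P ≤ diagStage p P N j φ := fun j => by
    refine le_trans (lintegral_mono fun ω => ?_) (stopped_le_stage hp hN φ j (j * 2 ^ j)
      (hσm j) (fun i => ?_) fun ω => min_le_right _ _)
    · rw [runCost_coe]
      exact add_le_add le_rfl (mul_le_mul_right (valueLim_le_stage _ _ _) _)
    · have : {ω | i < σ j ω} = {ω | i < upIndex j (j * 2 ^ j) (U ω)} ∩
          {ω | i < optIndex p P N φ j (j * 2 ^ j) ω} := by
        ext ω
        simp only [hσ, Set.mem_ofPred_eq, lt_min_iff, Set.mem_inter_iff]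
      rw [this]
      exact (hU.obs_lt_upIndex _ _ _).inter (obs_lt_optIndex hp hN φ _ _ _)
  have hgrid : ∀ j, grid j (j * 2 ^ j) = j := fun j => by
    have := grid_mul_two_pow 0 j j
    rw [zero_add] at this
    rw [this]
    simp [grid, mesh]
  have hpt : ∀ᵐ ω ∂P, stopCost p (valueLim p P N) φ (pathOf N ω) (U ω) ≤
      liminf (fun i => runCost p φ (pathOf N ω) (s (ns i) ω) + disc p (s (ns i) ω) *
        valueLim p P N (pos p φ (s (ns i) ω) (pathOf N ω))) atTop := by
    filter_upwards [hlt, hgap, hN.isStepPath] with ω h1 h2 hω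
    -- Stopping before `U` and by time `t` would leave a loss of at least `disc p t * ε`, which is
    -- incompatible with losses tending to zero.
    have hτ : ∀ t : ℝ≥0, ∀ᶠ i in atTop, (diagTime p P N φ (ns i) ω : ℝ≥0∞) < U ω →
        t < diagTime p P N φ (ns i) ω := by
      intro t
      have hpos : 0 < disc p t * ε :=
        pos_iff_ne_zero.2 (mul_ne_zero (disc_ne_zero p t) hε)
      filter_upwards [h2.eventually_lt_const hpos] with i hi hlti
      by_contra hcon
      refine absurd hi (not_lt.2 ?_)
      refine mul_le_mul' (disc_antitone hp (NNReal.coe_le_coe.2 (not_lt.1 hcon))) ?_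
      exact ENNReal.le_sub_of_add_le_left (valueLim_ne_top _) (h1 _ hlti)
    have hs1 : ∀ t < U ω, ∀ᶠ i in atTop, t < (s (ns i) ω : ℝ≥0∞) := by
      intro t ht
      lift t to ℝ≥0 using ht.ne_top
      have hcap : ∀ᶠ i in atTop, t < (ns i : ℝ≥0) := by
        obtain ⟨n, hn⟩ := exists_nat_gt t
        filter_upwards [hns.eventually_ge_atTop n] with i hi
        exact hn.trans_le (by exact_mod_cast hi)
      filter_upwards [hτ t, hcap] with i hi hcap
      rw [hsmin, ENNReal.coe_lt_coe, lt_min_iff]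
      constructor
      · rw [← ENNReal.coe_lt_coe]
        refine lt_of_lt_of_le ?_ (le_grid_upIndex _ _ _)
        rw [hgrid, lt_min_iff]
        exact ⟨ht, ENNReal.coe_lt_coe.2 hcap⟩
      · by_contra hcon
        have h3 : (diagTime p P N φ (ns i) ω : ℝ≥0∞) < U ω :=
          (ENNReal.coe_le_coe.2 (not_lt.1 hcon)).trans_lt ht
        exact hcon (hi h3)
    refine le_trans (add_le_add (runCost_le_liminf hp φ _ hs1) ?_) (liminf_add_liminf_le _ _)
    rcases eq_or_ne (U ω) ⊤ with hUt | hUt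
    · simp [hUt]
    · have hu : ((U ω).toNNReal : ℝ≥0∞) = U ω := ENNReal.coe_toNNReal hUt
      generalize (U ω).toNNReal = u at hu
      rw [← hu, discE_coe]
      refine le_of_eq (Tendsto.liminf_eq ?_).symm
      -- Taking `t = u` in `hτ`, a grid optimum before `U = u` would have to lie after `u`; so
      -- eventually it lies at or after `u`, and the cut-off times approach `u` from the right.
      have hge : ∀ᶠ i in atTop, u ≤ s (ns i) ω := by
        have hcap : ∀ᶠ i in atTop, u ≤ (ns i : ℝ≥0) := by
          obtain ⟨n, hn⟩ := exists_nat_gt u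
          filter_upwards [hns.eventually_ge_atTop n] with i hi
          exact hn.le.trans (by exact_mod_cast hi)
        filter_upwards [hτ u, hcap] with i hi hcap
        rw [hsmin, le_min_iff]
        constructor
        · rw [← ENNReal.coe_le_coe]
          refine le_trans ?_ (le_grid_upIndex _ _ _)
          rw [hgrid, ← hu, le_min_iff]
          exact ⟨le_rfl, ENNReal.coe_le_coe.2 hcap⟩
        · by_contra hcon
          have h3 := hi (by rw [← hu]; exact ENNReal.coe_lt_coe.2 (not_le.1 hcon))
          exact hcon h3.le
      have hle : ∀ i, s (ns i) ω ≤ u + mesh (ns i) := fun i => by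
        rw [hsmin]
        refine (min_le_left _ _).trans ?_
        rw [← ENNReal.coe_le_coe, ENNReal.coe_add]
        refine (grid_upIndex_le _ _ _).trans (add_le_add ((min_le_left _ _).trans hu.ge) le_rfl)
      have hlim : Tendsto (fun i => s (ns i) ω) atTop (𝓝 u) := by
        have hm : Tendsto (fun i => u + mesh (ns i)) atTop (𝓝 u) := by
          have := tendsto_mesh
          rw [← ENNReal.coe_zero, ENNReal.tendsto_coe] at this
          simpa using tendsto_const_nhds.add (this.comp hns)
        exact tendsto_of_tendsto_of_tendsto_of_le_of_le' tendsto_const_nhds hm hge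
          (Eventually.of_forall hle)
      refine tendsto_of_right (f := fun t : ℝ≥0 =>
        disc p t * valueLim p P N (pos p φ t (pathOf N ω))) ?_ hge hlim
      refine ENNReal.Tendsto.mul ?_ (Or.inr (valueLim_ne_top _)) ?_ (Or.inr (disc_ne_top _ _))
      · exact ((continuous_disc p).comp NNReal.continuous_coe).continuousWithinAt
      · exact ContinuousWithinAt.comp (f := fun t => pos p φ t (pathOf N ω))
          (continuousOn_valueLim hp hN _ (hω.pos_mem_quadrant hp hφ u))
          (hω.continuousWithinAt_pos hp φ u) fun t _ => hω.pos_mem_quadrant hp hφ t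
  refine (lintegral_mono_ae hpt).trans ((lintegral_liminf_le fun i => ?_).trans ?_)
  · exact (measurable_runCost hp hN φ (hsm _).coe_nnreal_ennreal).add (Measurable.mul
      (by have := hsm (ns i); fun_prop) ((measurable_valueLim hp hN).comp
        (measurable_pos_pathOf hp hN φ (hsm _))))
  · refine (liminf_le_liminf (Eventually.of_forall fun i => hcost (ns i))).trans (le_of_eq ?_)
    exact ((tendsto_diagStage hp hN φ).comp hns).liminf_eq

/-- Stopping when the value is within `ε` of its maximum costs at most `ε`. -/
theorem stopCost_bound_le_add [IsProbabilityMeasure P] (hp : p.Valid)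
    (hN : IsPoissonProcess N p.mu P) {φ : ℝ × ℝ} (hφ : φ ∈ quadrant) {U : Ω → ℝ≥0∞}
    (hU : IsObsTime N P U) {ε : ℝ≥0∞} (hε : ε ≠ 0)
    (hlt : ∀ᵐ ω ∂P, ∀ t : ℝ≥0, (t : ℝ≥0∞) < U ω →
      valueLim p P N (pos p φ t (pathOf N ω)) + ε ≤ bound p)
    (hge : ∀ᵐ ω ∂P, U ω ≠ ⊤ →
      bound p ≤ valueLim p P N (pos p φ (U ω).toNNReal (pathOf N ω)) + ε) :
    ∫⁻ ω, stopCost p (fun _ => bound p) φ (pathOf N ω) (U ω) ∂P ≤ valueLim p P N φ + ε := by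
  have h : ∫⁻ ω, stopCost p (fun _ => bound p) φ (pathOf N ω) (U ω) ∂P ≤
      ∫⁻ ω, stopCost p (valueLim p P N) φ (pathOf N ω) (U ω) + ε ∂P := by
    refine lintegral_mono_ae ?_
    filter_upwards [hge] with ω hω
    rw [stopCost, stopCost, add_assoc]
    refine add_le_add le_rfl ?_
    rcases eq_or_ne (U ω) ⊤ with h | h
    · simp [h]
    · refine (mul_le_mul_right (hω h) _).trans ?_
      rw [mul_add]
      exact add_le_add le_rfl (mul_le_of_le_one_left zero_le (discE_le_one hp _))
  refine h.trans ?_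
  rw [lintegral_add_right _ measurable_const, lintegral_const, measure_univ, mul_one]
  exact add_le_add (stopCost_le_valueLim hp hN hφ hU hε hlt) le_rfl

/-- The limit of almost optimal times is optimal. -/
theorem stopCost_iSup_le [IsProbabilityMeasure P] (hp : p.Valid)
    (hN : IsPoissonProcess N p.mu P) {φ : ℝ × ℝ} {U : ℕ → Ω → ℝ≥0∞}
    (hU : ∀ m, Measurable (U m)) (hmono : ∀ᵐ ω ∂P, Monotone fun m => U m ω)
    {ε : ℕ → ℝ≥0∞} (hε : Tendsto ε atTop (𝓝 0))
    (hcost : ∀ m, ∫⁻ ω, stopCost p (fun _ => bound p) φ (pathOf N ω) (U m ω) ∂P ≤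
      valueLim p P N φ + ε m) :
    ∫⁻ ω, stopCost p (fun _ => bound p) φ (pathOf N ω) (⨆ m, U m ω) ∂P ≤ valueLim p P N φ := by
  have hpt : ∀ᵐ ω ∂P, stopCost p (fun _ => bound p) φ (pathOf N ω) (⨆ m, U m ω) ≤
      liminf (fun m => stopCost p (fun _ => bound p) φ (pathOf N ω) (U m ω)) atTop := by
    filter_upwards [hmono] with ω hω
    refine le_trans (add_le_add (runCost_le_liminf hp φ _ (s := fun m => U m ω)
      fun t ht => ?_) ?_) (liminf_add_liminf_le _ _)
    · obtain ⟨m, hm⟩ := lt_iSup_iff.1 ht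
      filter_upwards [eventually_ge_atTop m] with n hn
      exact hm.trans_le (hω hn)
    -- No limit is needed for the terminal term: the discount at the supremum is below the discount
    -- at every earlier time.
    · refine le_liminf_of_le (by isBoundedDefault) (Eventually.of_forall fun m => ?_)
      exact mul_le_mul_left (discE_antitone hp (le_iSup (fun m => U m ω) m)) _
  refine (lintegral_mono_ae hpt).trans ((lintegral_liminf_le fun m =>
    measurable_stopCost hp hN φ measurable_const (hU m)).trans ?_)
  refine (liminf_le_liminf (Eventually.of_forall hcost)).trans (le_of_eq ?_)
  have := (tendsto_const_nhds (x := valueLim p P N φ)).add hε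
  rw [add_zero] at this
  exact this.liminf_eq

/-- At an optimal time the value is maximal. -/
theorem bound_le_valueLim_of_optimal [IsProbabilityMeasure P] (hp : p.Valid)
    (hN : IsPoissonProcess N p.mu P) {φ : ℝ × ℝ} (hφ : φ ∈ quadrant) {U : Ω → ℝ≥0∞}
    (hU : IsObsTime N P U)
    (hcost : ∫⁻ ω, stopCost p (fun _ => bound p) φ (pathOf N ω) (U ω) ∂P ≤ valueLim p P N φ) :
    ∀ᵐ ω ∂P, U ω ≠ ⊤ → bound p ≤ valueLim p P N (pos p φ (U ω).toNNReal (pathOf N ω)) := by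
  have h1 := hcost.trans (valueLim_le_stopCost hp hN hφ hU)
  have hm := measurable_stopCost hp hN φ (measurable_valueLim (P := P) hp hN) hU.measurable
  have hm2 := measurable_stopCost hp hN φ (measurable_const (a := bound p)) hU.measurable
  have hle : ∀ ω, stopCost p (valueLim p P N) φ (pathOf N ω) (U ω) ≤
      stopCost p (fun _ => bound p) φ (pathOf N ω) (U ω) := fun ω =>
    add_le_add le_rfl (mul_le_mul_right (valueLim_le_bound _) _)
  have hfin2 : ∫⁻ ω, stopCost p (fun _ => bound p) φ (pathOf N ω) (U ω) ∂P ≠ ⊤ :=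
    ne_top_of_le_ne_top (valueLim_ne_top φ) hcost
  have hfin : ∫⁻ ω, stopCost p (valueLim p P N) φ (pathOf N ω) (U ω) ∂P ≠ ⊤ :=
    ne_top_of_le_ne_top hfin2 (lintegral_mono hle)
  -- The two costs are ordered pointwise and have finite integrals in the opposite order, hence
  -- agree almost surely; running cost and discount factor can then be cancelled.
  have hae := ae_eq_of_ae_le_of_lintegral_le (ae_of_all _ hle) hfin hm2.aemeasurable h1
  filter_upwards [hae, ae_lt_top hm hfin] with ω h2 h3 h4
  rw [stopCost] at h2 h3
  rw [stopCost] at h2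
  have h5 := (ENNReal.add_right_inj (ne_top_of_le_ne_top h3.ne le_self_add)).1 h2
  rw [discE, if_neg h4] at h5
  exact ((ENNReal.mul_right_inj (disc_ne_zero _ _) (disc_ne_top _ _)).1 h5).ge

end

/-! ### Hitting times of closed sets and of the near-maximal region -/

section

variable {Ω : Type*} [MeasurableSpace Ω] {P : Measure Ω} {N : ℝ≥0 → Ω → ℕ} {p : Params}

/-! ### Hitting times of closed sets -/

/-- The first time at which the position is in `A`. -/
def hit (p : Params) (φ : ℝ × ℝ) (A : Set (ℝ × ℝ)) (w : ℝ≥0 → ℕ) : ℝ≥0∞ :=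
  ⨅ (t : ℝ≥0) (_ : pos p φ t w ∈ A), (t : ℝ≥0∞)

theorem hit_lt_iff {φ : ℝ × ℝ} {A : Set (ℝ × ℝ)} {w : ℝ≥0 → ℕ} {x : ℝ≥0∞} :
    hit p φ A w < x ↔ ∃ s : ℝ≥0, pos p φ s w ∈ A ∧ (s : ℝ≥0∞) < x := by
  simp only [hit, iInf_lt_iff, exists_prop]

theorem notMem_of_lt_hit {φ : ℝ × ℝ} {A : Set (ℝ × ℝ)} {w : ℝ≥0 → ℕ} {t : ℝ≥0}
    (h : (t : ℝ≥0∞) < hit p φ A w) : pos p φ t w ∉ A :=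
  fun hA => absurd (iInf₂_le (f := fun (t : ℝ≥0) (_ : pos p φ t w ∈ A) => (t : ℝ≥0∞)) t hA)
    (not_le.2 h)

theorem hit_le {φ : ℝ × ℝ} {A : Set (ℝ × ℝ)} {w : ℝ≥0 → ℕ} {t : ℝ≥0}
    (h : pos p φ t w ∈ A) : hit p φ A w ≤ t :=
  not_lt.1 fun hlt => notMem_of_lt_hit hlt h

theorem hit_anti {φ : ℝ × ℝ} {A B : Set (ℝ × ℝ)} {w : ℝ≥0 → ℕ} (h : A ⊆ B) :
    hit p φ B w ≤ hit p φ A w :=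
  le_iInf₂ fun _ ht => hit_le (h ht)

/-- Right-continuity keeps the path outside a closed set for a while whenever it is outside, so the
infimum is attained. -/
theorem IsStepPath.pos_hit_mem {w : ℝ≥0 → ℕ} (hw : IsStepPath w) (hp : p.Valid) (φ : ℝ × ℝ)
    {A : Set (ℝ × ℝ)} (hA : IsClosed A) (h : hit p φ A w ≠ ⊤) :
    pos p φ (hit p φ A w).toNNReal w ∈ A := by
  have hu : ((hit p φ A w).toNNReal : ℝ≥0∞) = hit p φ A w := ENNReal.coe_toNNReal h
  set t := (hit p φ A w).toNNReal with ht
  by_contra hcon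
  have hev : ∀ᶠ s in 𝓝[≥] t, pos p φ s w ∈ Aᶜ :=
    (hw.continuousWithinAt_pos hp φ t).eventually (hA.isOpen_compl.mem_nhds hcon)
  obtain ⟨u, hu1, hus⟩ := mem_nhdsGE_iff_exists_Ico_subset.1 hev
  have h1 : hit p φ A w < u := by rw [← hu]; exact ENNReal.coe_lt_coe.2 hu1
  obtain ⟨s, hs, hsu⟩ := hit_lt_iff.1 h1
  have h2 : t ≤ s := by
    rw [← ENNReal.coe_le_coe, hu]
    exact hit_le hs
  exact hus ⟨h2, ENNReal.coe_lt_coe.1 hsu⟩ hs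

/-- The points from which the flow meets `A` by time `q`. -/
def flowReach (p : Params) (A : Set (ℝ × ℝ)) (q : ℝ) : Set (ℝ × ℝ) :=
  {ψ | ∃ r ∈ Set.Icc 0 q, flow p r ψ ∈ A}

/-- The set is the projection of a closed set along the compact interval `[0, q]`. -/
theorem isClosed_flowReach (hp : p.Valid) {A : Set (ℝ × ℝ)} (hA : IsClosed A) (q : ℝ) :
    IsClosed (flowReach p A q) := by
  have hcl : IsClosed {z : Set.Icc 0 q × (ℝ × ℝ) | flow p z.1 z.2 ∈ A} :=
    hA.preimage ((continuous_flow hp).comp (by fun_prop :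
      Continuous fun z : Set.Icc 0 q × (ℝ × ℝ) => ((z.1 : ℝ), z.2)))
  have := isClosedMap_snd_of_compactSpace _ hcl
  convert this using 1
  ext ψ
  constructor
  · rintro ⟨r, hr, h⟩
    exact ⟨(⟨r, hr⟩, ψ), h, rfl⟩
  · rintro ⟨⟨r, ψ'⟩, h, rfl⟩
    exact ⟨r, r.2, h⟩

/-- The paths for which the position meets `A` before time `t`. -/
def hitBefore (p : Params) (φ : ℝ × ℝ) (A : Set (ℝ × ℝ)) (t : ℝ≥0) : Set (ℝ≥0 → ℕ) :=
  ⋃ (n : ℕ) (q : ℚ≥0), {v | jumpAt n v + ((q : ℝ≥0) : ℝ≥0∞) < min (jumpAt (n + 1) v) t ∧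
    postAt p φ v n ∈ flowReach p A (q : ℝ≥0)}

theorem measurableSet_hitBefore (hp : p.Valid) (φ : ℝ × ℝ) {A : Set (ℝ × ℝ)} (hA : IsClosed A)
    (t : ℝ≥0) : MeasurableSet (hitBefore p φ A t) := by
  refine MeasurableSet.iUnion fun n => MeasurableSet.iUnion fun q => MeasurableSet.inter ?_ ?_
  · have h1 := measurable_jumpAt n
    have h2 := measurable_jumpAt (n + 1)
    exact measurableSet_lt (h1.add_const _) (h2.min measurable_const)
  · exact ((measurable_postAt hp n).comp (measurable_const.prodMk measurable_id))
      (isClosed_flowReach hp hA _).measurableSet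

/-- The uncountable search for a hitting time becomes a countable union over the jump number and a
rational duration within that flow segment. This avoids any appeal to a debut theorem. -/
theorem IsStepPath.mem_hitBefore_iff {w : ℝ≥0 → ℕ} (hw : IsStepPath w) (φ : ℝ × ℝ)
    {A : Set (ℝ × ℝ)} {t : ℝ≥0} :
    w ∈ hitBefore p φ A t ↔ ∃ s < t, pos p φ s w ∈ A := by
  simp only [hitBefore, Set.mem_iUnion, Set.mem_ofPred_eq]
  constructor
  · rintro ⟨n, q, hq, r, hr, hA⟩
    rw [lt_min_iff] at hq
    have hne : jumpAt n w ≠ ⊤ := (le_self_add.trans_lt hq.2).ne_top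
    obtain ⟨a, ha⟩ : ∃ a : ℝ≥0, jumpAt n w = a := ⟨_, (ENNReal.coe_toNNReal hne).symm⟩
    set r' : ℝ≥0 := ⟨r, hr.1⟩ with hr'
    have hrq : r' ≤ q := NNReal.coe_le_coe.1 hr.2
    have hle : ((a + r' : ℝ≥0) : ℝ≥0∞) ≤ jumpAt n w + ((q : ℝ≥0) : ℝ≥0∞) := by
      rw [ha, ENNReal.coe_add]
      exact add_le_add le_rfl (ENNReal.coe_le_coe.2 hrq)
    have hws : w (a + r') = n := by
      refine le_antisymm ?_ (hw.jumpAt_le_iff.1 ?_)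
      · refine Nat.lt_succ_iff.1 (not_le.1 fun h => ?_)
        exact absurd (hw.jumpAt_le_iff.2 h) (not_le.2 (hle.trans_lt hq.1))
      · rw [ha, ENNReal.coe_add]
        exact le_self_add
    refine ⟨a + r', ENNReal.coe_lt_coe.1 (hle.trans_lt hq.2), ?_⟩
    rw [hw.pos_eq, hws, ha, ENNReal.coe_toReal, NNReal.coe_add, add_sub_cancel_left]
    exact hA
  · rintro ⟨s, hst, hA⟩
    have h1 : jumpAt (w s) w ≤ s := hw.jumpAt_le_iff.2 le_rfl
    have h2 : (s : ℝ≥0∞) < jumpAt (w s + 1) w := by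
      rw [← not_le, hw.jumpAt_le_iff]
      omega
    obtain ⟨a, ha⟩ : ∃ a : ℝ≥0, jumpAt (w s) w = a :=
      ⟨_, (ENNReal.coe_toNNReal (h1.trans_lt ENNReal.coe_lt_top).ne).symm⟩
    rw [ha, ENNReal.coe_le_coe] at h1
    obtain ⟨x, hx1, hx2⟩ := ENNReal.lt_iff_exists_nnreal_btwn.1
      (lt_min h2 (ENNReal.coe_lt_coe.2 hst))
    have hx3 : s - a < x - a := by
      rw [ENNReal.coe_lt_coe] at hx1
      exact tsub_lt_tsub_right_of_le h1 hx1
    obtain ⟨q, hq1, hq2⟩ : ∃ q : ℚ≥0, s - a < (q : ℝ≥0) ∧ (q : ℝ≥0) < x - a := by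
      obtain ⟨q, hq1, hq2⟩ := exists_rat_btwn (NNReal.coe_lt_coe.2 hx3)
      have hq0 : 0 ≤ q := by
        have : (0 : ℝ) ≤ q := (NNReal.coe_nonneg _).trans hq1.le
        exact_mod_cast this
      set u : ℚ≥0 := ⟨q, hq0⟩
      have hc : ((u : ℝ≥0) : ℝ) = q := rfl
      exact ⟨u, NNReal.coe_lt_coe.1 (hc ▸ hq1), NNReal.coe_lt_coe.1 (hc ▸ hq2)⟩
    refine ⟨w s, q, ?_, s - a, ⟨sub_nonneg.2 (NNReal.coe_le_coe.2 h1), ?_⟩, ?_⟩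
    · rw [ha]
      refine lt_of_le_of_lt ?_ hx2
      rw [← ENNReal.coe_add, ENNReal.coe_le_coe]
      calc a + q ≤ a + (x - a) := by gcongr
        _ = x := add_tsub_cancel_of_le (h1.trans (ENNReal.coe_le_coe.1 hx1.le))
    · rw [← NNReal.coe_sub h1]
      exact NNReal.coe_le_coe.2 hq1.le
    · rw [hw.pos_eq, ha] at hA
      simpa using hA

theorem obs_hit_lt (hp : p.Valid) (hN : IsPoissonProcess N p.mu P) (φ : ℝ × ℝ)
    {A : Set (ℝ × ℝ)} (hA : IsClosed A) (t : ℝ≥0) :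
    Obs N P t {ω | hit p φ A (pathOf N ω) < t} := by
  refine obs_of_stepPath hN (measurableSet_hitBefore hp φ hA t) fun ω hω => ?_
  rw [(hω.stopPath t).mem_hitBefore_iff, Set.mem_ofPred_eq, hit_lt_iff]
  refine exists_congr fun s => ?_
  rw [ENNReal.coe_lt_coe, and_comm]
  refine and_congr_right fun hs => ?_
  rw [hω.pos_stopPath p φ hs.le]

/-- Null sets belong to the filtration, so a genuinely measurable modification remains observable.
-/
theorem exists_isObsTime {hm : ∀ t, Measurable (N t)} {τ : Ω → ℝ≥0∞}
    (h : ∀ t : ℝ≥0, Obs N P t {ω | τ ω < t}) : ∃ τ', IsObsTime N P τ' ∧ τ =ᵐ[P] τ' := by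
  have hae := (isStop_of_obs_lt (hm := hm) h).aemeasurable
  refine ⟨hae.mk τ, ⟨hae.measurable_mk, fun t => (h t).congr ?_⟩, hae.ae_eq_mk⟩
  filter_upwards [hae.ae_eq_mk] with ω hω
  refine propext ?_
  change hae.mk τ ω < t ↔ τ ω < t
  rw [hω]

theorem hitTime_process_ae (hp : p.Valid) (hN : IsPoissonProcess N p.mu P) {φ : ℝ × ℝ}
    (hφ : φ ∈ quadrant) {A B : Set (ℝ × ℝ)} (hAB : ∀ ψ ∈ quadrant, ψ ∈ A ↔ ψ ∈ B) :
    hitTime (process p N φ) A =ᵐ[P] fun ω => hit p φ B (pathOf N ω) := by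
  filter_upwards [hN.isStepPath] with ω hω
  unfold hitTime hit
  refine iInf_congr fun t => ?_
  have h1 : process p N φ t ω = pos p φ t (pathOf N ω) := IsStepPath.process_eq hω p φ t
  rw [h1]
  exact iInf_congr_Prop (hAB _ (hω.pos_mem_quadrant hp hφ t)) fun _ => rfl

/-! ### The region where the value is almost maximal -/

/-- The region where the value is within `ε` of its maximum. -/
def nearStop (p : Params) (P : Measure Ω) (N : ℝ≥0 → Ω → ℕ) (ε : ℝ≥0∞) : Set (ℝ × ℝ) :=
  {ψ | ψ ∈ quadrant ∧ bound p ≤ valueLim p P N ψ + ε}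

theorem isClosed_quadrant : IsClosed quadrant :=
  (isClosed_le continuous_const continuous_fst).inter
    (isClosed_le continuous_const continuous_snd)

theorem isClosed_nearStop [IsProbabilityMeasure P] (hp : p.Valid)
    (hN : IsPoissonProcess N p.mu P) (ε : ℝ≥0∞) : IsClosed (nearStop p P N ε) := by
  have h : ContinuousOn (fun ψ => valueLim p P N ψ + ε) quadrant :=
    (continuousOn_valueLim hp hN).add continuousOn_const
  exact h.preimage_isClosed_of_isClosed isClosed_quadrant isClosed_Ici

theorem nearStop_mono : Monotone (nearStop p P N) :=
  fun _ _ h _ hψ => ⟨hψ.1, hψ.2.trans (add_le_add le_rfl h)⟩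

theorem stopCost_congr_ae {u : ℝ × ℝ → ℝ≥0∞} {φ : ℝ × ℝ} {U V : Ω → ℝ≥0∞} (h : U =ᵐ[P] V) :
    ∫⁻ ω, stopCost p u φ (pathOf N ω) (U ω) ∂P = ∫⁻ ω, stopCost p u φ (pathOf N ω) (V ω) ∂P := by
  refine lintegral_congr_ae ?_
  filter_upwards [h] with ω hω
  rw [hω]

theorem stopCost_hit_le_of_ne_zero [IsProbabilityMeasure P] (hp : p.Valid)
    (hN : IsPoissonProcess N p.mu P) {φ : ℝ × ℝ} (hφ : φ ∈ quadrant) {ε : ℝ≥0∞} (hε : ε ≠ 0) :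
    ∫⁻ ω, stopCost p (fun _ => bound p) φ (pathOf N ω)
      (hit p φ (nearStop p P N ε) (pathOf N ω)) ∂P ≤ valueLim p P N φ + ε := by
  have hcl := isClosed_nearStop (P := P) hp hN ε
  obtain ⟨U, hU, hae⟩ := exists_isObsTime (hm := hN.measurable) (obs_hit_lt hp hN φ hcl)
  rw [stopCost_congr_ae hae]
  refine stopCost_bound_le_add hp hN hφ hU hε ?_ ?_
  · filter_upwards [hae, hN.isStepPath] with ω h1 hω t ht
    rw [← h1] at ht
    have := notMem_of_lt_hit ht
    exact (not_le.1 fun hle => this ⟨hω.pos_mem_quadrant hp hφ t, hle⟩).le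
  · filter_upwards [hae, hN.isStepPath] with ω h1 hω ht
    rw [← h1] at ht ⊢
    exact (hω.pos_hit_mem hp φ hcl ht).2

/-- For `ε = 0` the argument behind `stopCost_le_valueLim` breaks down, as the gap has no positive
lower bound. Instead the supremum of the times for `ε = 1/(m+1)` is shown optimal, and optimality
forces the value to be maximal there. -/
theorem stopCost_hit_zero_le [IsProbabilityMeasure P] (hp : p.Valid)
    (hN : IsPoissonProcess N p.mu P) {φ : ℝ × ℝ} (hφ : φ ∈ quadrant) :
    ∫⁻ ω, stopCost p (fun _ => bound p) φ (pathOf N ω)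
      (hit p φ (nearStop p P N 0) (pathOf N ω)) ∂P ≤ valueLim p P N φ := by
  set ε : ℕ → ℝ≥0∞ := fun m => ((m + 1 : ℕ) : ℝ≥0∞)⁻¹ with hεdef
  have hε0 : ∀ m, ε m ≠ 0 := fun m => ENNReal.inv_ne_zero.2 (ENNReal.natCast_ne_top _)
  have hεanti : Antitone ε := fun m n h => ENNReal.inv_le_inv.2 (by exact_mod_cast (by omega))
  have hεlim : Tendsto ε atTop (𝓝 0) :=
    (tendsto_add_atTop_iff_nat (f := fun n : ℕ => ((n : ℕ) : ℝ≥0∞)⁻¹) 1).2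
      ENNReal.tendsto_inv_nat_nhds_zero
  set W : ℕ → Ω → ℝ≥0∞ := fun m ω => hit p φ (nearStop p P N (ε m)) (pathOf N ω) with hW
  have hex : ∀ m, ∃ U, IsObsTime N P U ∧ W m =ᵐ[P] U := fun m =>
    exists_isObsTime (hm := hN.measurable)
      (obs_hit_lt hp hN φ (isClosed_nearStop (P := P) hp hN (ε m)))
  choose U hU hWU using hex
  have hall := ae_all_iff.2 hWU
  have hcost : ∫⁻ ω, stopCost p (fun _ => bound p) φ (pathOf N ω) (⨆ m, U m ω) ∂P ≤
      valueLim p P N φ := by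
    refine stopCost_iSup_le hp hN (fun m => (hU m).measurable) ?_ hεlim fun m => ?_
    · filter_upwards [hall] with ω h m n hmn
      dsimp only
      rw [← h, ← h]
      exact hit_anti (nearStop_mono (hεanti hmn))
    · rw [← stopCost_congr_ae (hWU m)]
      exact stopCost_hit_le_of_ne_zero hp hN hφ (hε0 m)
  have hsup : IsObsTime N P fun ω => ⨆ m, U m ω := by
    refine ⟨Measurable.iSup fun m => (hU m).measurable, fun t => ?_⟩
    have hst : IsStop (obsFiltration N P hN.measurable) fun ω => ⨆ m, U m ω := fun i => by
      have heq : {ω | (⨆ m, U m ω) ≤ (i : ℝ≥0∞)} = ⋂ m, {ω | U m ω ≤ (i : ℝ≥0∞)} := by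
        ext ω
        simp
      change MeasurableSet[obsFiltration N P hN.measurable i] {ω | (⨆ m, U m ω) ≤ (i : ℝ≥0∞)}
      rw [heq]
      exact @MeasurableSet.iInter Ω ℕ (obsFiltration N P hN.measurable i) _ _ fun m =>
        isStop_of_obs_lt (hm := hN.measurable) (hU m).obs_lt i
    exact hst.obs_lt t
  have hbound := bound_le_valueLim_of_optimal hp hN hφ hsup hcost
  rw [stopCost_congr_ae (V := fun ω => ⨆ m, U m ω)]
  · exact hcost
  -- The supremum is a time spent in the stopping set, so it is no earlier than the hitting time; it
  -- is no later because each approximating set is larger.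
  · filter_upwards [hall, hbound, hN.isStepPath] with ω h1 h2 hω
    refine le_antisymm ?_ (iSup_le fun m => ?_)
    · rcases eq_or_ne (⨆ m, U m ω) ⊤ with h | h
      · rw [h]
        exact le_top
      · rw [← ENNReal.coe_toNNReal h]
        refine hit_le ⟨hω.pos_mem_quadrant hp hφ _, ?_⟩
        rw [add_zero]
        exact h2 h
    · rw [← h1 m]
      exact hit_anti (nearStop_mono zero_le)

end

/-! ### Return to the signed problem -/

section

variable {Ω : Type*} [MeasurableSpace Ω] {P : Measure Ω} {N : ℝ≥0 → Ω → ℕ} {p : Params}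

/-! ### The value function -/

/-- Only the subtracted terms need be finite; `x` and `c` may be infinite, as costs can be. -/
theorem coe_sub_coe_eq {x y c d : ℝ≥0∞} (h : x + d = y + c) (hy : y ≠ ⊤) (hd : d ≠ ⊤) :
    (x : EReal) - y = c - d := by
  lift y to ℝ≥0 using hy
  lift d to ℝ≥0 using hd
  cases c with
  | top =>
    have hx : x = ⊤ := by simpa using h
    subst hx
    simp
  | coe c =>
    have hx : x ≠ ⊤ := fun hx => by
      subst hx
      simp at h
      exact absurd h.symm (ENNReal.add_ne_top.2 ⟨ENNReal.coe_ne_top, ENNReal.coe_ne_top⟩)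
    lift x to ℝ≥0 using hx
    have h1 : x + d = y + c := by exact_mod_cast h
    have h2 : (x : ℝ) + d = y + c := by exact_mod_cast h1
    have h3 : (x : ℝ) - y = c - d := by linarith
    have hval : ∀ a b : ℝ≥0, ((a : ℝ≥0∞) : EReal) - ((b : ℝ≥0∞) : EReal) =
        (((a : ℝ) - b : ℝ) : EReal) := fun _ _ => rfl
    rw [hval, hval, h3]

/-- Truncated differences satisfy `(C - b) + b = max C b = (b - C) + C`, so linearity survives even
if `C` has infinite integral. -/
theorem eIntegral_eq_sub {α : Type*} [MeasurableSpace α] {ν : Measure α} {f : α → EReal}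
    {C b : α → ℝ≥0∞} (hC : AEMeasurable C ν) (hb : AEMeasurable b ν) (hfin : ∫⁻ a, b a ∂ν ≠ ⊤)
    (hf : ∀ᵐ a ∂ν, f a = (C a : EReal) - b a) :
    eIntegral ν f = ((∫⁻ a, C a ∂ν : ℝ≥0∞) : EReal) - ((∫⁻ a, b a ∂ν : ℝ≥0∞) : EReal) := by
  have hbt := ae_lt_top' hb hfin
  have h1 : ∫⁻ a, (f a).toENNReal ∂ν = ∫⁻ a, C a - b a ∂ν := by
    refine lintegral_congr_ae ?_
    filter_upwards [hf] with a ha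
    rw [ha, EReal.toENNReal_sub (EReal.coe_ennreal_nonneg _), EReal.toENNReal_coe,
      EReal.toENNReal_coe]
  have h2 : ∫⁻ a, (-f a).toENNReal ∂ν = ∫⁻ a, b a - C a ∂ν := by
    refine lintegral_congr_ae ?_
    filter_upwards [hf, hbt] with a ha hba
    rw [ha, EReal.neg_sub (Or.inl (by simp)) (Or.inr (by simpa using hba.ne)), add_comm,
      ← sub_eq_add_neg, EReal.toENNReal_sub (EReal.coe_ennreal_nonneg _), EReal.toENNReal_coe,
      EReal.toENNReal_coe]
  rw [eIntegral, h1, h2]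
  refine coe_sub_coe_eq ?_ (ne_top_of_le_ne_top hfin (lintegral_mono fun a => tsub_le_self)) hfin
  rw [← lintegral_add_right' _ hb, ← lintegral_add_right' _ hC]
  refine lintegral_congr fun a => ?_
  rw [tsub_add_eq_max, tsub_add_eq_max, max_comm]

theorem exponentialPDF_eq_indicator (r : ℝ) : exponentialPDF r =
    (Set.Ici 0).indicator fun t => ENNReal.ofReal (r * Real.exp (-(r * t))) := by
  ext t
  rw [exponentialPDF_eq]
  by_cases h : 0 ≤ t
  · rw [Set.indicator_of_mem (Set.mem_Ici.2 h), if_pos h]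
  · rw [Set.indicator_of_notMem (by simpa using h), if_neg h, ENNReal.ofReal_zero]

theorem lintegral_Ico_exp {r : ℝ} (hr : 0 < r) (t : ℝ≥0) :
    (∫⁻ s in Set.Ico 0 (t : ℝ), ENNReal.ofReal (r * Real.exp (-(r * s)))) +
      ENNReal.ofReal (Real.exp (-(r * t))) = 1 := by
  have h := lintegral_exponentialPDF_eq_antiDeriv hr t
  rw [exponentialPDF_eq_indicator, setLIntegral_indicator measurableSet_Ici, Set.Ici_inter_Iic,
    if_pos t.coe_nonneg, ← setLIntegral_congr Ico_ae_eq_Icc] at h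
  rw [h, ← ENNReal.ofReal_add _ (Real.exp_pos _).le]
  · simp
  · rw [sub_nonneg, Real.exp_le_one_iff, neg_nonpos]
    positivity

/-- Here `λ ∫_0^τ e^{-λt} dt + e^{-λτ} = 1`, the exponential law, is scaled by `√2/c`; it justifies
the shift of the cost by `bound p`. -/
theorem lintegral_before_exp (hp : p.Valid) (τ : ℝ≥0∞) :
    (∫⁻ t in {t : ℝ | 0 ≤ t ∧ ENNReal.ofReal t < τ},
      ENNReal.ofReal (Real.exp (-p.lam * t) * (p.lam / p.c * √2))) + discE p τ * bound p =
        bound p := by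
  have hl := hp.lam_pos
  have hc := hp.c_pos
  have hrate : ∀ t : ℝ, ENNReal.ofReal (Real.exp (-p.lam * t) * (p.lam / p.c * √2)) =
      bound p * ENNReal.ofReal (p.lam * Real.exp (-(p.lam * t))) := fun t => by
    rw [bound, ← ENNReal.ofReal_mul (by positivity)]
    congr 1
    rw [neg_mul]
    ring
  have hone : (∫⁻ t in {t : ℝ | 0 ≤ t ∧ ENNReal.ofReal t < τ},
      ENNReal.ofReal (p.lam * Real.exp (-(p.lam * t)))) + discE p τ = 1 := by
    cases τ with
    | top =>
      have hset : {t : ℝ | 0 ≤ t ∧ ENNReal.ofReal t < ⊤} = Set.Ici 0 := by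
        ext t
        simp
      rw [hset, discE_top, add_zero, ← lintegral_indicator measurableSet_Ici,
        ← exponentialPDF_eq_indicator]
      exact lintegral_exponentialPDF_eq_one hl
    | coe t =>
      rw [before_coe, discE_coe, disc, neg_mul]
      exact lintegral_Ico_exp hl t
  simp only [hrate]
  rw [lintegral_const_mul' _ _ (bound_ne_top p), mul_comm (discE p τ), ← mul_add, hone, mul_one]

theorem IsStepPath.eIntegral_runningCost {Ω : Type*} {N : ℝ≥0 → Ω → ℕ} {ω : Ω}
    (hω : IsStepPath (pathOf N ω)) (hp : p.Valid)
    {φ : ℝ × ℝ} (hφ : φ ∈ quadrant) (τ : ℝ≥0∞) :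
    eIntegral (volume.restrict {t : ℝ | 0 ≤ t ∧ ENNReal.ofReal t < τ}) (fun t =>
      ((Real.exp (-p.lam * t) * runningCost p (process p N φ t.toNNReal ω) : ℝ) : EReal)) =
      (stopCost p (fun _ => bound p) φ (pathOf N ω) τ : EReal) - (bound p : EReal) := by
  have hb := lintegral_before_exp hp τ
  have hfin : (∫⁻ t in {t : ℝ | 0 ≤ t ∧ ENNReal.ofReal t < τ},
      ENNReal.ofReal (Real.exp (-p.lam * t) * (p.lam / p.c * √2))) ≠ ⊤ :=
    ne_top_of_le_ne_top (bound_ne_top p) (le_self_add.trans hb.le)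
  rw [eIntegral_eq_sub (C := runRate p φ (pathOf N ω)) (b := fun t =>
    ENNReal.ofReal (Real.exp (-p.lam * t) * (p.lam / p.c * √2)))
    (measurable_runRate_path hp φ _).aemeasurable (by fun_prop) hfin]
  · refine coe_sub_coe_eq ?_ hfin (bound_ne_top p)
    rw [stopCost, add_comm (runCost _ _ _ _), ← add_assoc, hb, add_comm]
    rfl
  · refine (ae_restrict_iff' (measurableSet_before τ)).2 (ae_of_all _ fun t ht => ?_)
    have h1 : process p N φ t.toNNReal ω = pos p φ t.toNNReal (pathOf N ω) :=
      IsStepPath.process_eq hω p φ _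
    have h2 := hω.pos_mem_quadrant hp hφ t.toNNReal
    have hl := hp.lam_pos
    have hc := hp.c_pos
    rw [h1, runRate, disc, size, ← ENNReal.ofReal_mul (Real.exp_pos _).le,
      EReal.coe_ennreal_ofReal, EReal.coe_ennreal_ofReal, max_eq_left, max_eq_left,
      ← EReal.coe_sub, ← mul_sub]
    · rfl
    · positivity
    · exact mul_nonneg (Real.exp_pos _).le (add_nonneg h2.1 h2.2)

/-- The expected cost in terms of the shifted nonnegative cost. -/
theorem expectedCost_eq [IsProbabilityMeasure P] (hp : p.Valid) (hN : IsPoissonProcess N p.mu P)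
    {φ : ℝ × ℝ} (hφ : φ ∈ quadrant) {τ : Ω → ℝ≥0∞} (hτ : AEMeasurable τ P) :
    expectedCost p P N φ τ =
      ((∫⁻ ω, stopCost p (fun _ => bound p) φ (pathOf N ω) (τ ω) ∂P : ℝ≥0∞) : EReal) -
        (bound p : EReal) := by
  have hm : AEMeasurable (fun ω => stopCost p (fun _ => bound p) φ (pathOf N ω) (τ ω)) P := by
    refine ⟨_, measurable_stopCost hp hN φ (measurable_const (a := bound p)) hτ.measurable_mk, ?_⟩
    filter_upwards [hτ.ae_eq_mk] with ω hω
    rw [← hω]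
  rw [expectedCost, eIntegral_eq_sub hm (b := fun _ => bound p) aemeasurable_const]
  · simp
  · simp [bound_ne_top]
  · filter_upwards [hN.isStepPath] with ω hω
    exact hω.eIntegral_runningCost hp hφ (τ ω)

theorem coe_sub_bound_le {a b : ℝ≥0∞} (h : a ≤ b) :
    (a : EReal) - (bound p : EReal) ≤ (b : EReal) - (bound p : EReal) :=
  EReal.sub_le_sub (EReal.coe_ennreal_le_coe_ennreal_iff.2 h) le_rfl

theorem valueLim_le_stopCost_bound [IsProbabilityMeasure P] (hp : p.Valid)
    (hN : IsPoissonProcess N p.mu P) {φ : ℝ × ℝ} (hφ : φ ∈ quadrant) {τ : Ω → ℝ≥0∞}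
    (hτ : IsStop (obsFiltration N P hN.measurable) τ) :
    valueLim p P N φ ≤ ∫⁻ ω, stopCost p (fun _ => bound p) φ (pathOf N ω) (τ ω) ∂P := by
  obtain ⟨τ', hτ', hae⟩ := exists_isObsTime (hm := hN.measurable) hτ.obs_lt
  rw [stopCost_congr_ae hae]
  refine (valueLim_le_stopCost hp hN hφ hτ').trans (lintegral_mono fun ω => ?_)
  exact add_le_add le_rfl (mul_le_mul_right (valueLim_le_bound _) _)

theorem isStop_hit [IsProbabilityMeasure P] (hp : p.Valid) (hN : IsPoissonProcess N p.mu P)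
    (φ : ℝ × ℝ) {A : Set (ℝ × ℝ)} (hA : IsClosed A) :
    IsStop (obsFiltration N P hN.measurable) fun ω => hit p φ A (pathOf N ω) :=
  isStop_of_obs_lt (obs_hit_lt hp hN φ hA)

/-- The entrance time into the maximal set attains `valueLim`, and no stopping time goes below it.
-/
theorem value_eq [IsProbabilityMeasure P] (hp : p.Valid) (hN : IsPoissonProcess N p.mu P)
    {φ : ℝ × ℝ} (hφ : φ ∈ quadrant) :
    value p P N hN.measurable φ = (valueLim p P N φ : EReal) - (bound p : EReal) := by
  refine le_antisymm ?_ (le_iInf₂ fun τ hτ => ?_)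
  · have hst := isStop_hit hp hN φ (isClosed_nearStop (P := P) hp hN 0)
    refine (iInf₂_le _ hst).trans ?_
    rw [expectedCost_eq hp hN hφ hst.aemeasurable]
    exact coe_sub_bound_le (stopCost_hit_zero_le hp hN hφ)
  · rw [expectedCost_eq hp hN hφ hτ.aemeasurable]
    exact coe_sub_bound_le (valueLim_le_stopCost_bound hp hN hφ hτ)

theorem neg_le_coe_sub_bound_iff {ε : ℝ} (hε : 0 ≤ ε) {a : ℝ≥0∞} :
    ((-ε : ℝ) : EReal) ≤ (a : EReal) - (bound p : EReal) ↔
      bound p ≤ a + ENNReal.ofReal ε := by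
  lift ε to ℝ≥0 using hε
  rw [ENNReal.ofReal_coe_nnreal]
  cases a with
  | top => simp [bound]
  | coe a =>
    have hB := bound_ne_top p
    lift bound p to ℝ≥0 using hB with B
    have h1 : ((a : ℝ≥0∞) : EReal) - ((B : ℝ≥0∞) : EReal) = (((a : ℝ) - B : ℝ) : EReal) := rfl
    rw [h1, EReal.coe_le_coe_iff]
    norm_cast
    rw [← NNReal.coe_le_coe, NNReal.coe_add]
    constructor <;> intro h <;> linarith

theorem coe_le_value_iff [IsProbabilityMeasure P] (hp : p.Valid)
    (hN : IsPoissonProcess N p.mu P) {ε : ℝ} (hε : 0 ≤ ε) {φ : ℝ × ℝ} (hφ : φ ∈ quadrant) :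
    ((-ε : ℝ) : EReal) ≤ value p P N hN.measurable φ ↔
      φ ∈ nearStop p P N (ENNReal.ofReal ε) := by
  rw [value_eq hp hN hφ, neg_le_coe_sub_bound_iff hε]
  exact ⟨fun h => ⟨hφ, h⟩, fun h => h.2⟩

theorem hitU_ae [IsProbabilityMeasure P] (hp : p.Valid) (hN : IsPoissonProcess N p.mu P)
    {ε : ℝ} (hε : 0 ≤ ε) {φ : ℝ × ℝ} (hφ : φ ∈ quadrant) :
    hitU p P N hN.measurable ε φ =ᵐ[P]
      fun ω => hit p φ (nearStop p P N (ENNReal.ofReal ε)) (pathOf N ω) :=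
  hitTime_process_ae hp hN hφ fun _ hψ => coe_le_value_iff hp hN hε hψ

/-- Needed because the hitting times of `process` and of `pos` agree only on step paths. -/
theorem isStop_congr {hm : ∀ t, Measurable (N t)} {τ τ' : Ω → ℝ≥0∞} (h : τ =ᵐ[P] τ')
    (hτ : IsStop (obsFiltration N P hm) τ') : IsStop (obsFiltration N P hm) τ := by
  refine isStop_of_obs_lt fun t => (hτ.obs_lt t).congr ?_
  filter_upwards [h] with ω hω
  refine propext ?_
  change τ ω < t ↔ τ' ω < t
  rw [hω]

theorem isStop_hitU [IsProbabilityMeasure P] (hp : p.Valid) (hN : IsPoissonProcess N p.mu P)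
    {ε : ℝ} (hε : 0 ≤ ε) {φ : ℝ × ℝ} (hφ : φ ∈ quadrant) :
    IsStop (obsFiltration N P hN.measurable) (hitU p P N hN.measurable ε φ) :=
  isStop_congr (hitU_ae hp hN hε hφ) (isStop_hit hp hN φ (isClosed_nearStop hp hN _))

theorem expectedCost_hitU_le [IsProbabilityMeasure P] (hp : p.Valid)
    (hN : IsPoissonProcess N p.mu P) {ε : ℝ} (hε : 0 ≤ ε) {φ : ℝ × ℝ} (hφ : φ ∈ quadrant) :
    expectedCost p P N φ (hitU p P N hN.measurable ε φ) ≤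
      value p P N hN.measurable φ + (ε : EReal) := by
  rw [expectedCost_eq hp hN hφ (isStop_hitU hp hN hε hφ).aemeasurable, value_eq hp hN hφ,
    stopCost_congr_ae (hitU_ae hp hN hε hφ)]
  have h : ∫⁻ ω, stopCost p (fun _ => bound p) φ (pathOf N ω)
      (hit p φ (nearStop p P N (ENNReal.ofReal ε)) (pathOf N ω)) ∂P ≤
      valueLim p P N φ + ENNReal.ofReal ε := by
    rcases hε.eq_or_lt with h | h
    · subst h
      rw [ENNReal.ofReal_zero, add_zero]
      exact stopCost_hit_zero_le hp hN hφ
    · exact stopCost_hit_le_of_ne_zero hp hN hφ (ENNReal.ofReal_pos.2 h).ne'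
  refine (coe_sub_bound_le h).trans (le_of_eq ?_)
  rw [EReal.coe_ennreal_add, EReal.coe_ennreal_ofReal, max_eq_left hε, sub_eq_add_neg,
    sub_eq_add_neg, add_right_comm]

theorem expectedCost_hitU_zero [IsProbabilityMeasure P] (hp : p.Valid)
    (hN : IsPoissonProcess N p.mu P) {φ : ℝ × ℝ} (hφ : φ ∈ quadrant) :
    expectedCost p P N φ (hitU p P N hN.measurable 0 φ) = value p P N hN.measurable φ := by
  refine le_antisymm ?_ (iInf₂_le _ (isStop_hitU hp hN le_rfl hφ))
  simpa using expectedCost_hitU_le hp hN le_rfl hφ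

theorem hitU_zero_ae_hitTime_stopRegion [IsProbabilityMeasure P] (hp : p.Valid)
    (hN : IsPoissonProcess N p.mu P) {φ : ℝ × ℝ} (hφ : φ ∈ quadrant) :
    hitU p P N hN.measurable 0 φ =ᵐ[P]
      hitTime (process p N φ) (stopRegion p P N hN.measurable) := by
  refine (hitU_ae hp hN le_rfl hφ).trans (hitTime_process_ae hp hN hφ fun ψ hψ => ?_).symm
  rw [← coe_le_value_iff hp hN le_rfl hψ]
  have hle : value p P N hN.measurable ψ ≤ 0 := by
    rw [value_eq hp hN hψ]
    refine (coe_sub_bound_le (valueLim_le_bound ψ)).trans ?_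
    exact EReal.sub_self_le_zero
  rw [neg_zero, EReal.coe_zero]
  exact ⟨fun h => h.2.ge, fun h => ⟨hψ, le_antisymm hle h⟩⟩

end

/-! ### The triangle and integrability of its exit time -/

section

variable {Ω : Type*} [MeasurableSpace Ω] {P : Measure Ω} {N : ℝ≥0 → Ω → ℕ} {p : Params}

/-! ### The triangle contains the continuation region -/

/-- The points from which the flow never goes below the line `x + y = K`. -/
def aboveLevel (p : Params) : Set (ℝ × ℝ) :=
  {φ | ∀ t : ℝ, 0 ≤ t → level p ≤ (flow p t φ).1 + (flow p t φ).2}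

theorem flow_mem_aboveLevel (hp : p.Valid) {φ : ℝ × ℝ} (h : φ ∈ aboveLevel p) {s : ℝ}
    (hs : 0 ≤ s) : flow p s φ ∈ aboveLevel p := fun t ht => by
  rw [← flow_add hp]
  exact h _ (add_nonneg hs ht)

/-- A jointly measurable version of the process. -/
theorem IsPoissonProcess.exists_measurable_version [IsProbabilityMeasure P]
    (hN : IsPoissonProcess N p.mu P) (hmu : 0 ≤ p.mu) : ∃ J : ℝ≥0 → Ω → ℕ,
      Measurable (Function.uncurry J) ∧ (∀ᵐ ω ∂P, ∀ t, J t ω = pathOf N ω t) ∧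
      ∀ t : ℝ≥0, P {ω | J t ω = 0} = ENNReal.ofReal (Real.exp (-(p.mu * t))) := by
  have hJ : ∀ᵐ ω ∂P, ∀ t, jumpCount t (pathOf N ω) = pathOf N ω t := by
    filter_upwards [hN.isStepPath] with ω hω t using hω.jumpCount_eq t
  refine ⟨fun t ω => jumpCount t (pathOf N ω), ?_, hJ, fun t => ?_⟩
  · exact measurable_jumpCount.comp (measurable_fst.prodMk
      (hN.measurable_pathOf.comp measurable_snd))
  have hlaw := hN.law 0 t zero_le
  have h1 : P ((fun ω => N t ω - N 0 ω) ⁻¹' {0}) =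
      poissonMeasure (p.mu.toNNReal * (t - 0)) {0} := by
    rw [← hlaw.map_eq, Measure.map_apply_of_aemeasurable hlaw.aemeasurable
      (measurableSet_singleton _)]
  rw [poissonMeasure_singleton] at h1
  have h2 : P {ω | jumpCount t (pathOf N ω) = 0} = P ((fun ω => N t ω - N 0 ω) ⁻¹' {0}) := by
    refine measure_congr ?_
    filter_upwards [hN.isStepPath, hJ] with ω hω hJω
    have h0 : N 0 ω = 0 := hω.zero
    refine propext ?_
    change jumpCount t (pathOf N ω) = 0 ↔ N t ω - N 0 ω = 0
    rw [h0, Nat.sub_zero, hJω]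
    rfl
  rw [h2, h1]
  simp [Real.coe_toNNReal _ hmu]

theorem level_eq (p : Params) : level p = (p.lam + p.mu) * (√2 / p.c) := by
  unfold level
  ring

/-- Above the level, continuing without jumps already costs as much as stopping. -/
theorem bound_le_stepOp [IsProbabilityMeasure P] (hp : p.Valid) (hN : IsPoissonProcess N p.mu P)
    {u : ℝ × ℝ → ℝ≥0∞} (h : ℝ≥0) (hu : ∀ ψ ∈ aboveLevel p, bound p ≤ u ψ)
    {φ : ℝ × ℝ} (hφ : φ ∈ aboveLevel p) : bound p ≤ stepOp p P N h u φ := by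
  have hl := hp.lam_pos
  have hc := hp.c_pos
  have hmu : 0 < p.mu := by linarith [hp.one_lt_mu]
  obtain ⟨J, hJm, hJN, hJ0⟩ := hN.exists_measurable_version hmu.le
  -- Only the cost before the first jump is retained; the jointly measurable version `J` allows
  -- Tonelli.
  set Z : Ω → ℝ → ℝ≥0∞ := fun ω t => {z : Ω × ℝ | J z.2.toNNReal z.1 = 0}.indicator
    (fun z => disc p z.2 * ENNReal.ofReal (level p)) (ω, t) with hZ
  have hNm : Measurable fun z : Ω × ℝ => J z.2.toNNReal z.1 :=
    hJm.comp (measurable_snd.real_toNNReal.prodMk measurable_fst)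
  have hjm : ∀ t, MeasurableSet {ω | J t ω = 0} := fun t =>
    hJm.of_uncurry_left (measurableSet_singleton 0)
  have hset : MeasurableSet {z : Ω × ℝ | J z.2.toNNReal z.1 = 0} :=
    hNm (measurableSet_singleton 0)
  have hZm : Measurable (Function.uncurry Z) :=
    Measurable.indicator (by fun_prop) hset
  have hZint : ∀ t : ℝ, 0 ≤ t → ∫⁻ ω, Z ω t ∂P =
      bound p * ENNReal.ofReal ((p.lam + p.mu) * Real.exp (-((p.lam + p.mu) * t))) := by
    intro t ht
    have h1 : ∀ ω, Z ω t = {ω | J t.toNNReal ω = 0}.indicator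
        (fun _ => disc p t * ENNReal.ofReal (level p)) ω := fun ω => rfl
    simp only [h1]
    rw [lintegral_indicator (hjm _), setLIntegral_const,
      hJ0, level_eq, disc, bound, ← ENNReal.ofReal_mul (Real.exp_pos _).le,
      ← ENNReal.ofReal_mul (by positivity), ← ENNReal.ofReal_mul (by positivity),
      Real.coe_toNNReal _ ht]
    congr 1
    rw [show -((p.lam + p.mu) * t) = -p.lam * t + -(p.mu * t) by ring, Real.exp_add]
    ring
  have hterm : ∫⁻ ω, {ω | J h ω = 0}.indicator (fun _ => disc p h * bound p) ω ∂P =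
      bound p * ENNReal.ofReal (Real.exp (-((p.lam + p.mu) * h))) := by
    rw [lintegral_indicator (hjm _), setLIntegral_const,
      hJ0, disc, bound, ← ENNReal.ofReal_mul (Real.exp_pos _).le,
      ← ENNReal.ofReal_mul (by positivity), ← ENNReal.ofReal_mul (by positivity)]
    congr 1
    rw [show -((p.lam + p.mu) * h) = -p.lam * h + -(p.mu * h) by ring, Real.exp_add]
    ring
  have hrun : ∫⁻ ω, (∫⁻ t in Set.Ico 0 (h : ℝ), Z ω t) ∂P = bound p *
      ∫⁻ t in Set.Ico 0 (h : ℝ),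
        ENNReal.ofReal ((p.lam + p.mu) * Real.exp (-((p.lam + p.mu) * t))) := by
    rw [lintegral_lintegral_swap hZm.aemeasurable, ← lintegral_const_mul' _ _ (bound_ne_top p)]
    exact setLIntegral_congr_fun measurableSet_Ico fun t ht => hZint t ht.1
  -- Since `level p = (λ + μ) * (√2 / c)`, the retained running and terminal costs are the two
  -- pieces of an exponential law of rate `λ + μ`, scaled by `bound p`.
  calc bound p = bound p * ((∫⁻ t in Set.Ico 0 (h : ℝ),
        ENNReal.ofReal ((p.lam + p.mu) * Real.exp (-((p.lam + p.mu) * t)))) +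
        ENNReal.ofReal (Real.exp (-((p.lam + p.mu) * h)))) := by
        rw [lintegral_Ico_exp (by positivity), mul_one]
    _ = ∫⁻ ω, (∫⁻ t in Set.Ico 0 (h : ℝ), Z ω t) +
        {ω | J h ω = 0}.indicator (fun _ => disc p h * bound p) ω ∂P := by
        rw [mul_add, ← hterm, ← hrun, lintegral_add_right]
        exact measurable_const.indicator (hjm _)
    _ ≤ stepOp p P N h u φ := by
        unfold stepOp stepCost
        refine lintegral_mono_ae ?_
        filter_upwards [hN.isStepPath, hJN] with ω hω hJω
        refine add_le_add (setLIntegral_mono' measurableSet_Ico fun t ht => ?_) ?_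
        · refine Set.indicator_apply_le' (fun h0 => ?_) fun _ => zero_le
          have h1 : pathOf N ω t.toNNReal = 0 := (hJω _).symm.trans h0
          rw [runRate, hω.pos_of_eq_zero φ h1, Real.coe_toNNReal _ ht.1]
          exact mul_le_mul_right (ENNReal.ofReal_le_ofReal (hφ t ht.1)) _
        · refine Set.indicator_apply_le' (fun h0 => ?_) fun _ => zero_le
          rw [hω.pos_of_eq_zero φ ((hJω _).symm.trans h0)]
          exact mul_le_mul_right (hu _ (flow_mem_aboveLevel hp hφ h.coe_nonneg)) _

theorem bound_le_valueLim [IsProbabilityMeasure P] (hp : p.Valid)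
    (hN : IsPoissonProcess N p.mu P) {φ : ℝ × ℝ} (hφ : φ ∈ aboveLevel p) :
    bound p ≤ valueLim p P N φ := by
  refine le_iInf₂ fun k n => ?_
  induction n generalizing φ with
  | zero => exact le_rfl
  | succ n ih => exact le_min le_rfl (bound_le_stepOp hp hN _ (fun ψ hψ => ih hψ) hφ)

theorem mul_expInt (γ t : ℝ) : γ * expInt γ t = Real.exp (γ * t) - 1 := by
  unfold expInt
  split_ifs with h
  · simp [h]
  · field_simp

theorem expInt_neg (γ t : ℝ) : expInt γ (-t) = -expInt (-γ) t := by
  unfold expInt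
  by_cases h : γ = 0
  · simp [h]
  · rw [if_neg h, if_neg (neg_ne_zero.2 h), mul_neg, neg_mul, div_neg, neg_neg]

/-- Negative times are included because the extremal curve is later followed backwards from its
contact point. -/
theorem expInt_le_expInt {γ γ' : ℝ} (h : γ ≤ γ') (t : ℝ) : expInt γ t ≤ expInt γ' t := by
  rcases le_total 0 t with ht | ht
  · exact expInt_mono_left h ht
  · have h1 := expInt_neg γ (-t)
    have h2 := expInt_neg γ' (-t)
    have h3 := expInt_mono_left (neg_le_neg h) (neg_nonneg.2 ht)
    rw [neg_neg] at h1 h2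
    rw [h1, h2]
    exact neg_le_neg h3

theorem flow_sum_eq (hp : p.Valid) (t : ℝ) (φ : ℝ × ℝ) :
    (flow p t φ).1 + (flow p t φ).2 = φ.1 + φ.2 +
      expInt (p.lam + 1) t * (p.driftX + (p.lam + 1) * φ.1) +
      expInt (p.lam - 1) t * (p.driftY + (p.lam - 1) * φ.2) := by
  have h1 := mul_expInt (p.lam + 1) t
  have h2 := mul_expInt (p.lam - 1) t
  simp only [flow, flowX_eq hp, flowY_eq p]
  linear_combination -φ.1 * h1 - φ.2 * h2

theorem driftX_add_driftY (p : Params) : p.driftX + p.driftY = p.lam * √2 := by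
  unfold Params.driftX Params.driftY
  have h : √2 * √2 = 2 := Real.mul_self_sqrt (by norm_num)
  have h0 : √2 ≠ 0 := by positivity
  field_simp
  linear_combination (-p.lam) * h

theorem level_pos (hp : p.Valid) : 0 < level p := by
  have := hp.lam_pos
  have := hp.c_pos
  have : 0 < p.mu := by linarith [hp.one_lt_mu]
  unfold level
  positivity

/-- From `(0, K)` the increment of `x + y` is at least `expInt (λ - 1) t` times its initial slope
`λ√2 + (λ - 1)K`, which the hypothesis makes nonnegative. -/
theorem mem_aboveLevel_of_level (hp : p.Valid)
    (h : 1 ≤ p.lam ∨ (p.lam + p.mu) / p.c ≤ p.lam / (1 - p.lam)) :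
    (0, level p) ∈ aboveLevel p := by
  intro t ht
  have hK := level_pos hp
  have hX := hp.driftX_pos
  have hl := hp.lam_pos
  have hcoef : 0 ≤ p.lam * √2 + (p.lam - 1) * level p := by
    rcases le_or_gt 1 p.lam with h1 | h1
    · have := mul_nonneg (sub_nonneg.2 h1) hK.le
      positivity
    · have h2 := h.resolve_left (not_le.2 h1)
      rw [le_div_iff₀ (by linarith)] at h2
      unfold level
      nlinarith [Real.sqrt_nonneg 2]
  rw [flow_sum_eq hp]
  have h1 : expInt (p.lam - 1) t ≤ expInt (p.lam + 1) t := expInt_le_expInt (by linarith) t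
  have h2 := expInt_nonneg (p.lam - 1) ht
  have h3 := driftX_add_driftY p
  have h4 := mul_le_mul_of_nonneg_right h1 hX.le
  have h5 := mul_nonneg h2 hcoef
  simp only [mul_zero, add_zero, zero_add]
  nlinarith

/-- The curve from `(0, ξ*)` is tangent to `x + y = K` at the crossing point. With time counted from
there, in either direction, the two terms of `flow_sum_eq` have opposite coefficients, and `expInt
(λ - 1) ≤ expInt (λ + 1)` keeps the sum above `K`. -/
theorem mem_aboveLevel_of_cross (hp : p.Valid)
    (h : ¬ (1 ≤ p.lam ∨ (p.lam + p.mu) / p.c ≤ p.lam / (1 - p.lam))) :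
    (0, flowY p (-backTime p) (crossY p)) ∈ aboveLevel p := by
  push Not at h
  obtain ⟨h1, h2⟩ := h
  have hl := hp.lam_pos
  have hX := hp.driftX_pos
  have hcross : 0 < crossX p := by
    rw [div_lt_iff₀ (by linarith)] at h2
    have h3 : p.lam * √2 < (p.lam + p.mu) / p.c * (1 - p.lam) * √2 :=
      mul_lt_mul_of_pos_right h2 (by positivity)
    unfold crossX level
    linarith
  have hk : p.lam * (1 - p.m) / (√2 * (p.lam + 1)) = p.driftX / (p.lam + 1) := by
    unfold Params.driftX
    rw [div_div]
  have hk0 : 0 < p.driftX / (p.lam + 1) := by positivity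
  have hback : (p.lam + 1) * backTime p = Real.log (1 + crossX p / (p.driftX / (p.lam + 1))) := by
    unfold backTime
    rw [hk]
    field_simp
  have hstart : flow p (backTime p) (0, flowY p (-backTime p) (crossY p)) =
      (crossX p, crossY p) := by
    have h3 := flow_add hp (-backTime p) (backTime p) (0, crossY p)
    rw [neg_add_cancel, flow_zero hp] at h3
    refine Prod.ext ?_ (congrArg Prod.snd h3).symm
    simp only [flow, flowX_eq hp, mul_zero, zero_add]
    have h4 := mul_expInt (p.lam + 1) (backTime p)
    rw [hback, Real.exp_log (by positivity)] at h4
    field_simp at h4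
    exact mul_left_cancel₀ (by positivity : p.lam + 1 ≠ 0) (by linarith)
  intro t _
  have h3 := flow_add hp (backTime p) (t - backTime p) (0, flowY p (-backTime p) (crossY p))
  rw [add_sub_cancel, hstart] at h3
  rw [h3, flow_sum_eq hp]
  have h4 : expInt (p.lam - 1) (t - backTime p) ≤ expInt (p.lam + 1) (t - backTime p) :=
    expInt_le_expInt (by linarith) _
  have h5 := driftX_add_driftY p
  have h6 : p.driftY + (p.lam - 1) * crossY p = -(p.driftX + (p.lam + 1) * crossX p) := by
    unfold crossY crossX
    linear_combination h5
  have h7 : crossX p + crossY p = level p := by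
    unfold crossY
    ring
  have h8 : 0 ≤ p.driftX + (p.lam + 1) * crossX p := by positivity
  have h9 := mul_le_mul_of_nonneg_right h4 h8
  dsimp only
  rw [h6, h7]
  linarith

theorem threshold_mem_aboveLevel (hp : p.Valid) : (0, threshold p) ∈ aboveLevel p := by
  unfold threshold
  split_ifs with h
  · exact mem_aboveLevel_of_level hp h
  · exact mem_aboveLevel_of_cross hp h

theorem level_le_threshold (hp : p.Valid) : level p ≤ threshold p := by
  have h := threshold_mem_aboveLevel hp 0 le_rfl
  rw [flow_zero hp] at h
  simpa using h

/-- Mass in the first coordinate grows faster than mass in the second, so `(0, ξ*)` is the worst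
start on or beyond the line `x + y = ξ*`. -/
theorem mem_aboveLevel_of_threshold_le (hp : p.Valid) {φ : ℝ × ℝ} (hφ : φ ∈ quadrant)
    (h : threshold p ≤ φ.1 + φ.2) : φ ∈ aboveLevel p := by
  intro t ht
  refine (threshold_mem_aboveLevel hp t ht).trans ?_
  have he : Real.exp ((p.lam - 1) * t) ≤ Real.exp ((p.lam + 1) * t) :=
    Real.exp_le_exp.2 (by nlinarith)
  have h1 := mul_le_mul_of_nonneg_right he hφ.1
  have h2 := mul_le_mul_of_nonneg_left h (Real.exp_pos ((p.lam - 1) * t)).le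
  simp only [flow, flowX_eq hp, flowY_eq p, mul_zero, zero_add]
  linarith

/-! ### The exit time from the triangle -/

/-- The part of the quadrant outside the triangle. -/
def farRegion (p : Params) : Set (ℝ × ℝ) := {φ | φ ∈ quadrant ∧ threshold p ≤ φ.1 + φ.2}

theorem isClosed_farRegion : IsClosed (farRegion p) :=
  isClosed_quadrant.inter (isClosed_le continuous_const (continuous_fst.add continuous_snd))

theorem farRegion_subset [IsProbabilityMeasure P] (hp : p.Valid)
    (hN : IsPoissonProcess N p.mu P) : farRegion p ⊆ nearStop p P N 0 := fun φ hφ =>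
  ⟨hφ.1, by
    rw [add_zero]
    exact bound_le_valueLim hp hN (mem_aboveLevel_of_threshold_le hp hφ.1 hφ.2)⟩

theorem exitTime_ae (hp : p.Valid) (hN : IsPoissonProcess N p.mu P) {φ : ℝ × ℝ}
    (hφ : φ ∈ quadrant) :
    exitTime p N φ =ᵐ[P] fun ω => hit p φ (farRegion p) (pathOf N ω) :=
  hitTime_process_ae hp hN hφ fun ψ hψ => by
    simp [triangle, farRegion, hψ]

theorem isStop_exitTime [IsProbabilityMeasure P] (hp : p.Valid) (hN : IsPoissonProcess N p.mu P)
    {φ : ℝ × ℝ} (hφ : φ ∈ quadrant) :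
    IsStop (obsFiltration N P hN.measurable) (exitTime p N φ) :=
  isStop_congr (exitTime_ae hp hN hφ) (isStop_hit hp hN φ isClosed_farRegion)

theorem hitU_zero_le_exitTime [IsProbabilityMeasure P] (hp : p.Valid)
    (hN : IsPoissonProcess N p.mu P) {φ : ℝ × ℝ} (hφ : φ ∈ quadrant) :
    ∀ᵐ ω ∂P, hitU p P N hN.measurable 0 φ ω ≤ exitTime p N φ ω := by
  filter_upwards [hitU_ae hp hN le_rfl hφ, exitTime_ae hp hN hφ] with ω h1 h2
  rw [h1, h2, ENNReal.ofReal_zero]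
  exact hit_anti (farRegion_subset hp hN)

theorem exists_threshold_le (hp : p.Valid) : ∃ n : ℕ, threshold p ≤
    (1 + 1 / p.mu) ^ n * Real.exp (p.lam - 1) * (p.driftY * expInt (p.lam - 1) 1) := by
  have h1 : 0 < Real.exp (p.lam - 1) * (p.driftY * expInt (p.lam - 1) 1) :=
    mul_pos (Real.exp_pos _) (mul_pos hp.driftY_pos (expInt_pos _ one_pos))
  obtain ⟨n, hn⟩ := pow_unbounded_of_one_lt
    (threshold p / (Real.exp (p.lam - 1) * (p.driftY * expInt (p.lam - 1) 1)))
    (by linarith [hp.inv_mu_pos] : 1 < 1 + 1 / p.mu)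
  refine ⟨n, ?_⟩
  rw [div_lt_iff₀ h1] at hn
  linarith

/-- Sufficiently many jumps in one time unit lead out of the triangle. -/
theorem IsStepPath.hit_farRegion_le {w : ℝ≥0 → ℕ} (hw : IsStepPath w) (hp : p.Valid) {φ : ℝ × ℝ}
    (hφ : φ ∈ quadrant) {n : ℕ} (hn : threshold p ≤
      (1 + 1 / p.mu) ^ n * Real.exp (p.lam - 1) * (p.driftY * expInt (p.lam - 1) 1))
    {s : ℝ≥0} (hs : 1 ≤ s) (hjump : n ≤ w (s + 1) - w s) :
    hit p φ (farRegion p) w ≤ ((s + 1 : ℝ≥0) : ℝ≥0∞) := by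
  have hq := hw.pos_mem_quadrant hp hφ (s + 1)
  refine hit_le ⟨hq, ?_⟩
  -- The requirement `1 ≤ s` gives the drift time to lift the second coordinate away from zero,
  -- uniformly in the start; jumps alone cannot do this.
  have h1 : p.driftY * expInt (p.lam - 1) 1 ≤ (pos p φ s w).2 :=
    (mul_le_mul_of_nonneg_left (expInt_mono (by exact_mod_cast hs)) hp.driftY_pos.le).trans
      (hw.le_pos_snd hp hφ s)
  have h2 := (hw.shiftPath s).pow_mul_le_pos_snd hp (pos p φ s w) 1
  rw [← hw.pos_add hp] at h2
  have hb : 1 ≤ 1 + 1 / p.mu := by linarith [hp.inv_mu_pos]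
  have h3 : (1 + 1 / p.mu) ^ n ≤ (1 + 1 / p.mu) ^ PoissonDisorder.shiftPath s w 1 :=
    pow_le_pow_right₀ hb hjump
  have h0 : 0 ≤ p.driftY * expInt (p.lam - 1) 1 :=
    mul_nonneg hp.driftY_pos.le (expInt_nonneg _ zero_le_one)
  have h4 : (1 + 1 / p.mu) ^ n * Real.exp (p.lam - 1) * (p.driftY * expInt (p.lam - 1) 1) ≤
      (1 + 1 / p.mu) ^ PoissonDisorder.shiftPath s w 1 * Real.exp (p.lam - 1) *
        (pos p φ s w).2 := by gcongr
  rw [NNReal.coe_one, mul_one] at h2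
  linarith [hq.1]

theorem le_tsum_indicator (x : ℝ≥0∞) : x ≤ ∑' n : ℕ, if (n : ℝ≥0∞) < x then 1 else 0 := by
  refine ENNReal.le_of_forall_nnreal_lt fun r hr => ?_
  have hsum : (∑ n ∈ Finset.range (⌊r⌋₊ + 1), if (n : ℝ≥0∞) < x then (1 : ℝ≥0∞) else 0) =
      ((⌊r⌋₊ + 1 : ℕ) : ℝ≥0∞) := by
    rw [Finset.sum_congr rfl (g := fun _ => (1 : ℝ≥0∞))]
    · simp
    · intro n hn
      rw [if_pos]
      refine lt_of_le_of_lt ?_ hr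
      have h1 : n ≤ ⌊r⌋₊ := Nat.lt_succ_iff.1 (Finset.mem_range.1 hn)
      have h2 : (n : ℝ≥0) ≤ r := (Nat.cast_le.2 h1).trans (Nat.floor_le zero_le)
      exact_mod_cast h2
  refine le_trans ?_ (ENNReal.sum_le_tsum (Finset.range (⌊r⌋₊ + 1)))
  rw [hsum]
  exact_mod_cast (Nat.lt_floor_add_one r).le

/-- If the process is still inside after time `k + 1`, each of the `k` unit intervals from `1` to `k
+ 1` had fewer than `n` jumps, and these counts are independent. The interval `[0, 1]` is given up
to the drift. -/
theorem measure_lt_hit_le [IsProbabilityMeasure P] (hp : p.Valid)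
    (hN : IsPoissonProcess N p.mu P) {φ : ℝ × ℝ} (hφ : φ ∈ quadrant) {n : ℕ}
    (hn : threshold p ≤
      (1 + 1 / p.mu) ^ n * Real.exp (p.lam - 1) * (p.driftY * expInt (p.lam - 1) 1)) (k : ℕ) :
    P {ω | ((k + 1 : ℕ) : ℝ≥0∞) < hit p φ (farRegion p) (pathOf N ω)} ≤
      poissonMeasure p.mu.toNNReal (Set.Iio n) ^ k := by
  set d := increment N fun j : ℕ => (j : ℝ≥0) with hd
  have hind : iIndepFun d P := hN.indep.nat fun i j h => Nat.cast_le.2 h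
  have hlaw : ∀ j, P (d j ⁻¹' Set.Iio n) = poissonMeasure p.mu.toNNReal (Set.Iio n) := fun j => by
    have h := hN.law j (j + 1 : ℕ) (by exact_mod_cast Nat.le_succ j)
    have h1 : p.mu.toNNReal * (((j + 1 : ℕ) : ℝ≥0) - j) = p.mu.toNNReal := by
      rw [Nat.cast_succ, add_tsub_cancel_left, mul_one]
    rw [h1] at h
    rw [← h.map_eq, Measure.map_apply_of_aemeasurable h.aemeasurable measurableSet_Iio]
    rfl
  calc P {ω | ((k + 1 : ℕ) : ℝ≥0∞) < hit p φ (farRegion p) (pathOf N ω)}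
      ≤ P (⋂ j ∈ Finset.Ico 1 (k + 1), d j ⁻¹' Set.Iio n) := by
        refine measure_mono_ae ?_
        filter_upwards [hN.isStepPath] with ω hω hlt
        refine Set.mem_iInter₂.2 fun j hj => ?_
        rw [Finset.mem_Ico] at hj
        by_contra hcon
        have h1 : n ≤ pathOf N ω ((j : ℝ≥0) + 1) - pathOf N ω j := by
          have := not_lt.1 (show ¬ d j ω < n from hcon)
          simpa [hd, increment, pathOf] using this
        have h2 := hω.hit_farRegion_le hp hφ hn (by exact_mod_cast hj.1) h1
        refine absurd (lt_of_lt_of_le hlt h2) (not_lt.2 ?_)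
        exact_mod_cast (by omega : j + 1 ≤ k + 1)
    _ = ∏ j ∈ Finset.Ico 1 (k + 1), P (d j ⁻¹' Set.Iio n) :=
        hind.measure_inter_preimage_eq_mul _ fun _ _ => measurableSet_Iio
    _ = _ := by simp [hlaw]

theorem poissonMeasure_Iio_lt_one {r : ℝ≥0} (hr : 0 < r) (n : ℕ) :
    poissonMeasure r (Set.Iio n) < 1 := by
  have h1 : 0 < poissonMeasure r {n} := by
    have := poissonMeasure_real_singleton_pos n hr
    rw [measureReal_def] at this
    exact (ENNReal.toReal_pos_iff.1 this).1
  have h2 : poissonMeasure r (Set.Iio n) + poissonMeasure r {n} ≤ 1 := by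
    rw [← measure_union (by simp) (measurableSet_singleton n)]
    exact prob_le_one
  exact (ENNReal.lt_add_right (measure_ne_top _ _) h1.ne').trans_le h2

theorem lintegral_exitTime_lt_top [IsProbabilityMeasure P] (hp : p.Valid)
    (hN : IsPoissonProcess N p.mu P) {φ : ℝ × ℝ} (hφ : φ ∈ quadrant) :
    ∫⁻ ω, exitTime p N φ ω ∂P < ⊤ := by
  obtain ⟨n, hn⟩ := exists_threshold_le hp
  have hae := (isStop_hit hp hN φ (isClosed_farRegion (p := p))).aemeasurable
  set τ : Ω → ℝ≥0∞ := fun ω => hit p φ (farRegion p) (pathOf N ω) with hτ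
  set q := poissonMeasure p.mu.toNNReal (Set.Iio n) with hq
  have hq1 : q < 1 := poissonMeasure_Iio_lt_one (Real.toNNReal_pos.2
    (by linarith [hp.one_lt_mu])) n
  rw [lintegral_congr_ae (exitTime_ae hp hN hφ)]
  have hset : ∀ k : ℕ, NullMeasurableSet {ω | (k : ℝ≥0∞) < τ ω} P := fun k =>
    hae.nullMeasurable measurableSet_Ioi
  calc ∫⁻ ω, τ ω ∂P ≤ ∫⁻ ω, ∑' k : ℕ, {ω | (k : ℝ≥0∞) < τ ω}.indicator 1 ω ∂P := by
        refine lintegral_mono fun ω => (le_tsum_indicator (τ ω)).trans (le_of_eq ?_)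
        refine tsum_congr fun k => ?_
        simp [Set.indicator_apply]
    _ = ∑' k : ℕ, P {ω | (k : ℝ≥0∞) < τ ω} := by
        have hm : ∀ k : ℕ, AEMeasurable ({ω | (k : ℝ≥0∞) < τ ω}.indicator (1 : Ω → ℝ≥0∞)) P :=
          fun k => (measurable_one.aemeasurable).indicator₀ (hset k)
        rw [lintegral_tsum hm]
        exact tsum_congr fun k => lintegral_indicator_one₀ (hset k)
    _ ≤ 1 + ∑' k : ℕ, q ^ k := by
        -- The tail estimate starts at `k + 1`, so the term at `0` is bounded by total mass one.
        rw [tsum_eq_zero_add' ENNReal.summable]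
        exact add_le_add prob_le_one
          (ENNReal.tsum_le_tsum fun k => measure_lt_hit_le hp hN hφ hn k)
    _ < ⊤ := by
        rw [ENNReal.tsum_geometric, ENNReal.add_lt_top]
        exact ⟨ENNReal.one_lt_top, ENNReal.inv_lt_top.2 (tsub_pos_of_lt hq1)⟩

end

end PoissonDisorder

end

theorem proposition5p12 {Ω : Type*} [MeasurableSpace Ω] (P : Measure Ω) [IsProbabilityMeasure P]
    (p : Params) (hlam : 0 < p.lam) (hmu : 1 < p.mu) (hc : 0 < p.c) (hm : p.m ∈ Set.Ioo (-1) 1)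
    (N : ℝ≥0 → Ω → ℕ) (hN : IsPoissonProcess N p.mu P) :
    -- for every `ε ≥ 0`, `U_ε` is a stopping time and is `ε`-optimal
    (∀ ε : ℝ, 0 ≤ ε → ∀ φ ∈ quadrant,
      IsStop (obsFiltration N P hN.measurable) (hitU p P N hN.measurable ε φ) ∧
      expectedCost p P N φ (hitU p P N hN.measurable ε φ) ≤
        value p P N hN.measurable φ + (ε : EReal)) ∧
    -- `U_0` is the first entrance time into `Γ`, and it is optimal
    (∀ φ ∈ quadrant,
      hitU p P N hN.measurable 0 φ
        =ᵐ[P] hitTime (process p N φ) (stopRegion p P N hN.measurable) ∧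
      expectedCost p P N φ (hitU p P N hN.measurable 0 φ) = value p P N hN.measurable φ) ∧
    -- `U_0` is bounded by the exit time `τ_D` from `D`, and both have finite expectation
    level p ≤ threshold p ∧
    (∀ φ ∈ quadrant,
      IsStop (obsFiltration N P hN.measurable) (exitTime p N φ) ∧
      (∀ᵐ ω ∂P, hitU p P N hN.measurable 0 φ ω ≤ exitTime p N φ ω) ∧
      ∫⁻ ω, hitU p P N hN.measurable 0 φ ω ∂P < ∞ ∧
      ∫⁻ ω, exitTime p N φ ω ∂P < ∞) := by
  have hp : p.Valid := ⟨hlam, hmu, hc, hm.1, hm.2⟩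
  refine ⟨fun ε hε φ hφ => ⟨isStop_hitU hp hN hε hφ, expectedCost_hitU_le hp hN hε hφ⟩,
    fun φ hφ => ⟨hitU_zero_ae_hitTime_stopRegion hp hN hφ, expectedCost_hitU_zero hp hN hφ⟩,
    level_le_threshold hp, fun φ hφ => ?_⟩
  exact ⟨isStop_exitTime hp hN hφ, hitU_zero_le_exitTime hp hN hφ,
    (lintegral_mono_ae (hitU_zero_le_exitTime hp hN hφ)).trans_lt
      (lintegral_exitTime_lt_top hp hN hφ), lintegral_exitTime_lt_top hp hN hφ⟩
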